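/- \textbf{Setting.} Let $(\xi_n)_{n\in\mathbb Z}$ be a two-sided stationary sequence on a probability space $(\Omega_0,\mathscr F,\mathbf P)$ with values in a measurable space $\mathcal Y$, let $\mathbb P$ be its law on $\Omega=\mathcal Y^{\mathbb Z}$, and let $\sigma$ be the left shift on $\Omega$. Let $(X,\mathcal B,m)$ be a probability space and let $v$ assign to each measurable $f:X\to\mathbb C$ a variation $v(f)\in[0,\infty]$ with $v(cf)=|c|v(f)$ for $c\in\mathbb R$, $v(f+g)\le v(f)+v(g)$, $v(fg)\le \sup|f|\,v(g)+\sup|g|\,v(f)$, $\sup|f|\le C_0(v(f)+\|f\|_{L^1(m)})$ for a constant $C_0$, and $v(f)=0$ for constant $f$. Put $\|f\|_{BV}=\|f\|_{L^1(m)}+v(f)$; for functions determined only up to $m$-a.e. equality, $\|\cdot\|_{BV}$ is the infimum over measurable versions. Let $T_y:X\to X$, $y\in\mathcal Y$, be maps such that, with $T_\omega=T_{\omega_0}$, the skew product $\tau(\omega,x)=(\sigma\omega,T_\omega x)$ is measurable and $T_\omega$ is nonsingular with respect to $m$ for $\mathbb P$-a.e. $\omega$. Let $\mathcal L_\omega$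 be the transfer operator, $\int g\cdot(f\circ T_\omega)\,dm=\int(\mathcal L_\omega g)f\,dm$ for $g\in L^1(m)$, $f\in L^\infty(m)$, and $\mathcal L_\omega^n=\mathcal L_{\sigma^{n-1}\omega}\circ\dots\circ\mathcal L_\omega$. \textbf{Standing assumption.} (1) There is a measurable $h:\Omega\times X\to[0,\infty)$ such that $d\mu=h\,dm\,d\mathbb P$ is a $\tau$-invariant probability measure and, for $\mathbb P$-a.e. $\omega$, $h_\omega=h(\omega,\cdot)$ satisfies $\|h_\omega\|_{BV}<\infty$, $\int h_\omega\,dm=1$, $h_\omega>0$ $m$-a.e. and $\mathcal L_\omega h_\omega=h_{\sigma\omega}$. (2) There are $\lambda>0$, $0<\varepsilon<\lambda/3$ and a random variable $K:\Omega\to[1,\infty)$ such that for $\mathbb P$-a.e. $\omega$: $\frac1n\ln K(\sigma^n\omega)\to0$ as $n\to\infty$; $K(\omega)e^{-\varepsilon|n|}\le K(\sigma^n\omega)\le K(\omega)e^{\varepsilon|n|}$ for all $n\in\mathbb Z$; and, for all $n\ge1$ and all measurable $g:X\to\mathbb C$, $$\|\mathcal L^n_\omega\mathbf 1-h_{\sigma^n\omega}\|_{BV}\le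 K(\omega)e^{-\lambda n},\qquad v(g\circ T_\omega)\le K(\omega)v(g),\qquad \|L_\omega^ng-\mu_\omega(g)\mathbf 1\|_{BV}\le K(\omega)\|g\|_{BV}e^{-\lambda n},$$ where $\mu_\omega=h_\omega\,dm$, $L_\omega g=\mathcal L_\omega(gh_\omega)/h_{\sigma\omega}$ and $L^n_\omega=L_{\sigma^{n-1}\omega}\circ\dots\circ L_\omega$; the last inequality is required when $\|g\|_{BV}<\infty$. \textbf{Mixing.} Let $\alpha_n=\sup_{k}\sup\{|\mathbf P(A\cap B)-\mathbf P(A)\mathbf P(B)|: A\in\sigma(\xi_j,\,j\le k),\ B\in\sigma(\xi_j,\,j\ge k+n)\}$, and suppose that $\alpha_n\le c_1e^{-c_2n^\eta}$ for all $n\ge1$, with constants $c_1,c_2,\eta>0$. Put $\gamma=1/\eta$. \textbf{Theorem.} Let $\varphi:\Omega\times X\to\mathbb R$ be a measurable observable of the form $\varphi(\omega,x)=\varphi_{\omega_0}(x)$, write $\varphi_\omega=\varphi(\omega,\cdot)$, and suppose that $\int\varphi\,d\mu=0$ and $\|\varphi\|_K:=\operatorname{ess\,sup}_{\omega}\big(K(\omega)\|\varphi_\omega\|_{BV}\big)<\infty$.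 Let $S_n=\sum_{j=0}^{n-1}\varphi\circ\tau^j$. Then there are constants $a_1,a_2>0$, depending only on $c_1,c_2,\eta,\lambda,C_0$ and (an upper bound for) $\|\varphi\|_K$, such that for all $x>0$ and all integers $n\ge1$, $$\mu\big(n^{-1/2}S_n\ge x\big)\le\exp\left(-\frac{x^2}{2\big(a_1+a_2\,x\,n^{-\frac1{2+4\gamma}}\big)^{\frac{1+2\gamma}{1+\gamma}}}\right).$$ -/

import Mathlib

open MeasureTheory Filter Topology
open scoped ENNReal NNReal

namespace RandomSkew

noncomputable section

/-! ## The driving process and its mixing coefficients -/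

/-- A two-sided process is stationary if its law on path space is invariant under all shifts of
the time. -/
def IsStationary {Ω₀ Y : Type*} [MeasurableSpace Ω₀] [MeasurableSpace Y]
    (Q : Measure Ω₀) (ξ : ℤ → Ω₀ → Y) : Prop :=
  ∀ k : ℤ, Q.map (fun w => fun j : ℤ => ξ (j + k) w) = Q.map (fun w => fun j : ℤ => ξ j w)

/-- The law of the process on the path space `ℤ → Y` with its product σ-algebra. -/
def pathLaw {Ω₀ Y : Type*} [MeasurableSpace Ω₀] [MeasurableSpace Y]
    (Q : Measure Ω₀) (ξ : ℤ → Ω₀ → Y) : Measure (ℤ → Y) :=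
  Q.map (fun w => fun j : ℤ => ξ j w)

/-- The `α`-dependence coefficient of two σ-algebras `𝒢`, `ℋ`:
`sup {|Q(A ∩ B) - Q(A) Q(B)| : A ∈ 𝒢, B ∈ ℋ}`. -/
def alphaDep {Ω₀ : Type*} [MeasurableSpace Ω₀] (Q : Measure Ω₀)
    (𝒢 ℋ : MeasurableSpace Ω₀) : ℝ :=
  sSup {a : ℝ | ∃ A B : Set Ω₀, MeasurableSet[𝒢] A ∧ MeasurableSet[ℋ] B ∧
    a = |Q.real (A ∩ B) - Q.real A * Q.real B|}

/-- The σ-algebra generated by `ξ j`, `j ≤ k`. -/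
@[reducible] def pastSigma {Ω₀ Y : Type*} [MeasurableSpace Y] (ξ : ℤ → Ω₀ → Y) (k : ℤ) :
    MeasurableSpace Ω₀ :=
  ⨆ (j : ℤ) (_ : j ≤ k), MeasurableSpace.comap (ξ j) inferInstance

/-- The σ-algebra generated by `ξ j`, `j ≥ k`. -/
@[reducible] def futureSigma {Ω₀ Y : Type*} [MeasurableSpace Y] (ξ : ℤ → Ω₀ → Y) (k : ℤ) :
    MeasurableSpace Ω₀ :=
  ⨆ (j : ℤ) (_ : k ≤ j), MeasurableSpace.comap (ξ j) inferInstance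

/-- The `n`-th `α`-mixing coefficient of the process. -/
def alphaCoeff {Ω₀ Y : Type*} [MeasurableSpace Ω₀] [MeasurableSpace Y]
    (Q : Measure Ω₀) (ξ : ℤ → Ω₀ → Y) (n : ℕ) : ℝ :=
  ⨆ k : ℤ, alphaDep Q (pastSigma ξ k) (futureSigma ξ (k + n))

/-! ## The skew product -/

/-- The `k`-th power `σ ^ k` of the left shift on `ℤ → Y`. -/
def shift {Y : Type*} (k : ℤ) (ω : ℤ → Y) : ℤ → Y := fun j => ω (j + k)

/-- The skew product `τ (ω, x) = (σ ω, T_{ω₀} x)`. -/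
def skewProduct {Y X : Type*} (T : Y → X → X) (z : (ℤ → Y) × X) : (ℤ → Y) × X :=
  (shift 1 z.1, T (z.1 0) z.2)

/-- The sums `S_n φ = ∑_{j < n} φ ∘ τ ^ j` of the observable `(ω, x) ↦ φ ω₀ x`. -/
def skewSum {Y X : Type*} (T : Y → X → X) (φ : Y → X → ℝ) (n : ℕ) (z : (ℤ → Y) × X) : ℝ :=
  birkhoffSum (skewProduct T) (fun z' => φ (z'.1 0) z'.2) n z

/-- The measure `dμ = h(ω, x) dm(x) dP(ω)`. -/
def skewMeasure {Y X : Type*} [MeasurableSpace Y] [MeasurableSpace X]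
    (P : Measure (ℤ → Y)) (m : Measure X) (h : (ℤ → Y) → X → ℝ) : Measure ((ℤ → Y) × X) :=
  (P.prod m).withDensity (fun z => ENNReal.ofReal (h z.1 z.2))

/-! ## Variation and BV norms -/

/-- `v` is a notion of variation for (measurable, complex valued) functions on `(X, m)`, with
constant `C₀` in the comparison of the supremum with the BV norm. -/
structure IsVariation {X : Type*} [MeasurableSpace X] (m : Measure X) (C₀ : ℝ≥0)
    (v : (X → ℂ) → ℝ≥0∞) : Prop where
  smul : ∀ (c : ℝ) (f : X → ℂ), Measurable f →
    v (fun x => (c : ℂ) * f x) = ENNReal.ofReal |c| * v f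
  add_le : ∀ f g : X → ℂ, Measurable f → Measurable g →
    v (fun x => f x + g x) ≤ v f + v g
  mul_le : ∀ f g : X → ℂ, Measurable f → Measurable g →
    v (fun x => f x * g x) ≤ (⨆ x, ‖f x‖ₑ) * v g + (⨆ x, ‖g x‖ₑ) * v f
  sup_le : ∀ f : X → ℂ, Measurable f →
    (⨆ x, ‖f x‖ₑ) ≤ (C₀ : ℝ≥0∞) * (v f + ∫⁻ x, ‖f x‖ₑ ∂m)
  const : ∀ c : ℂ, v (fun _ => c) = 0

/-- The BV norm `‖f‖_BV = ‖f‖_{L¹(m)} + v(f)` of a function. -/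
def bvNorm {X : Type*} [MeasurableSpace X] (m : Measure X) (v : (X → ℂ) → ℝ≥0∞)
    (f : X → ℂ) : ℝ≥0∞ :=
  (∫⁻ x, ‖f x‖ₑ ∂m) + v f

/-- The BV norm of the class of `f` modulo `m`-a.e. equality: the infimum of the BV norm over all
measurable versions of `f`. It is used for functions that are only determined almost everywhere,
such as densities and images under transfer operators. -/
def bvNormAE {X : Type*} [MeasurableSpace X] (m : Measure X) (v : (X → ℂ) → ℝ≥0∞)
    (f : X → ℂ) : ℝ≥0∞ :=
  ⨅ (g : X → ℂ) (_ : Measurable g ∧ g =ᵐ[m] f), bvNorm m v g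

/-! ## Transfer operators -/

/-- The transfer operator of `S : X → X` with respect to `m`: `𝓛 g` is the density with respect
to `m` of the image under `S` of the complex measure `g dm`. -/
def transfer {X : Type*} [MeasurableSpace X] (m : Measure X) (S : X → X) (g : X → ℂ) : X → ℂ :=
  ComplexMeasure.rnDeriv ((m.withDensityᵥ g).map S) m

theorem integrable_transfer {X : Type*} [MeasurableSpace X] (m : Measure X) (S : X → X)
    (g : X → ℂ) : Integrable (transfer m S g) m :=
  ComplexMeasure.integrable_rnDeriv _ _

/-- The duality relation `∫ 𝓛g · f dm = ∫ g · (f ∘ S) dm`, for indicators `f`, which determines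
`𝓛g` up to `m`-a.e. equality. -/
theorem setIntegral_transfer {X : Type*} [MeasurableSpace X] (m : Measure X)
    [IsFiniteMeasure m] (S : X → X) (hS : Measure.QuasiMeasurePreserving S m m)
    (g : X → ℂ) (hg : Integrable g m) (A : Set X) (hA : MeasurableSet A) :
    ∫ x in A, transfer m S g x ∂m = ∫ x in S ⁻¹' A, g x ∂m := by
  set c : ComplexMeasure X := (m.withDensityᵥ g).map S with hc
  have hcA : ∀ B, MeasurableSet B → c B = ∫ x in S ⁻¹' B, g x ∂m := fun B hB => by
    rw [hc, VectorMeasure.map_apply _ hS.measurable hB,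
      withDensityᵥ_apply hg (hS.measurable hB)]
  have h0 : ∀ B, MeasurableSet B → m B = 0 → c B = 0 := fun B hB hB0 => by
    rw [hcA B hB]
    exact Measure.restrict_eq_zero.2 (hS.preimage_null hB0) ▸ integral_zero_measure _
  have hre : m.withDensityᵥ (c.re.rnDeriv m) = c.re := by
    rw [← SignedMeasure.absolutelyContinuous_iff_withDensityᵥ_rnDeriv_eq]
    refine VectorMeasure.AbsolutelyContinuous.mk fun B hB hB0 => ?_
    rw [Measure.toENNRealVectorMeasure_apply_measurable hB] at hB0
    change (c B).re = 0
    rw [h0 B hB hB0, Complex.zero_re]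
  have him : m.withDensityᵥ (c.im.rnDeriv m) = c.im := by
    rw [← SignedMeasure.absolutelyContinuous_iff_withDensityᵥ_rnDeriv_eq]
    refine VectorMeasure.AbsolutelyContinuous.mk fun B hB hB0 => ?_
    rw [Measure.toENNRealVectorMeasure_apply_measurable hB] at hB0
    change (c B).im = 0
    rw [h0 B hB hB0, Complex.zero_im]
  rw [← hcA A hA]
  have hi := (integrable_transfer m S g).integrableOn (s := A)
  apply Complex.ext
  · rw [← RCLike.re_eq_complex_re, ← integral_re hi]
    change ∫ x in A, c.re.rnDeriv m x ∂m = c.re A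
    rw [← withDensityᵥ_apply (SignedMeasure.integrable_rnDeriv _ _) hA, hre]
  · rw [← RCLike.im_eq_complex_im, ← integral_im hi]
    change ∫ x in A, c.im.rnDeriv m x ∂m = c.im A
    rw [← withDensityᵥ_apply (SignedMeasure.integrable_rnDeriv _ _) hA, him]

/-- The iterates `𝓛_ω^n = 𝓛_{σ^{n-1}ω} ∘ ⋯ ∘ 𝓛_{σω} ∘ 𝓛_ω`, where `𝓛_ω` is the transfer operator
of `T_ω = T_{ω₀}`. -/
def transferIter {Y X : Type*} [MeasurableSpace X] (m : Measure X) (T : Y → X → X)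
    (ω : ℤ → Y) : ℕ → (X → ℂ) → (X → ℂ)
  | 0, g => g
  | n + 1, g => transfer m (T (shift n ω 0)) (transferIter m T ω n g)

/-- The normalized operator `L_ω g = 𝓛_ω(g h_ω) / h_{σω}`. -/
def normTransfer {Y X : Type*} [MeasurableSpace X] (m : Measure X) (T : Y → X → X)
    (h : (ℤ → Y) → X → ℝ) (ω : ℤ → Y) (g : X → ℂ) : X → ℂ :=
  fun x => transfer m (T (ω 0)) (fun y => g y * (h ω y : ℂ)) x / (h (shift 1 ω) x : ℂ)

/-- The iterates `L_ω^n = L_{σ^{n-1}ω} ∘ ⋯ ∘ L_{σω} ∘ L_ω`. -/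
def normTransferIter {Y X : Type*} [MeasurableSpace X] (m : Measure X) (T : Y → X → X)
    (h : (ℤ → Y) → X → ℝ) (ω : ℤ → Y) : ℕ → (X → ℂ) → (X → ℂ)
  | 0, g => g
  | n + 1, g => normTransfer m T h (shift n ω) (normTransferIter m T h ω n g)

/-! ## The standing assumption on the random maps -/

/-- The standing assumption on the family `T`, the law `P` of the driving process, the densities
`h_ω`, the random variable `K`, the rate `lam` and the slow variation rate `eps` of `K`. -/
structure StandingAssumption {Y X : Type*} [MeasurableSpace Y] [MeasurableSpace X]
    (P : Measure (ℤ → Y)) (m : Measure X) (T : Y → X → X) (v : (X → ℂ) → ℝ≥0∞)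
    (h : (ℤ → Y) → X → ℝ) (K : (ℤ → Y) → ℝ) (lam eps : ℝ) : Prop where
  /-- the skew product is measurable -/
  measurable_skew : Measurable (skewProduct (Y := Y) T)
  /-- the maps are nonsingular, so that the transfer operators are defined -/
  nonsingular : ∀ᵐ ω ∂P, Measure.QuasiMeasurePreserving (T (ω 0)) m m
  /-- the density is measurable and nonnegative -/
  measurable_h : Measurable (Function.uncurry h)
  h_nonneg : ∀ ω x, 0 ≤ h ω x
  /-- `μ` is a `τ`-invariant probability measure -/
  prob : IsProbabilityMeasure (skewMeasure P m h)
  invariant : MeasurePreserving (skewProduct T) (skewMeasure P m h) (skewMeasure P m h)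
  h_bv : ∀ᵐ ω ∂P, bvNormAE m v (fun x => (h ω x : ℂ)) < ∞
  h_mass : ∀ᵐ ω ∂P, ∫ x, h ω x ∂m = 1
  h_pos : ∀ᵐ ω ∂P, ∀ᵐ x ∂m, 0 < h ω x
  h_equivariant : ∀ᵐ ω ∂P,
    transfer m (T (ω 0)) (fun x => (h ω x : ℂ)) =ᵐ[m] fun x => (h (shift 1 ω) x : ℂ)
  /-- `K ≥ 1` is a tempered random variable -/
  measurable_K : Measurable K
  one_le_K : ∀ ω, 1 ≤ K ω
  tempered : ∀ᵐ ω ∂P,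
    Tendsto (fun n : ℕ => (1 / (n : ℝ)) * Real.log (K (shift n ω))) atTop (𝓝 0)
  /-- `K` varies slowly along orbits -/
  eps_pos : 0 < eps
  eps_lt : eps < lam / 3
  slow : ∀ᵐ ω ∂P, ∀ n : ℤ, K ω * Real.exp (-eps * |(n : ℝ)|) ≤ K (shift n ω) ∧
    K (shift n ω) ≤ K ω * Real.exp (eps * |(n : ℝ)|)
  /-- `‖𝓛_ω^n 1 - h_{σ^n ω}‖_BV ≤ K(ω) e^{-λ n}` -/
  decay_density : ∀ᵐ ω ∂P, ∀ n : ℕ, 1 ≤ n →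
    bvNormAE m v (fun x => transferIter m T ω n (fun _ => 1) x - (h (shift n ω) x : ℂ)) ≤
      ENNReal.ofReal (K ω * Real.exp (-lam * n))
  /-- `v(g ∘ T_ω) ≤ v(g) K(ω)` -/
  variation_comp : ∀ᵐ ω ∂P, ∀ g : X → ℂ, Measurable g →
    v (fun x => g (T (ω 0) x)) ≤ v g * ENNReal.ofReal (K ω)
  /-- `‖L_ω^n g - μ_ω(g)‖_BV ≤ K(ω) ‖g‖_BV e^{-λ n}`, where `μ_ω(g) = ∫ g h_ω dm` -/
  decay_norm : ∀ᵐ ω ∂P, ∀ n : ℕ, 1 ≤ n → ∀ g : X → ℂ, Measurable g →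
    bvNormAE m v (fun x => normTransferIter m T h ω n g x - ∫ y, g y * (h ω y : ℂ) ∂m) ≤
      ENNReal.ofReal (K ω) * bvNorm m v g * ENNReal.ofReal (Real.exp (-lam * n))

/-- `‖φ‖_K = ess sup_ω K(ω) ‖φ_ω‖_BV` for the observable `φ_ω = φ ω₀`. -/
def scaledNorm {Y X : Type*} [MeasurableSpace Y] [MeasurableSpace X]
    (P : Measure (ℤ → Y)) (m : Measure X) (v : (X → ℂ) → ℝ≥0∞) (K : (ℤ → Y) → ℝ)
    (φ : Y → X → ℝ) : ℝ≥0∞ :=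
  essSup (fun ω => ENNReal.ofReal (K ω) * bvNorm m v (fun x => (φ (ω 0) x : ℂ))) P

end

end RandomSkew

namespace RandomSkew

/-! Let ψ(ω) = ∫ φ_ω h_ω dm be the fiber mean of the observable. Then S_n splits into the Birkhoff
sum of the fiberwise centered function f = φ - ψ and the sum of ψ(σ^j ω) over j < n, which depends
on the driving process only. In both parts the weight K(ω) in ‖φ‖_K cancels the nonuniform factor
K(ω) of the standing assumption. The estimates are therefore uniform in ω, although K may be
unbounded.

Centered part. The quenched decay of L_ω^k, multiplied by the densities and integrated over ω, shows
that the image of f dμ under τ^k has a density g_k with respect to μ with |g_k| ≤ D e^{-λk}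
(`abs_setIntegral_iterate_le`, `exists_bounded_density`). Gordin's construction compares f with M =
∑ (g_k - g_{k+1} ∘ τ), a bounded reverse martingale difference; the two Birkhoff sums differ by a
bounded amount. Azuma's inequality then gives Gaussian exponential moments
(`integral_exp_birkhoffSum_le`).

Fiber means. Since h_ω is the limit of 𝓛^r 1 started at σ^{-r} ω, ψ(ω) is determined up to
O(e^{-2λr/3}) by the coordinates -r, ..., 0 (`mixingApprox_fiberMean`). For such variables summable
covariances give a variance of order n. A Chernoff bound over alternate blocks of length of order
t^{1/(1+η)} gives tails C exp(-c min(t²/n, t^{η/(1+η)})) (`exists_mixing_tail_bound`).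

Conclusion. The combined tail has a prefactor C, while the theorem has none. For bounded x,
Cantelli's inequality gives V/(V+x²) ≤ exp(-x²/(V+x²)) instead. For large x, half of the exponent
absorbs C. The exponents of the theorem come from κ = 1/(1+γ) = η/(1+η): the power in the
denominator is 2 - κ, and x²/(x^{2-κ} n^{-κ/2}) = (x√n)^κ (`exists_bound_constants`). -/

/-! ### Integration preliminaries and densities of image measures -/

theorem integrable_of_abs_le {α : Type*} [MeasurableSpace α] {μ : Measure α} [IsFiniteMeasure μ]
    {f : α → ℝ} (hf : Measurable f) {C : ℝ} (h : ∀ x, |f x| ≤ C) : Integrable f μ :=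
  Integrable.of_bound hf.aestronglyMeasurable C (ae_of_all _ h)

theorem integral_comp_of_measurePreserving {α β : Type*} [MeasurableSpace α] [MeasurableSpace β]
    {μ : Measure α} {ν : Measure β} {S : α → β} (hS : MeasurePreserving S μ ν) {g : β → ℝ}
    (hg : Measurable g) : ∫ x, g (S x) ∂μ = ∫ y, g y ∂ν := by
  rw [← hS.map_eq, integral_map hS.aemeasurable hg.aestronglyMeasurable]

/-- If `g dν` is the image of `f dμ` under `S`, then `∫ g G dν = ∫ f (G ∘ S) dμ` for all bounded
measurable `G`. -/
theorem integral_mul_eq_integral_mul_comp {α β : Type*} [MeasurableSpace α] [MeasurableSpace β]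
    {μ : Measure α} {ν : Measure β} {S : α → β} (hS : Measurable S)
    {f : α → ℝ} {g : β → ℝ} (hf : Integrable f μ) (hg : Integrable g ν)
    (h : ∀ A, MeasurableSet A → ∫ x in A, g x ∂ν = ∫ x in S ⁻¹' A, f x ∂μ)
    {G : β → ℝ} (hG : Measurable G) {C : ℝ} (hC : ∀ x, |G x| ≤ C) :
    ∫ x, g x * G x ∂ν = ∫ x, f x * G (S x) ∂μ := by
  -- The identity is linear in G, so indicators give all simple functions; dominated convergence
  -- with bound 2C|g|, respectively 2C|f|, gives the rest.
  have key : ∀ s : SimpleFunc β ℝ, ∫ x, g x * s x ∂ν = ∫ x, f x * s (S x) ∂μ := by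
    intro s
    induction s using SimpleFunc.induction with
    | const c hA =>
      rename_i A
      have e1 : ∀ x, g x * (SimpleFunc.piecewise A hA (SimpleFunc.const β c)
          (SimpleFunc.const β 0)) x = A.indicator (fun x => g x * c) x := by
        intro x
        by_cases hx : x ∈ A <;> simp [hx]
      have e2 : ∀ x, f x * (SimpleFunc.piecewise A hA (SimpleFunc.const β c)
          (SimpleFunc.const β 0)) (S x) = (S ⁻¹' A).indicator (fun x => f x * c) x := by
        intro x
        by_cases hx : S x ∈ A <;> simp [hx]
      simp_rw [e1, e2]
      rw [integral_indicator hA, integral_indicator (hS hA), integral_mul_const,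
        integral_mul_const, h A hA]
    | @add s t _ hs ht =>
      have i1 : ∀ s : SimpleFunc β ℝ, Integrable (fun x => g x * s x) ν := fun s => by
        obtain ⟨c, hc⟩ := s.exists_forall_norm_le
        exact hg.mul_bdd s.measurable.aestronglyMeasurable (ae_of_all _ hc)
      have i2 : ∀ s : SimpleFunc β ℝ, Integrable (fun x => f x * s (S x)) μ := fun s => by
        obtain ⟨c, hc⟩ := s.exists_forall_norm_le
        exact hf.mul_bdd (s.measurable.comp hS).aestronglyMeasurable
          (ae_of_all _ fun x => hc (S x))
      simp only [SimpleFunc.coe_add, Pi.add_apply, mul_add]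
      rw [integral_add (i1 s) (i1 t), integral_add (i2 s) (i2 t), hs, ht]
  have hb : ∀ n x, |SimpleFunc.approxOn G hG Set.univ 0 (Set.mem_univ _) n x| ≤ C + C :=
    fun n x => (SimpleFunc.norm_approxOn_zero_le hG (Set.mem_univ _) x n).trans
      (add_le_add (hC x) (hC x))
  have hl : ∀ x, Tendsto (fun n => SimpleFunc.approxOn G hG Set.univ 0 (Set.mem_univ _) n x)
      atTop (𝓝 (G x)) := fun x =>
    SimpleFunc.tendsto_approxOn hG (Set.mem_univ _) (by simp)
  have t1 := tendsto_integral_of_dominated_convergence (μ := ν)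
    (F := fun n x => g x * SimpleFunc.approxOn G hG Set.univ 0 (Set.mem_univ _) n x)
    (f := fun x => g x * G x) (fun x => |g x| * (C + C))
    (fun n => hg.aestronglyMeasurable.mul (SimpleFunc.measurable _).aestronglyMeasurable)
    (hg.abs.mul_const _)
    (fun n => ae_of_all _ fun x => by
      rw [Real.norm_eq_abs, abs_mul]
      exact mul_le_mul_of_nonneg_left (hb n x) (abs_nonneg _))
    (ae_of_all _ fun x => (hl x).const_mul _)
  have t2 := tendsto_integral_of_dominated_convergence (μ := μ)
    (F := fun n x => f x * SimpleFunc.approxOn G hG Set.univ 0 (Set.mem_univ _) n (S x))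
    (f := fun x => f x * G (S x)) (fun x => |f x| * (C + C))
    (fun n => hf.aestronglyMeasurable.mul
      ((SimpleFunc.measurable _).comp hS).aestronglyMeasurable)
    (hf.abs.mul_const _)
    (fun n => ae_of_all _ fun x => by
      rw [Real.norm_eq_abs, abs_mul]
      exact mul_le_mul_of_nonneg_left (hb n (S x)) (abs_nonneg _))
    (ae_of_all _ fun x => (hl (S x)).const_mul _)
  simp_rw [key] at t1
  exact tendsto_nhds_unique t1 t2

/-- A bounded function whose image under a measure preserving map `S` is dominated by `c μ` has
an image density bounded by `c`. -/
theorem exists_bounded_density {α : Type*} [MeasurableSpace α] {μ : Measure α}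
    [IsProbabilityMeasure μ] {S : α → α} (hS : MeasurePreserving S μ μ) {f : α → ℝ}
    (hf : Integrable f μ) {c : ℝ} (hc : 0 ≤ c)
    (h : ∀ A, MeasurableSet A → |∫ x in S ⁻¹' A, f x ∂μ| ≤ c * μ.real A) :
    ∃ g : α → ℝ, Measurable g ∧ (∀ x, |g x| ≤ c) ∧ ∀ (G : α → ℝ) (C : ℝ), Measurable G →
      (∀ x, |G x| ≤ C) → ∫ x, g x * G x ∂μ = ∫ x, f x * G (S x) ∂μ := by
  -- The transfer operator is taken with respect to the invariant measure μ, not m, so that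
  -- domination by c μ becomes a bound on the density.
  set u := transfer μ S (fun x => (f x : ℂ)) with hu
  have hui : Integrable u μ := integrable_transfer _ _ _
  have hset : ∀ A, MeasurableSet A → ∫ x in A, (u x).re ∂μ = ∫ x in S ⁻¹' A, f x ∂μ := by
    intro A hA
    have := setIntegral_transfer μ S hS.quasiMeasurePreserving (fun x => (f x : ℂ)) hf.ofReal A hA
    rw [← hu] at this
    have e := integral_re (𝕜 := ℂ) (hui.integrableOn (s := A))
    simp only [RCLike.re_eq_complex_re] at e
    rw [e, this, integral_complex_ofReal, Complex.ofReal_re]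
  have hri : Integrable (fun x => (u x).re) μ := hui.re
  have hset' : ∀ A, MeasurableSet A → |∫ x in A, (u x).re ∂μ| ≤ ∫ x in A, c ∂μ := by
    intro A hA
    rw [hset A hA, setIntegral_const, smul_eq_mul, mul_comm]
    exact h A hA
  have hle : (fun x => (u x).re) ≤ᵐ[μ] fun _ => c :=
    ae_le_of_forall_setIntegral_le hri (integrable_const _) fun A hA _ =>
      (le_abs_self _).trans (hset' A hA)
  have hge : (fun _ => -c) ≤ᵐ[μ] fun x => (u x).re := by
    refine ae_le_of_forall_setIntegral_le (integrable_const _) hri fun A hA _ => ?_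
    rw [integral_neg]
    exact neg_le_of_abs_le (hset' A hA)
  have hm := hri.aestronglyMeasurable
  set w := hm.mk _ with hw
  have hwm : Measurable w := hm.stronglyMeasurable_mk.measurable
  have hwe : (fun x => (u x).re) =ᵐ[μ] w := hm.ae_eq_mk
  -- Truncating a measurable version changes it on a null set only and makes the bound hold at every
  -- point.
  refine ⟨fun x => max (-c) (min c (w x)), by fun_prop, fun x => ?_, fun G C hG hC => ?_⟩
  · exact abs_le.2 ⟨le_max_left _ _, max_le (by linarith) (min_le_left _ _)⟩
  · rw [← integral_mul_eq_integral_mul_comp hS.measurable hf hri hset hG hC]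
    refine integral_congr_ae ?_
    filter_upwards [hle, hge, hwe] with x h1 h2 h3
    rw [← h3, min_eq_right h1, max_eq_right h2]

/-! ### Reverse martingale approximation of Birkhoff sums -/

theorem measurable_birkhoffSum {α : Type*} [MeasurableSpace α] {τ : α → α} (hτ : Measurable τ)
    {f : α → ℝ} (hf : Measurable f) (n : ℕ) : Measurable (birkhoffSum τ f n) := by
  unfold birkhoffSum
  exact Finset.measurable_fun_sum _ fun k _ => hf.comp (hτ.iterate k)

theorem abs_birkhoffSum_le {α : Type*} {τ : α → α} {f : α → ℝ} {C : ℝ} (h : ∀ x, |f x| ≤ C)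
    (n : ℕ) (x : α) : |birkhoffSum τ f n x| ≤ n * C := by
  unfold birkhoffSum
  calc _ ≤ ∑ k ∈ Finset.range n, |f (τ^[k] x)| := Finset.abs_sum_le_sum_abs _ _
    _ ≤ ∑ k ∈ Finset.range n, C := Finset.sum_le_sum fun k _ => h _
    _ = n * C := by simp

/-- Azuma's inequality for the Birkhoff sums of a bounded reverse martingale difference. -/
theorem integral_exp_birkhoffSum_le_of_martingale {α : Type*} [MeasurableSpace α] {μ : Measure α}
    [IsProbabilityMeasure μ] {τ : α → α} (hτ : MeasurePreserving τ μ μ) {f : α → ℝ}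
    (hf : Measurable f) {C : ℝ} (hC : 0 < C) (hb : ∀ x, |f x| ≤ C)
    (h0 : ∀ (G : α → ℝ) (c : ℝ), Measurable G → (∀ x, |G x| ≤ c) →
      ∫ x, f x * G (τ x) ∂μ = 0) (s : ℝ) (n : ℕ) :
    ∫ x, Real.exp (s * birkhoffSum τ f n x) ∂μ ≤ Real.exp ((s * C) ^ 2 / 2 * n) := by
  induction n with
  | zero => simp
  | succ n ih =>
    set G : α → ℝ := fun x => Real.exp (s * birkhoffSum τ f n x) with hGdef
    have hG : Measurable G := ((measurable_birkhoffSum hτ.measurable hf n).const_mul s).exp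
    have hGb : ∀ x, |G x| ≤ Real.exp (|s| * (n * C)) := fun x => by
      rw [abs_of_pos (Real.exp_pos _)]
      refine Real.exp_le_exp.2 ((le_abs_self _).trans ?_)
      rw [abs_mul]
      exact mul_le_mul_of_nonneg_left (abs_birkhoffSum_le hb n x) (abs_nonneg _)
    have hGi : Integrable G μ := integrable_of_abs_le hG hGb
    have hGτ : Integrable (fun x => G (τ x)) μ := hτ.integrable_comp_of_integrable hGi
    have hfG : Integrable (fun x => f x * G (τ x)) μ :=
      hGτ.bdd_mul hf.aestronglyMeasurable (ae_of_all _ hb)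
    -- The first summand is split off: S_{n+1} = f + S_n ∘ τ. By convexity exp(sf) lies below its
    -- chord on [-C, C], and the linear term integrates to 0 against functions of τ x.
    calc ∫ x, Real.exp (s * birkhoffSum τ f (n + 1) x) ∂μ
        ≤ ∫ x, (Real.cosh (s * C) * G (τ x) +
            Real.sinh (s * C) / C * (f x * G (τ x))) ∂μ := by
          refine integral_mono_of_nonneg (ae_of_all _ fun x => (Real.exp_pos _).le)
            ((hGτ.const_mul _).add (hfG.const_mul _)) (ae_of_all _ fun x => ?_)
          have h1 : |f x / C| ≤ 1 := by
            rw [abs_div, abs_of_pos hC]; exact (div_le_one hC).2 (hb x)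
          have h2 := Real.exp_mul_le_cosh_add_mul_sinh h1 (s * C)
          have h3 : f x / C * (s * C) = s * f x := by field_simp
          rw [h3] at h2
          simp only [birkhoffSum_succ', mul_add, Real.exp_add]
          calc _ ≤ (Real.cosh (s * C) + f x / C * Real.sinh (s * C)) * G (τ x) :=
                mul_le_mul_of_nonneg_right h2 (Real.exp_pos _).le
            _ = _ := by ring
      _ = Real.cosh (s * C) * ∫ x, G x ∂μ := by
          rw [integral_add (hGτ.const_mul _) (hfG.const_mul _), integral_const_mul,
            integral_const_mul, h0 G _ hG hGb, mul_zero, add_zero]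
          congr 1
          exact integral_comp_of_measurePreserving hτ hG
      _ ≤ Real.exp ((s * C) ^ 2 / 2) * Real.exp ((s * C) ^ 2 / 2 * n) :=
          mul_le_mul (Real.cosh_le_exp_half_sq _) ih (integral_nonneg fun x => (Real.exp_pos _).le)
            (Real.exp_pos _).le
      _ = _ := by rw [← Real.exp_add]; congr 1; push_cast; ring

theorem sum_geometric_le {r D : ℝ} (hr : 0 ≤ r) (hr1 : r < 1) (hD : 0 ≤ D) (n : ℕ) :
    ∑ k ∈ Finset.range n, D * r ^ k ≤ D / (1 - r) := by
  rw [← Finset.mul_sum, div_eq_mul_inv, ← tsum_geometric_of_lt_one hr hr1]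
  exact mul_le_mul_of_nonneg_left
    ((summable_geometric_of_lt_one hr hr1).sum_le_tsum _ fun _ _ => by positivity) hD

/-- The differences telescope along the diagonals of an n × N rectangle, so only boundary terms
survive. It compares the Birkhoff sums of f and of its martingale part. -/
theorem sum_range_sub_diagonal (a : ℕ → ℕ → ℝ) (n N : ℕ) :
    ∑ j ∈ Finset.range n, ∑ k ∈ Finset.range N, (a k j - a (k + 1) (j + 1)) =
      ∑ j ∈ Finset.range n, a 0 j - ∑ j ∈ Finset.range n, a N j +
        ∑ k ∈ Finset.range N, (a (k + 1) 0 - a (k + 1) n) := by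
  induction N with
  | zero => simp
  | succ N ih =>
    simp only [Finset.sum_range_succ _ N, Finset.sum_add_distrib, ih]
    have h2 : ∑ j ∈ Finset.range n, (a N j - a (N + 1) (j + 1)) = _ := Finset.sum_sub_distrib _ _
    have := Finset.sum_range_succ' (fun j => a (N + 1) j) n
    rw [Finset.sum_range_succ] at this
    linarith

/-- Exponential moments of the Birkhoff sums of a bounded function whose images under the
iterates of `τ` have densities decaying uniformly and exponentially fast. -/
theorem integral_exp_birkhoffSum_le {α : Type*} [MeasurableSpace α] {μ : Measure α}
    [IsProbabilityMeasure μ] {τ : α → α} (hτ : MeasurePreserving τ μ μ) {f : α → ℝ}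
    (hf : Measurable f) {D r : ℝ} (hD : 0 < D) (hr : 0 < r) (hr1 : r < 1)
    (hb : ∀ x, |f x| ≤ D)
    (hd : ∀ k : ℕ, 1 ≤ k → ∀ A, MeasurableSet A →
      |∫ x in τ^[k] ⁻¹' A, f x ∂μ| ≤ D * r ^ k * μ.real A) (s : ℝ) (n : ℕ) :
    ∫ x, Real.exp (s * birkhoffSum τ f n x) ∂μ ≤
      Real.exp (2 * (D / (1 - r)) ^ 2 * s ^ 2 * n + 3 * (D / (1 - r)) * |s|) := by
  set D' := D / (1 - r) with hD'
  have hD'0 : 0 < D' := div_pos hD (by linarith)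
  have hfi : Integrable f μ := integrable_of_abs_le hf hb
  -- g_k is the density of the image of f dμ under τ^k. The case k = 0 is f itself, to which the
  -- decay hypothesis does not apply.
  have hex : ∀ k : ℕ, ∃ g : α → ℝ, Measurable g ∧ (∀ x, |g x| ≤ D * r ^ k) ∧
      (∀ (G : α → ℝ) (C : ℝ), Measurable G → (∀ x, |G x| ≤ C) →
        ∫ x, g x * G x ∂μ = ∫ x, f x * G (τ^[k] x) ∂μ) ∧ (k = 0 → g = f) := by
    intro k
    rcases Nat.eq_zero_or_pos k with rfl | hk
    · exact ⟨f, hf, by simpa using hb, fun G C _ _ => rfl, fun _ => rfl⟩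
    · obtain ⟨g, h1, h2, h3⟩ := exists_bounded_density (hτ.iterate k) hfi
        (by positivity : 0 ≤ D * r ^ k) (hd k hk)
      exact ⟨g, h1, h2, h3, fun h => absurd h hk.ne'⟩
  choose g hgm hgb hgd hg0 using hex
  -- The series of densities is cut at the number of summands: the n leftover terms g_n are each at
  -- most D r^n ≤ D r^j for j < n, so their sum is again bounded by D/(1-r).
  set N := n
  set M : α → ℝ := fun x => ∑ k ∈ Finset.range N, (g k x - g (k + 1) (τ x)) with hM
  have hMm : Measurable M := Finset.measurable_fun_sum _ fun k _ =>
    (hgm k).sub ((hgm (k + 1)).comp hτ.measurable)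
  have hsum1 : ∀ x, ∑ k ∈ Finset.range N, |g k x| ≤ D' := fun x =>
    (Finset.sum_le_sum fun k _ => hgb k x).trans (sum_geometric_le hr.le hr1 hD.le N)
  have hsum2 : ∀ x, ∑ k ∈ Finset.range N, |g (k + 1) x| ≤ D' := fun x => by
    refine le_trans (Finset.sum_le_sum fun k _ => (hgb (k + 1) x).trans ?_)
      (sum_geometric_le hr.le hr1 hD.le N)
    exact mul_le_mul_of_nonneg_left (pow_le_pow_of_le_one hr.le hr1.le (Nat.le_succ k)) hD.le
  have hMb : ∀ x, |M x| ≤ 2 * D' := fun x => by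
    calc |M x| ≤ ∑ k ∈ Finset.range N, |g k x - g (k + 1) (τ x)| :=
          Finset.abs_sum_le_sum_abs _ _
      _ ≤ ∑ k ∈ Finset.range N, (|g k x| + |g (k + 1) (τ x)|) :=
          Finset.sum_le_sum fun k _ => abs_sub _ _
      _ ≤ 2 * D' := by
          rw [Finset.sum_add_distrib]
          linarith [hsum1 x, hsum2 (τ x)]
  -- Both ∫ g_k (G ∘ τ) and, by invariance, ∫ (g_{k+1} G) ∘ τ equal ∫ f (G ∘ τ^{k+1}), so each
  -- difference has integral 0.
  have hM0 : ∀ (G : α → ℝ) (c : ℝ), Measurable G → (∀ x, |G x| ≤ c) →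
      ∫ x, M x * G (τ x) ∂μ = 0 := by
    intro G c hG hc
    have hGτ : Measurable fun x => G (τ x) := hG.comp hτ.measurable
    have i1 : ∀ k, Integrable (fun x => g k x * G (τ x)) μ := fun k =>
      (integrable_of_abs_le (hgm k) (hgb k)).mul_bdd hGτ.aestronglyMeasurable
        (ae_of_all _ fun x => hc (τ x))
    have i2 : ∀ k, Integrable (fun x => g k (τ x) * G (τ x)) μ := fun k =>
      hτ.integrable_comp_of_integrable (g := fun x => g k x * G x)
        ((integrable_of_abs_le (hgm k) (hgb k)).mul_bdd hG.aestronglyMeasurable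
        (ae_of_all _ hc))
    simp only [hM, Finset.sum_mul, sub_mul]
    have i3 : ∀ k, Integrable (fun x => g k x * G (τ x) - g (k + 1) (τ x) * G (τ x)) μ :=
      fun k => (i1 k).sub (i2 (k + 1))
    rw [integral_finsetSum _ fun k _ => i3 k]
    refine Finset.sum_eq_zero fun k _ => ?_
    rw [integral_sub (i1 k) (i2 (k + 1)), sub_eq_zero, hgd k _ c hGτ fun x => hc (τ x)]
    rw [integral_comp_of_measurePreserving hτ (g := fun x => g (k + 1) x * G x)
      ((hgm (k + 1)).mul hG), hgd (k + 1) G c hG hc]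
    simp only [Function.iterate_succ_apply']
  have hcmp : ∀ x, s * birkhoffSum τ f n x ≤ s * birkhoffSum τ M n x + 3 * D' * |s| := by
    intro x
    have e := sum_range_sub_diagonal (fun k j => g k (τ^[j] x)) n N
    have hMs : birkhoffSum τ M n x = ∑ j ∈ Finset.range n, ∑ k ∈ Finset.range N,
        (g k (τ^[j] x) - g (k + 1) (τ^[j + 1] x)) := by
      simp only [birkhoffSum, hM, Function.iterate_succ_apply']
    have hfs : birkhoffSum τ f n x = ∑ j ∈ Finset.range n, g 0 (τ^[j] x) := by
      simp only [birkhoffSum, hg0 0 rfl]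
    -- Of the constant 3, one part pays for the terms g_N and two for the terms at the times 0 and
    -- n.
    have hdiff : |birkhoffSum τ f n x - birkhoffSum τ M n x| ≤ 3 * D' := by
      rw [hMs, e, hfs]
      have b1 : |∑ j ∈ Finset.range n, g N (τ^[j] x)| ≤ D' := by
        calc _ ≤ ∑ j ∈ Finset.range n, |g N (τ^[j] x)| := Finset.abs_sum_le_sum_abs _ _
          _ ≤ ∑ j ∈ Finset.range n, D * r ^ j := Finset.sum_le_sum fun j hj =>
              (hgb N _).trans (mul_le_mul_of_nonneg_left
                (pow_le_pow_of_le_one hr.le hr1.le (Finset.mem_range.1 hj).le) hD.le)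
          _ ≤ D' := sum_geometric_le hr.le hr1 hD.le n
      have b2 : |∑ k ∈ Finset.range N, (g (k + 1) (τ^[0] x) - g (k + 1) (τ^[n] x))| ≤ 2 * D' := by
        calc _ ≤ ∑ k ∈ Finset.range N, |g (k + 1) (τ^[0] x) - g (k + 1) (τ^[n] x)| :=
              Finset.abs_sum_le_sum_abs _ _
          _ ≤ ∑ k ∈ Finset.range N, (|g (k + 1) (τ^[0] x)| + |g (k + 1) (τ^[n] x)|) :=
              Finset.sum_le_sum fun k _ => abs_sub _ _
          _ ≤ 2 * D' := by
              rw [Finset.sum_add_distrib]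
              linarith [hsum2 (τ^[0] x), hsum2 (τ^[n] x)]
      rw [abs_le] at b1 b2 ⊢
      constructor <;> linarith [b1.1, b1.2, b2.1, b2.2]
    have : s * (birkhoffSum τ f n x - birkhoffSum τ M n x) ≤ |s| * (3 * D') := by
      refine (le_abs_self _).trans ?_
      rw [abs_mul]
      exact mul_le_mul_of_nonneg_left hdiff (abs_nonneg _)
    linarith
  have hMi : Integrable (fun x => Real.exp (s * birkhoffSum τ M n x)) μ := by
    refine integrable_of_abs_le (C := Real.exp (|s| * (n * (2 * D'))))
      ((measurable_birkhoffSum hτ.measurable hMm n).const_mul s).exp fun x => ?_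
    rw [abs_of_pos (Real.exp_pos _)]
    refine Real.exp_le_exp.2 ((le_abs_self _).trans ?_)
    rw [abs_mul]
    exact mul_le_mul_of_nonneg_left (abs_birkhoffSum_le hMb n x) (abs_nonneg _)
  calc ∫ x, Real.exp (s * birkhoffSum τ f n x) ∂μ
      ≤ ∫ x, Real.exp (s * birkhoffSum τ M n x) * Real.exp (3 * D' * |s|) ∂μ := by
        refine integral_mono_of_nonneg (ae_of_all _ fun x => (Real.exp_pos _).le)
          (hMi.mul_const _) (ae_of_all _ fun x => ?_)
        simp only [← Real.exp_add]
        exact Real.exp_le_exp.2 (hcmp x)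
    _ ≤ Real.exp ((s * (2 * D')) ^ 2 / 2 * n) * Real.exp (3 * D' * |s|) := by
        rw [integral_mul_const]
        exact mul_le_mul_of_nonneg_right
          (integral_exp_birkhoffSum_le_of_martingale hτ hMm (by positivity) hMb hM0 s n)
          (Real.exp_pos _).le
    _ = _ := by rw [← Real.exp_add]; congr 1; ring

/-! ### Consequences of α-mixing for conditional expectations and covariances -/

/-- The set where W is nonnegative belongs to 𝒦, so ∫ |W| is the difference of two admissible set
integrals. -/
theorem integral_abs_le_of_abs_setIntegral_le {Ω : Type*} {𝒦 m0 : MeasurableSpace Ω}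
    {Q : Measure Ω} (h𝒦 : 𝒦 ≤ m0) {W : Ω → ℝ} (hW : Measurable[𝒦] W)
    (hWi : Integrable W Q) {c : ℝ} (hc : ∀ A, MeasurableSet[𝒦] A → |∫ w in A, W w ∂Q| ≤ c) :
    ∫ w, |W w| ∂Q ≤ 2 * c := by
  have hA : MeasurableSet[𝒦] {w | 0 ≤ W w} := hW measurableSet_Ici
  have e := integral_add_compl (h𝒦 _ hA) hWi.abs
  have e1 : ∫ w in {w | 0 ≤ W w}, |W w| ∂Q = ∫ w in {w | 0 ≤ W w}, W w ∂Q :=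
    setIntegral_congr_fun (h𝒦 _ hA) fun w hw => abs_of_nonneg hw
  have e2 : ∫ w in {w | 0 ≤ W w}ᶜ, |W w| ∂Q = -∫ w in {w | 0 ≤ W w}ᶜ, W w ∂Q := by
    rw [← integral_neg]
    exact setIntegral_congr_fun (h𝒦 _ hA).compl fun w hw =>
      abs_of_neg (not_le.1 hw)
  have c1 := le_of_abs_le (hc _ hA)
  have c2 := neg_le_of_abs_le (hc _ hA.compl)
  linarith

/-- If `Z` is bounded and `ℋ`-measurable, its conditional expectation on `𝒢` is close to its mean
when `𝒢` and `ℋ` are nearly independent. -/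
theorem integral_abs_condExp_sub_le {Ω : Type*} {𝒢 ℋ m0 : MeasurableSpace Ω} {Q : Measure Ω}
    [IsProbabilityMeasure Q] (h𝒢 : 𝒢 ≤ m0) (hℋ : ℋ ≤ m0) {a : ℝ}
    (h : ∀ A B, MeasurableSet[𝒢] A → MeasurableSet[ℋ] B →
      |Q.real (A ∩ B) - Q.real A * Q.real B| ≤ a)
    {Z : Ω → ℝ} (hZ : Measurable[ℋ] Z) {B : ℝ} (hB : ∀ w, |Z w| ≤ B) :
    ∫ w, |(Q[Z | 𝒢]) w - ∫ w, Z w ∂Q| ∂Q ≤ 4 * B * a := by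
  have hB0 : 0 ≤ B := by
    have : Nonempty Ω := Q.nonempty_of_neZero
    exact (abs_nonneg _).trans (hB this.some)
  have hZ0 : Measurable[m0] Z := hZ.mono hℋ le_rfl
  have hZi : Integrable Z Q := integrable_of_abs_le hZ0 hB
  -- Conditioning is first moved to the other side: W = E[1_A | ℋ] - Q(A) has L¹ norm at most 2a,
  -- and pairing it with Z costs a factor B. The sign argument on 𝒢 then doubles the bound to 4Ba.
  have step : ∀ A, MeasurableSet[𝒢] A →
      |∫ w in A, Z w ∂Q - Q.real A * ∫ w, Z w ∂Q| ≤ B * (2 * a) := by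
    intro A hA
    set V : Ω → ℝ := A.indicator fun _ => 1 with hV
    have hVm : Measurable[m0] V := measurable_const.indicator (h𝒢 _ hA)
    have hVi : Integrable V Q := integrable_of_abs_le (C := 1) hVm fun w => by
      by_cases hw : w ∈ A <;> simp [hV, hw]
    set W : Ω → ℝ := fun w => (Q[V | ℋ]) w - Q.real A with hW
    have hWm : Measurable[ℋ] W :=
      (stronglyMeasurable_condExp.measurable).sub_const _
    have hWi : Integrable W Q := integrable_condExp.sub (integrable_const _)
    have b1 := integral_abs_le_of_abs_setIntegral_le hℋ hWm hWi (c := a) fun D hD => by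
      have : ∫ w in D, W w ∂Q = Q.real (A ∩ D) - Q.real A * Q.real D := by
        rw [hW, integral_sub integrable_condExp.integrableOn (integrable_const _),
          setIntegral_condExp hℋ hVi hD, setIntegral_const, hV,
          integral_indicator (h𝒢 _ hA), Measure.restrict_restrict (h𝒢 _ hA), setIntegral_const]
        simp [mul_comm]
      rw [this]
      exact h A D hA hD
    have hVZ : Integrable (fun w => V w * Z w) Q := hVi.mul_bdd hZ0.aestronglyMeasurable
      (ae_of_all _ hB)
    have e : ∫ w in A, Z w ∂Q - Q.real A * ∫ w, Z w ∂Q = ∫ w, W w * Z w ∂Q := by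
      have h1 : ∫ w in A, Z w ∂Q = ∫ w, V w * Z w ∂Q := by
        rw [← integral_indicator (h𝒢 _ hA)]
        refine integral_congr_ae (ae_of_all _ fun w => ?_)
        by_cases hw : w ∈ A <;> simp [hV, hw]
      have h2 : ∫ w, V w * Z w ∂Q = ∫ w, (Q[V | ℋ]) w * Z w ∂Q := by
        rw [← integral_condExp hℋ]
        exact integral_congr_ae
          (condExp_mul_of_stronglyMeasurable_right hZ.stronglyMeasurable hVZ hVi)
      have h3 : Integrable (fun w => (Q[V | ℋ]) w * Z w) Q :=
        integrable_condExp.mul_bdd hZ0.aestronglyMeasurable (ae_of_all _ hB)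
      simp only [hW, sub_mul]
      rw [integral_sub h3 (hZi.const_mul _), integral_const_mul, h1, h2]
    rw [e]
    calc |∫ w, W w * Z w ∂Q| ≤ ∫ w, |W w * Z w| ∂Q := abs_integral_le_integral_abs
      _ ≤ ∫ w, B * |W w| ∂Q := by
          refine integral_mono_of_nonneg (ae_of_all _ fun w => abs_nonneg _)
            (hWi.abs.const_mul _) (ae_of_all _ fun w => ?_)
          simp only [abs_mul]
          rw [mul_comm]
          exact mul_le_mul_of_nonneg_right (hB w) (abs_nonneg _)
      _ ≤ B * (2 * a) := by
          rw [integral_const_mul]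
          exact mul_le_mul_of_nonneg_left b1 hB0
  have fin := integral_abs_le_of_abs_setIntegral_le h𝒢 (W := fun w => (Q[Z | 𝒢]) w - ∫ w, Z w ∂Q)
    (stronglyMeasurable_condExp.measurable.sub_const _)
    (integrable_condExp.sub (integrable_const _)) (c := B * (2 * a)) fun A hA => by
      rw [integral_sub integrable_condExp.integrableOn (integrable_const _),
        setIntegral_condExp h𝒢 hZi hA, setIntegral_const, smul_eq_mul]
      exact step A hA
  linarith

/-- The values are bounded by 1, so the real supremum is a true one and not the default value 0 of
an unbounded set. -/
theorem abs_le_alphaDep {Ω : Type*} {𝒢 ℋ m0 : MeasurableSpace Ω} {Q : Measure Ω}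
    [IsProbabilityMeasure Q] {A B : Set Ω}
    (hA : MeasurableSet[𝒢] A) (hB : MeasurableSet[ℋ] B) :
    |Q.real (A ∩ B) - Q.real A * Q.real B| ≤ alphaDep Q 𝒢 ℋ := by
  refine le_csSup ⟨1, ?_⟩ ⟨A, B, hA, hB, rfl⟩
  rintro _ ⟨A, B, -, -, rfl⟩
  have h1 := measureReal_nonneg (μ := Q) (s := A ∩ B)
  have h2 := measureReal_le_one (μ := Q) (s := A ∩ B)
  have h3 := mul_nonneg (measureReal_nonneg (μ := Q) (s := A)) (measureReal_nonneg (μ := Q) (s := B))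
  have h4 := mul_le_one₀ (measureReal_le_one (μ := Q) (s := A)) measureReal_nonneg
    (measureReal_le_one (μ := Q) (s := B))
  exact abs_le.2 ⟨by linarith, by linarith⟩

theorem alphaDep_le_one {Ω : Type*} (𝒢 ℋ : MeasurableSpace Ω) {m0 : MeasurableSpace Ω}
    {Q : Measure Ω} [IsProbabilityMeasure Q] : alphaDep Q 𝒢 ℋ ≤ 1 := by
  refine csSup_le ⟨_, ∅, ∅, @MeasurableSet.empty _ 𝒢, @MeasurableSet.empty _ ℋ, rfl⟩ ?_
  rintro _ ⟨A, B, -, -, rfl⟩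
  have h1 := measureReal_nonneg (μ := Q) (s := A ∩ B)
  have h2 := measureReal_le_one (μ := Q) (s := A ∩ B)
  have h3 := mul_nonneg (measureReal_nonneg (μ := Q) (s := A)) (measureReal_nonneg (μ := Q) (s := B))
  have h4 := mul_le_one₀ (measureReal_le_one (μ := Q) (s := A)) measureReal_nonneg
    (measureReal_le_one (μ := Q) (s := B))
  exact abs_le.2 ⟨by linarith, by linarith⟩

theorem abs_le_alphaCoeff {Ω Y : Type*} [MeasurableSpace Ω] [MeasurableSpace Y] {Q : Measure Ω}
    [IsProbabilityMeasure Q] {ξ : ℤ → Ω → Y} (k : ℤ) (n : ℕ) {A B : Set Ω}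
    (hA : MeasurableSet[pastSigma ξ k] A) (hB : MeasurableSet[futureSigma ξ (k + n)] B) :
    |Q.real (A ∩ B) - Q.real A * Q.real B| ≤ alphaCoeff Q ξ n :=
  (abs_le_alphaDep (Q := Q) hA hB).trans
    (le_ciSup (f := fun k : ℤ => alphaDep Q (pastSigma ξ k) (futureSigma ξ (k + n)))
      ⟨1, by rintro _ ⟨k, rfl⟩; exact alphaDep_le_one _ _⟩ k)

theorem pastSigma_le {Ω Y : Type*} [MeasurableSpace Ω] [MeasurableSpace Y] {ξ : ℤ → Ω → Y}
    (hξ : ∀ j, Measurable (ξ j)) (k : ℤ) : pastSigma ξ k ≤ ‹MeasurableSpace Ω› :=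
  iSup₂_le fun j _ => (hξ j).comap_le

theorem futureSigma_le {Ω Y : Type*} [MeasurableSpace Ω] [MeasurableSpace Y] {ξ : ℤ → Ω → Y}
    (hξ : ∀ j, Measurable (ξ j)) (k : ℤ) : futureSigma ξ k ≤ ‹MeasurableSpace Ω› :=
  iSup₂_le fun j _ => (hξ j).comap_le

theorem pastSigma_mono {Ω Y : Type*} [MeasurableSpace Y] (ξ : ℤ → Ω → Y) {k l : ℤ} (h : k ≤ l) :
    pastSigma ξ k ≤ pastSigma ξ l :=
  iSup₂_le fun j hj => le_iSup₂_of_le j (hj.trans h) le_rfl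

theorem futureSigma_anti {Ω Y : Type*} [MeasurableSpace Y] (ξ : ℤ → Ω → Y) {k l : ℤ}
    (h : k ≤ l) : futureSigma ξ l ≤ futureSigma ξ k :=
  iSup₂_le fun j hj => le_iSup₂_of_le j (h.trans hj) le_rfl

theorem integral_abs_condExp_pastSigma_sub_le {Ω Y : Type*} [MeasurableSpace Ω]
    [MeasurableSpace Y] {Q : Measure Ω} [IsProbabilityMeasure Q] {ξ : ℤ → Ω → Y}
    (hξ : ∀ j, Measurable (ξ j)) (k : ℤ) (n : ℕ) {Z : Ω → ℝ}
    (hZ : Measurable[futureSigma ξ (k + n)] Z) {B : ℝ} (hB : ∀ w, |Z w| ≤ B) :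
    ∫ w, |(Q[Z | pastSigma ξ k]) w - ∫ w, Z w ∂Q| ∂Q ≤ 4 * B * alphaCoeff Q ξ n :=
  integral_abs_condExp_sub_le (pastSigma_le hξ k) (futureSigma_le hξ _)
    (fun _ _ hA hB => abs_le_alphaCoeff k n hA hB) hZ hB

/-- Conditioning on the past σ-algebra replaces Z by its conditional expectation, which is L¹-close
to the mean of Z; U is bounded. -/
theorem abs_covariance_le_alphaCoeff {Ω Y : Type*} [MeasurableSpace Ω]
    [MeasurableSpace Y] {Q : Measure Ω} [IsProbabilityMeasure Q] {ξ : ℤ → Ω → Y}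
    (hξ : ∀ j, Measurable (ξ j)) (k : ℤ) (n : ℕ) {U Z : Ω → ℝ}
    (hU : Measurable[pastSigma ξ k] U) {b : ℝ} (hb : ∀ w, |U w| ≤ b)
    (hZ : Measurable[futureSigma ξ (k + n)] Z) {B : ℝ} (hB : ∀ w, |Z w| ≤ B) :
    |∫ w, U w * Z w ∂Q - (∫ w, U w ∂Q) * ∫ w, Z w ∂Q| ≤ b * (4 * B * alphaCoeff Q ξ n) := by
  have hb0 : 0 ≤ b := by
    have : Nonempty Ω := Q.nonempty_of_neZero
    exact (abs_nonneg _).trans (hb this.some)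
  have hU0 : Measurable U := hU.mono (pastSigma_le hξ k) le_rfl
  have hZ0 : Measurable Z := hZ.mono (futureSigma_le hξ _) le_rfl
  have hUi : Integrable U Q := integrable_of_abs_le hU0 hb
  have hZi : Integrable Z Q := integrable_of_abs_le hZ0 hB
  have hUZ : Integrable (fun w => U w * Z w) Q := hUi.mul_bdd hZ0.aestronglyMeasurable
    (ae_of_all _ hB)
  have h2 : ∫ w, U w * Z w ∂Q = ∫ w, U w * (Q[Z | pastSigma ξ k]) w ∂Q := by
    rw [← integral_condExp (pastSigma_le hξ k)]
    exact integral_congr_ae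
      (condExp_mul_of_stronglyMeasurable_left hU.stronglyMeasurable hUZ hZi)
  have h3 : Integrable (fun w => U w * (Q[Z | pastSigma ξ k]) w) Q :=
    integrable_condExp.bdd_mul hU0.aestronglyMeasurable (ae_of_all _ hb)
  have hD : Integrable (fun w => (Q[Z | pastSigma ξ k]) w - ∫ w, Z w ∂Q) Q :=
    integrable_condExp.sub (integrable_const _)
  have e : ∫ w, U w * Z w ∂Q - (∫ w, U w ∂Q) * ∫ w, Z w ∂Q =
      ∫ w, U w * ((Q[Z | pastSigma ξ k]) w - ∫ w, Z w ∂Q) ∂Q := by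
    simp only [mul_sub]
    rw [integral_sub h3 (hUi.mul_const _), integral_mul_const, h2]
  rw [e]
  calc _ ≤ ∫ w, |U w * ((Q[Z | pastSigma ξ k]) w - ∫ w, Z w ∂Q)| ∂Q :=
        abs_integral_le_integral_abs
    _ ≤ ∫ w, b * |(Q[Z | pastSigma ξ k]) w - ∫ w, Z w ∂Q| ∂Q := by
        refine integral_mono_of_nonneg (ae_of_all _ fun w => abs_nonneg _)
          (hD.abs.const_mul _) (ae_of_all _ fun w => ?_)
        simp only [abs_mul]
        exact mul_le_mul_of_nonneg_right (hb w) (abs_nonneg _)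
    _ ≤ _ := by
        rw [integral_const_mul]
        exact mul_le_mul_of_nonneg_left
          (integral_abs_condExp_pastSigma_sub_le hξ k n hZ hB) hb0

theorem integrable_mul_of_abs_le {α : Type*} [MeasurableSpace α] {μ : Measure α}
    [IsFiniteMeasure μ] {f g : α → ℝ} (hf : Measurable f) (hg : Measurable g) {b c : ℝ}
    (hb : ∀ x, |f x| ≤ b) (hc : ∀ x, |g x| ≤ c) : Integrable (fun x => f x * g x) μ :=
  (integrable_of_abs_le hf hb).mul_bdd hg.aestronglyMeasurable (ae_of_all _ hc)

theorem abs_integral_le_of_ae_abs_le {α : Type*} [MeasurableSpace α] {μ : Measure α}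
    [IsProbabilityMeasure μ] {f : α → ℝ} {C : ℝ} (h : ∀ᵐ x ∂μ, |f x| ≤ C) :
    |∫ x, f x ∂μ| ≤ C := by
  simpa using norm_integral_le_of_norm_le_const (f := f) (C := C) h

/-! ### Covariances and variances of approximately mixing sequences -/

/-- For u ≥ 1, one term y^m/m! of the series of e^y at y = a u^θ suffices as soon as mθ ≥ N. -/
theorem exists_pow_mul_exp_neg_rpow_le {a θ : ℝ} (ha : 0 < a) (hθ : 0 < θ) (N : ℕ) :
    ∃ C : ℝ, 0 < C ∧ ∀ u : ℝ, 0 ≤ u → (1 + u) ^ N * Real.exp (-a * u ^ θ) ≤ C := by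
  obtain ⟨m, hm⟩ := exists_nat_ge (N / θ)
  rw [div_le_iff₀ hθ] at hm
  refine ⟨2 ^ N * (1 + m.factorial / a ^ m), by positivity, fun u hu => ?_⟩
  have hy : 0 ≤ a * u ^ θ := mul_nonneg ha.le (Real.rpow_nonneg hu _)
  rcases le_total u 1 with h1 | h1
  · calc (1 + u) ^ N * Real.exp (-a * u ^ θ) ≤ 2 ^ N * 1 := by
          refine mul_le_mul (pow_le_pow_left₀ (by linarith) (by linarith) _)
            (Real.exp_le_one_iff.2 (by linarith)) (Real.exp_pos _).le (by positivity)
      _ ≤ _ := by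
          gcongr
          have : 0 ≤ (m.factorial : ℝ) / a ^ m := by positivity
          linarith
  · have hu0 : 0 < u := by linarith
    have e1 := Real.pow_div_factorial_le_exp _ hy m
    have e2 : u ^ N ≤ (u ^ θ) ^ m := by
      rw [← Real.rpow_natCast u N, ← Real.rpow_natCast (u ^ θ) m, ← Real.rpow_mul hu]
      exact Real.rpow_le_rpow_of_exponent_le h1 (by linarith)
    have e3 : u ^ N * Real.exp (-a * u ^ θ) ≤ m.factorial / a ^ m := by
      rw [neg_mul, Real.exp_neg, ← div_eq_mul_inv, div_le_div_iff₀ (Real.exp_pos _) (by positivity)]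
      rw [div_le_iff₀ (by positivity), mul_pow] at e1
      calc u ^ N * a ^ m ≤ (u ^ θ) ^ m * a ^ m := by gcongr
        _ ≤ _ := by linarith
    calc (1 + u) ^ N * Real.exp (-a * u ^ θ) ≤ (2 * u) ^ N * Real.exp (-a * u ^ θ) := by
          gcongr; linarith
      _ = 2 ^ N * (u ^ N * Real.exp (-a * u ^ θ)) := by rw [mul_pow]; ring
      _ ≤ 2 ^ N * (1 + m.factorial / a ^ m) := by gcongr; linarith

/-- The bound for the covariances at distance `k` of bounded variables that are exponentially
well approximated by functions of finite windows of a stretched exponentially mixing process. -/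
noncomputable def covBound (c₁ c₂ η B ρ : ℝ) (k : ℕ) : ℝ :=
  4 * B ^ 2 * (Real.exp (-ρ * (k / 2 : ℕ)) + c₁ * Real.exp (-c₂ * ((k / 2 : ℕ) : ℝ) ^ η))

theorem covBound_nonneg {c₁ c₂ η B ρ : ℝ} (hc₁ : 0 < c₁) (k : ℕ) :
    0 ≤ covBound c₁ c₂ η B ρ k := by
  unfold covBound; positivity

/-- Exponential and stretched exponential decay in k/2 both beat (1 + k/2)^2, so the series is
dominated by a multiple of ∑ 1/(k+1)². -/
theorem exists_sum_covBound_le {c₁ c₂ η B ρ : ℝ} (hc₁ : 0 < c₁) (hc₂ : 0 < c₂) (hη : 0 < η)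
    (hρ : 0 < ρ) : ∃ V : ℝ, 0 < V ∧
      ∀ N : ℕ, ∑ k ∈ Finset.range N, covBound c₁ c₂ η B ρ k ≤ V := by
  obtain ⟨A, hA, h1⟩ := exists_pow_mul_exp_neg_rpow_le hρ one_pos 2
  obtain ⟨A', hA', h2⟩ := exists_pow_mul_exp_neg_rpow_le hc₂ hη 2
  have hs : Summable fun k : ℕ => 16 * B ^ 2 * (A + c₁ * A') * (1 / ((k + 1 : ℕ) : ℝ) ^ 2) :=
    ((summable_nat_add_iff 1).2 (Real.summable_one_div_nat_pow.2 one_lt_two)).mul_left _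
  have hle : ∀ k : ℕ, covBound c₁ c₂ η B ρ k ≤
      16 * B ^ 2 * (A + c₁ * A') * (1 / ((k + 1 : ℕ) : ℝ) ^ 2) := by
    intro k
    set q : ℝ := ((k / 2 : ℕ) : ℝ) with hq
    have hq0 : 0 ≤ q := Nat.cast_nonneg _
    have hk : ((k + 1 : ℕ) : ℝ) ≤ 2 * (1 + q) := by
      rw [hq]
      have : k + 1 ≤ 2 * (1 + k / 2) := by omega
      exact_mod_cast this
    have g1 := h1 q hq0
    have g2 := h2 q hq0
    rw [Real.rpow_one] at g1
    rw [mul_one_div, le_div_iff₀ (by positivity)]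
    have hE : 0 ≤ Real.exp (-ρ * q) + c₁ * Real.exp (-c₂ * q ^ η) := by positivity
    calc covBound c₁ c₂ η B ρ k * ((k + 1 : ℕ) : ℝ) ^ 2
        ≤ covBound c₁ c₂ η B ρ k * (2 * (1 + q)) ^ 2 :=
          mul_le_mul_of_nonneg_left (pow_le_pow_left₀ (by positivity) hk 2)
            (covBound_nonneg hc₁ k)
      _ = 16 * B ^ 2 * ((1 + q) ^ 2 * Real.exp (-ρ * q) +
            c₁ * ((1 + q) ^ 2 * Real.exp (-c₂ * q ^ η))) := by
          unfold covBound; rw [← hq]; ring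
      _ ≤ _ := by gcongr
  refine ⟨∑' k : ℕ, 16 * B ^ 2 * (A + c₁ * A') * (1 / ((k + 1 : ℕ) : ℝ) ^ 2) + 1, ?_, fun N => ?_⟩
  · have : 0 ≤ ∑' k : ℕ, 16 * B ^ 2 * (A + c₁ * A') * (1 / ((k + 1 : ℕ) : ℝ) ^ 2) :=
      tsum_nonneg fun k => by positivity
    linarith
  · have := hs.sum_le_tsum (Finset.range N) fun k _ => by positivity
    linarith [Finset.sum_le_sum fun k (_ : k ∈ Finset.range N) => hle k]

/-- Centered variables `ψ j`, bounded by `B`, which are approximated up to `B e^{-ρ r}` by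
variables `ψ' r j` depending on the process in the window `[j - r, j]` only. -/
structure MixingApprox {Ω Y : Type*} [MeasurableSpace Ω] [MeasurableSpace Y] (Q : Measure Ω)
    (ξ : ℤ → Ω → Y) (B ρ : ℝ) (ψ : ℕ → Ω → ℝ) (ψ' : ℕ → ℕ → Ω → ℝ) : Prop where
  measurable : ∀ j, Measurable (ψ j)
  bound : ∀ j w, |ψ j w| ≤ B
  mean : ∀ j, ∫ w, ψ j w ∂Q = 0
  past : ∀ r j : ℕ, Measurable[pastSigma ξ j] (ψ' r j)
  future : ∀ r j : ℕ, Measurable[futureSigma ξ ((j : ℤ) - r)] (ψ' r j)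
  bound' : ∀ r j w, |ψ' r j w| ≤ B
  approx : ∀ r : ℕ, 1 ≤ r → ∀ j, ∀ᵐ w ∂Q, |ψ j w - ψ' r j w| ≤ B * Real.exp (-ρ * r)

namespace MixingApprox

variable {Ω Y : Type*} [MeasurableSpace Ω] [MeasurableSpace Y] {Q : Measure Ω}
  {ξ : ℤ → Ω → Y} {B ρ : ℝ} {ψ : ℕ → Ω → ℝ} {ψ' : ℕ → ℕ → Ω → ℝ}

/-- Truncation of the sequence at time `n`. -/
theorem truncate (H : MixingApprox Q ξ B ρ ψ ψ') (hB : 0 ≤ B) (n : ℕ) :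
    MixingApprox Q ξ B ρ (fun j w => if j < n then ψ j w else 0)
      (fun r j w => if j < n then ψ' r j w else 0) where
  measurable j := by
    by_cases h : j < n <;> simp only [h, if_true, if_false]
    exacts [H.measurable j, measurable_const]
  bound j w := by
    by_cases h : j < n <;> simp only [h, if_true, if_false]
    exacts [H.bound j w, by simpa using hB]
  mean j := by
    by_cases h : j < n <;> simp only [h, if_true, if_false]
    exacts [H.mean j, integral_zero _ _]
  past r j := by
    by_cases h : j < n <;> simp only [h, if_true, if_false]
    exacts [H.past r j, measurable_const]
  future r j := by
    by_cases h : j < n <;> simp only [h, if_true, if_false]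
    exacts [H.future r j, measurable_const]
  bound' r j w := by
    by_cases h : j < n <;> simp only [h, if_true, if_false]
    exacts [H.bound' r j w, by simpa using hB]
  approx r hr j := by
    by_cases h : j < n <;> simp only [h, if_true, if_false]
    · exact H.approx r hr j
    · exact ae_of_all _ fun w => by simpa using mul_nonneg hB (Real.exp_pos _).le

theorem measurable' (H : MixingApprox Q ξ B ρ ψ ψ') (hξ : ∀ j, Measurable (ξ j)) (r j : ℕ) :
    Measurable (ψ' r j) := (H.past r j).mono (pastSigma_le hξ j) le_rfl

variable [IsProbabilityMeasure Q]

theorem abs_integral_approx_le (H : MixingApprox Q ξ B ρ ψ ψ') (hξ : ∀ j, Measurable (ξ j))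
    {r : ℕ} (hr : 1 ≤ r) (j : ℕ) : |∫ w, ψ' r j w ∂Q| ≤ B * Real.exp (-ρ * r) := by
  have h1 : Integrable (ψ j) Q := integrable_of_abs_le (H.measurable j) (H.bound j)
  have h2 : Integrable (ψ' r j) Q := integrable_of_abs_le (H.measurable' hξ r j) (H.bound' r j)
  have e : ∫ w, ψ' r j w ∂Q = -∫ w, (ψ j w - ψ' r j w) ∂Q := by
    rw [integral_sub h1 h2, H.mean j]; ring
  rw [e, abs_neg]
  exact abs_integral_le_of_ae_abs_le (H.approx r hr j)

/-- Both variables are replaced by their approximations with window r = k/2. The window of the later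
one starts at least r after time i, so mixing applies across a gap r. -/
theorem abs_integral_mul_le {c₁ c₂ η : ℝ} (H : MixingApprox Q ξ B ρ ψ ψ')
    (hξ : ∀ j, Measurable (ξ j)) (hB : 0 ≤ B) (hc₁ : 0 < c₁)
    (hα : ∀ n : ℕ, 1 ≤ n → alphaCoeff Q ξ n ≤ c₁ * Real.exp (-c₂ * (n : ℝ) ^ η)) (i k : ℕ) :
    |∫ w, ψ i w * ψ (i + k) w ∂Q| ≤ covBound c₁ c₂ η B ρ k := by
  have hii : ∀ {f g : Ω → ℝ} (_ : ∀ w, |f w| ≤ B)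
      (_ : ∀ w, |g w| ≤ B), ∀ w, |f w * g w| ≤ B * B := fun h1 h2 w => by
    rw [abs_mul]; exact mul_le_mul (h1 w) (h2 w) (abs_nonneg _) hB
  -- For k < 2 the window would be r = 0, where neither the approximation nor the mixing rate is
  -- assumed; the trivial bound B² suffices.
  rcases lt_or_ge k 2 with hk | hk
  · have h0 : k / 2 = 0 := by omega
    have h1 := abs_integral_le_of_ae_abs_le (μ := Q)
      (ae_of_all _ (hii (H.bound i) (H.bound (i + k))))
    refine h1.trans ?_
    unfold covBound
    rw [h0]
    have : 0 ≤ c₁ * Real.exp (-c₂ * ((0 : ℕ) : ℝ) ^ η) := by positivity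
    simp only [Nat.cast_zero, mul_zero, Real.exp_zero] at this ⊢
    nlinarith [sq_nonneg B, mul_nonneg (sq_nonneg B) this]
  · set r := k / 2 with hr
    have hr1 : 1 ≤ r := by omega
    set E := Real.exp (-ρ * r) with hE
    have hE0 : 0 < E := Real.exp_pos _
    have m1 := H.measurable i
    have m2 := H.measurable (i + k)
    have m1' := H.measurable' hξ r i
    have m2' := H.measurable' hξ r (i + k)
    have hZ : Measurable[futureSigma ξ ((i : ℤ) + r)] (ψ' r (i + k)) :=
      (H.future r (i + k)).mono (futureSigma_anti ξ (by push_cast; omega)) le_rfl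
    have cov := abs_covariance_le_alphaCoeff (Q := Q) hξ i r (H.past r i) (H.bound' r i) hZ
      (H.bound' r (i + k))
    have hmean : |(∫ w, ψ' r i w ∂Q) * ∫ w, ψ' r (i + k) w ∂Q| ≤ B * (B * E) := by
      rw [abs_mul]
      refine mul_le_mul ?_ (H.abs_integral_approx_le hξ hr1 _) (abs_nonneg _) hB
      exact abs_integral_le_of_ae_abs_le (ae_of_all _ (H.bound' r i))
    have hdiff : |∫ w, ψ i w * ψ (i + k) w ∂Q - ∫ w, ψ' r i w * ψ' r (i + k) w ∂Q| ≤
        2 * (B * (B * E)) := by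
      rw [← integral_sub
        (integrable_mul_of_abs_le m1 m2 (H.bound i) (H.bound (i + k)))
        (integrable_mul_of_abs_le m1' m2' (H.bound' r i) (H.bound' r (i + k)))]
      refine abs_integral_le_of_ae_abs_le ?_
      · filter_upwards [H.approx r hr1 i, H.approx r hr1 (i + k)] with w h1 h2
        have e : ψ i w * ψ (i + k) w - ψ' r i w * ψ' r (i + k) w =
          ψ i w * (ψ (i + k) w - ψ' r (i + k) w) + ψ' r (i + k) w * (ψ i w - ψ' r i w) := by ring
        rw [e]
        refine (abs_add_le _ _).trans ?_
        rw [abs_mul, abs_mul]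
        have a1 := mul_le_mul (H.bound i w) h2 (abs_nonneg _) hB
        have a2 := mul_le_mul (H.bound' r (i + k) w) h1 (abs_nonneg _) hB
        linarith
    have hαr := hα r hr1
    have hB2 : 0 ≤ B ^ 2 * E := by positivity
    -- The covariance contributes 4B² times the mixing coefficient; the product of means contributes
    -- B²E and the replacement 2B²E, together below 4B²E.
    have hfin : B * (4 * B * alphaCoeff Q ξ r) ≤
        B * (4 * B * (c₁ * Real.exp (-c₂ * (r : ℝ) ^ η))) := by gcongr
    unfold covBound
    rw [← hr, ← hE]
    rw [abs_le] at cov hmean hdiff ⊢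
    constructor <;> nlinarith [cov.1, cov.2, hmean.1, hmean.2, hdiff.1, hdiff.2]

/-- Adding one summand costs its second moment, at most V, and twice the covariance with the earlier
sum, also at most V by summability over the distance. This explains the factor 3. -/
theorem integral_sum_sq_le {c₁ c₂ η V : ℝ} (H : MixingApprox Q ξ B ρ ψ ψ')
    (hξ : ∀ j, Measurable (ξ j)) (hB : 0 ≤ B) (hc₁ : 0 < c₁)
    (hα : ∀ n : ℕ, 1 ≤ n → alphaCoeff Q ξ n ≤ c₁ * Real.exp (-c₂ * (n : ℝ) ^ η))
    (hV : ∀ N : ℕ, ∑ k ∈ Finset.range N, covBound c₁ c₂ η B ρ k ≤ V) (a p : ℕ) :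
    ∫ w, (∑ j ∈ Finset.range p, ψ (a + j) w) ^ 2 ∂Q ≤ 3 * V * p := by
  induction p with
  | zero => simp
  | succ p ih =>
    set S : Ω → ℝ := fun w => ∑ j ∈ Finset.range p, ψ (a + j) w with hS
    have hSm : Measurable S := Finset.measurable_fun_sum _ fun j _ => H.measurable _
    have hSb : ∀ w, |S w| ≤ p * B := fun w => by
      calc |S w| ≤ ∑ j ∈ Finset.range p, |ψ (a + j) w| := Finset.abs_sum_le_sum_abs _ _
        _ ≤ ∑ j ∈ Finset.range p, B := Finset.sum_le_sum fun j _ => H.bound _ _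
        _ = p * B := by simp
    have hp := H.measurable (a + p)
    have i1 := integrable_mul_of_abs_le (μ := Q) hSm hSm hSb hSb
    have i2 := integrable_mul_of_abs_le (μ := Q) hSm hp hSb (H.bound _)
    have i3 := integrable_mul_of_abs_le (μ := Q) hp hp (H.bound _) (H.bound _)
    have i12 : Integrable (fun w => S w * S w + 2 * (S w * ψ (a + p) w)) Q :=
      i1.add (i2.const_mul 2)
    have e : ∫ w, (∑ j ∈ Finset.range (p + 1), ψ (a + j) w) ^ 2 ∂Q =
        ∫ w, S w * S w ∂Q + 2 * ∫ w, S w * ψ (a + p) w ∂Q +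
          ∫ w, ψ (a + p) w * ψ (a + p) w ∂Q := by
      rw [← integral_const_mul, ← integral_add i1 (i2.const_mul 2),
        ← integral_add i12 i3]
      congr 1; ext w
      rw [Finset.sum_range_succ]; simp only [hS]; ring
    have c0 := hV 1
    rw [Finset.sum_range_one] at c0
    have hlast := (le_abs_self _).trans (H.abs_integral_mul_le hξ hB hc₁ hα (a + p) 0)
    have hcross : ∫ w, S w * ψ (a + p) w ∂Q ≤ V := by
      simp only [hS, Finset.sum_mul]
      rw [integral_finsetSum _ fun j _ => integrable_mul_of_abs_le (H.measurable _) hp (H.bound _) (H.bound _)]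
      calc ∑ j ∈ Finset.range p, ∫ w, ψ (a + j) w * ψ (a + p) w ∂Q
          ≤ ∑ j ∈ Finset.range p, covBound c₁ c₂ η B ρ (p - 1 - j + 1) := by
            refine Finset.sum_le_sum fun j hj => ?_
            have hj' := Finset.mem_range.1 hj
            have := H.abs_integral_mul_le hξ hB hc₁ hα (a + j) (p - 1 - j + 1)
            rw [show a + j + (p - 1 - j + 1) = a + p by omega] at this
            exact (le_abs_self _).trans this
        _ = ∑ j ∈ Finset.range p, covBound c₁ c₂ η B ρ (j + 1) :=
            Finset.sum_range_reflect (fun j => covBound c₁ c₂ η B ρ (j + 1)) p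
        _ ≤ ∑ j ∈ Finset.range (p + 1), covBound c₁ c₂ η B ρ j := by
            rw [Finset.sum_range_succ']
            linarith [covBound_nonneg (c₂ := c₂) (η := η) (B := B) (ρ := ρ) hc₁ 0]
        _ ≤ V := hV _
    have hS2 : ∫ w, S w * S w ∂Q ≤ 3 * V * p := by
      simpa only [sq] using ih
    rw [e]; push_cast
    have : ∫ w, ψ (a + p) w * ψ (a + p) w ∂Q ≤ V := hlast.trans c0
    linarith

end MixingApprox

/-! ### Chernoff bounds for blocks -/

/-- A Chernoff bound for sums of bounded variables whose conditional exponential moments are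
close to their exponential moments in `L¹`. -/
theorem measureReal_sum_ge_le {Ω : Type*} {F : ℕ → MeasurableSpace Ω} {m0 : MeasurableSpace Ω}
    {Q : Measure Ω} [IsProbabilityMeasure Q] (hF : ∀ i, F i ≤ m0) (hmono : Monotone F)
    {D : ℕ → Ω → ℝ} (hD : ∀ i, Measurable[F (i + 1)] (D i)) {s : ℝ} (hs : 0 ≤ s)
    (hb : ∀ i w, |s * D i w| ≤ 1) {a v : ℝ}
    (ha : ∀ i, ∫ w, |(Q[fun w => Real.exp (s * D i w) | F i]) w -
      ∫ w, Real.exp (s * D i w) ∂Q| ∂Q ≤ a)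
    (hv : ∀ i, ∫ w, Real.exp (s * D i w) ∂Q ≤ 1 + v) (t : ℝ) (k : ℕ) :
    Q.real {w | t ≤ ∑ i ∈ Finset.range k, D i w} ≤ Real.exp (-(s * t) + k * v + 1) + k * a := by
  set Z : ℕ → Ω → ℝ := fun i w => Real.exp (s * D i w) with hZ
  set m : ℕ → Ω → ℝ := fun i => Q[Z i | F i] with hm
  have hD0 : ∀ i, Measurable (D i) := fun i => (hD i).mono (hF _) le_rfl
  have hZm : ∀ i, Measurable (Z i) := fun i => ((hD0 i).const_mul s).exp
  have hZb : ∀ i w, |Z i w| ≤ Real.exp 1 := fun i w => by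
    rw [abs_of_pos (Real.exp_pos _)]
    exact Real.exp_le_exp.2 (le_of_abs_le (hb i w))
  have hZi : ∀ i, Integrable (Z i) Q := fun i => integrable_of_abs_le (hZm i) (hZb i)
  have hmm : ∀ i, Measurable[F i] (m i) := fun i => stronglyMeasurable_condExp.measurable
  have hm0 : ∀ᵐ w ∂Q, ∀ i, 0 ≤ m i w := ae_all_iff.2 fun i =>
    condExp_nonneg (ae_of_all _ fun w => (Real.exp_pos _).le)
  -- The compensator m_i - 1 makes exp(U_k) a supermartingale, because e^{m-1} ≥ m. Unlike log m_i,
  -- it is controlled linearly by the L¹ distance of m_i to its mean.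
  set U : ℕ → Ω → ℝ := fun k w => ∑ i ∈ Finset.range k, (s * D i w - (m i w - 1)) with hU
  have hUm : ∀ k, Measurable[F k] (U k) := fun k => by
    refine Finset.measurable_fun_sum _ fun i hi => ?_
    have hi' := Finset.mem_range.1 hi
    exact (((hD i).mono (hmono hi') le_rfl).const_mul s).sub
      (((hmm i).mono (hmono hi'.le) le_rfl).sub_const 1)
  have hUb : ∀ᵐ w ∂Q, ∀ k, U k w ≤ 2 * k := by
    filter_upwards [hm0] with w hw k
    calc U k w ≤ ∑ i ∈ Finset.range k, (2 : ℝ) := Finset.sum_le_sum fun i _ => by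
          have := le_of_abs_le (hb i w); have := hw i; linarith
      _ = 2 * k := by simp [mul_comm]
  have hEi : ∀ k, Integrable (fun w => Real.exp (U k w)) Q := fun k => by
    refine Integrable.of_bound (((hUm k).mono (hF k) le_rfl).exp).aestronglyMeasurable
      (Real.exp (2 * k)) ?_
    filter_upwards [hUb] with w hw
    rw [Real.norm_eq_abs, abs_of_pos (Real.exp_pos _)]
    exact Real.exp_le_exp.2 (hw k)
  have hE : ∀ k, ∫ w, Real.exp (U k w) ∂Q ≤ 1 := by
    intro k
    induction k with
    | zero => simp [hU]
    | succ k ih =>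
      set W : Ω → ℝ := fun w => Real.exp (U k w - (m k w - 1)) with hW
      have hWm : Measurable[F k] W := ((hUm k).sub ((hmm k).sub_const 1)).exp
      have hWb : ∀ᵐ w ∂Q, ‖W w‖ ≤ Real.exp (2 * k + 1) := by
        filter_upwards [hUb, hm0] with w h1 h2
        rw [Real.norm_eq_abs, abs_of_pos (Real.exp_pos _)]
        refine Real.exp_le_exp.2 ?_
        have := h1 k; have := h2 k; linarith
      have hWZ : Integrable (fun w => W w * Z k w) Q :=
        (hZi k).bdd_mul (hWm.mono (hF k) le_rfl).aestronglyMeasurable hWb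
      have hWmk : Integrable (fun w => W w * m k w) Q :=
        integrable_condExp.bdd_mul (hWm.mono (hF k) le_rfl).aestronglyMeasurable hWb
      have e : ∀ w, Real.exp (U (k + 1) w) = W w * Z k w := fun w => by
        simp only [hU, hW, hZ, Finset.sum_range_succ, ← Real.exp_add]
        congr 1; ring
      simp_rw [e]
      have e2 : ∫ w, W w * Z k w ∂Q = ∫ w, W w * m k w ∂Q := by
        rw [← integral_condExp (hF k)]
        exact integral_congr_ae
          (condExp_mul_of_stronglyMeasurable_left hWm.stronglyMeasurable hWZ (hZi k))
      rw [e2]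
      refine le_trans (integral_mono hWmk (hEi k) fun w => ?_) ih
      simp only [hW]
      rw [Real.exp_sub, div_mul_eq_mul_div, div_le_iff₀ (Real.exp_pos _)]
      refine mul_le_mul_of_nonneg_left ?_ (Real.exp_pos _).le
      have := Real.add_one_le_exp (m k w - 1)
      linarith
  set R : Ω → ℝ := fun w => ∑ i ∈ Finset.range k, |m i w - ∫ w, Z i w ∂Q| with hR
  have hRi : ∀ i, Integrable (fun w => |m i w - ∫ w, Z i w ∂Q|) Q := fun i =>
    (integrable_condExp.sub (integrable_const _)).abs
  have hRint : ∫ w, R w ∂Q ≤ k * a := by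
    rw [hR, integral_finsetSum _ fun i _ => hRi i]
    calc _ ≤ ∑ i ∈ Finset.range k, a := Finset.sum_le_sum fun i _ => ha i
      _ = k * a := by simp
  have M1 := mul_meas_ge_le_integral_of_nonneg (μ := Q)
    (ae_of_all _ fun w => (Real.exp_pos (U k w)).le) (hEi k) (Real.exp (s * t - k * v - 1))
  have M2 := mul_meas_ge_le_integral_of_nonneg (μ := Q) (f := R)
    (ae_of_all _ fun w => Finset.sum_nonneg fun i _ => abs_nonneg _)
    (integrable_finsetSum _ fun i _ => hRi i) 1
  -- Off the event R ≥ 1 the compensators add up to at most 1 + kv. The exceptional event costs ka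
  -- by Markov's inequality.
  have hsub : {w | t ≤ ∑ i ∈ Finset.range k, D i w} ⊆
      {w | Real.exp (s * t - k * v - 1) ≤ Real.exp (U k w)} ∪ {w | 1 ≤ R w} := by
    intro w hw
    rcases le_or_gt 1 (R w) with h1 | h1
    · exact Or.inr h1
    · refine Or.inl (Real.exp_le_exp.2 ?_)
      have e : U k w = s * ∑ i ∈ Finset.range k, D i w -
          ∑ i ∈ Finset.range k, (m i w - 1) := by
        simp only [hU, Finset.sum_sub_distrib, Finset.mul_sum]
      have h2 : ∑ i ∈ Finset.range k, (m i w - 1) ≤ R w + k * v := by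
        have : R w + k * v = ∑ i ∈ Finset.range k, (|m i w - ∫ w, Z i w ∂Q| + v) := by
          simp [hR, Finset.sum_add_distrib]
        rw [this]
        refine Finset.sum_le_sum fun i _ => ?_
        have := le_abs_self (m i w - ∫ w, Z i w ∂Q)
        have := hv i
        linarith
      have h3 := mul_le_mul_of_nonneg_left (show t ≤ _ from hw) hs
      rw [e]; linarith
  calc _ ≤ Q.real ({w | Real.exp (s * t - k * v - 1) ≤ Real.exp (U k w)} ∪ {w | 1 ≤ R w}) :=
        measureReal_mono hsub
    _ ≤ _ := measureReal_union_le _ _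
    _ ≤ Real.exp (-(s * t) + k * v + 1) + k * a := by
        refine add_le_add ?_ (by linarith)
        have e : Real.exp (-(s * t) + k * v + 1) = 1 / Real.exp (s * t - k * v - 1) := by
          rw [one_div, ← Real.exp_neg]; congr 1; ring
        rw [e, le_div_iff₀ (Real.exp_pos _), mul_comm]
        exact M1.trans (hE k)

namespace MixingApprox

variable {Ω Y : Type*} [MeasurableSpace Ω] [MeasurableSpace Y] {Q : Measure Ω}
  {ξ : ℤ → Ω → Y} {B ρ : ℝ} {ψ : ℕ → Ω → ℝ} {ψ' : ℕ → ℕ → Ω → ℝ} [IsProbabilityMeasure Q]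

/-- Each centered approximation differs from ψ by at most 2ε. The resulting error p²ε² is still
linear in p, because ε decays exponentially in q = p/2. -/
theorem integral_block_sq_le {c₁ c₂ η V A : ℝ} (H : MixingApprox Q ξ B ρ ψ ψ')
    (hξ : ∀ j, Measurable (ξ j)) (hB : 0 ≤ B) (hρ : 0 < ρ) (hc₁ : 0 < c₁)
    (hα : ∀ n : ℕ, 1 ≤ n → alphaCoeff Q ξ n ≤ c₁ * Real.exp (-c₂ * (n : ℝ) ^ η))
    (hV : ∀ N : ℕ, ∑ k ∈ Finset.range N, covBound c₁ c₂ η B ρ k ≤ V)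
    (hA : ∀ u : ℝ, 0 ≤ u → (1 + u) * Real.exp (-ρ * u) ≤ A) {q : ℕ} (hq : 1 ≤ q) (b : ℕ) :
    ∫ w, (∑ j ∈ Finset.range (2 * q), (ψ' q (b + j) w - ∫ w, ψ' q (b + j) w ∂Q)) ^ 2 ∂Q ≤
      (6 * V + 16 * B ^ 2 * A) * (2 * q : ℕ) := by
  set ε := B * Real.exp (-ρ * q) with hε
  have hε0 : 0 ≤ ε := by positivity
  set p := 2 * q with hp
  have hθ : ∀ᵐ w ∂Q, ∀ j, |(ψ' q j w - ∫ w, ψ' q j w ∂Q) - ψ j w| ≤ 2 * ε := by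
    refine ae_all_iff.2 fun j => ?_
    filter_upwards [H.approx q hq j] with w hw
    have h2 := H.abs_integral_approx_le hξ hq j
    rw [← hε] at hw h2
    rw [abs_le] at hw h2 ⊢
    constructor <;> linarith [hw.1, hw.2, h2.1, h2.2]
  have hSm : Measurable fun w => ∑ j ∈ Finset.range p, ψ (b + j) w :=
    Finset.measurable_fun_sum _ fun j _ => H.measurable _
  have hSb : ∀ w, |∑ j ∈ Finset.range p, ψ (b + j) w| ≤ p * B := fun w => by
    calc _ ≤ ∑ j ∈ Finset.range p, |ψ (b + j) w| := Finset.abs_sum_le_sum_abs _ _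
      _ ≤ ∑ j ∈ Finset.range p, B := Finset.sum_le_sum fun j _ => H.bound _ _
      _ = p * B := by simp
  have hSi : Integrable (fun w => (∑ j ∈ Finset.range p, ψ (b + j) w) ^ 2) Q := by
    simpa only [sq] using integrable_mul_of_abs_le (μ := Q) hSm hSm hSb hSb
  calc _ ≤ ∫ w, (2 * (∑ j ∈ Finset.range p, ψ (b + j) w) ^ 2 + 2 * (p * (2 * ε)) ^ 2) ∂Q := by
        refine integral_mono_of_nonneg (ae_of_all _ fun w => sq_nonneg _)
          ((hSi.const_mul 2).add (integrable_const _)) ?_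
        filter_upwards [hθ] with w hw
        have h1 : |∑ j ∈ Finset.range p, (ψ' q (b + j) w - ∫ w, ψ' q (b + j) w ∂Q) -
            ∑ j ∈ Finset.range p, ψ (b + j) w| ≤ p * (2 * ε) := by
          rw [← Finset.sum_sub_distrib]
          calc _ ≤ ∑ j ∈ Finset.range p, |(ψ' q (b + j) w - ∫ w, ψ' q (b + j) w ∂Q) -
                  ψ (b + j) w| := Finset.abs_sum_le_sum_abs _ _
            _ ≤ ∑ j ∈ Finset.range p, 2 * ε := Finset.sum_le_sum fun j _ => hw _
            _ = p * (2 * ε) := by simp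
        have h2 := sq_le_sq' (neg_le_of_abs_le h1) (le_of_abs_le h1)
        set x := ∑ j ∈ Finset.range p, (ψ' q (b + j) w - ∫ w, ψ' q (b + j) w ∂Q)
        set y := ∑ j ∈ Finset.range p, ψ (b + j) w
        nlinarith [sq_nonneg (x - 2 * y)]
    _ = 2 * ∫ w, (∑ j ∈ Finset.range p, ψ (b + j) w) ^ 2 ∂Q + 2 * (p * (2 * ε)) ^ 2 := by
        rw [integral_add (hSi.const_mul 2) (integrable_const _), integral_const_mul,
          integral_const, probReal_univ, one_smul]
    _ ≤ 2 * (3 * V * p) + 8 * p ^ 2 * ε ^ 2 := by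
        have := H.integral_sum_sq_le hξ hB hc₁ hα hV b p
        nlinarith
    _ ≤ (6 * V + 16 * B ^ 2 * A) * p := by
        have hq0 : (0 : ℝ) ≤ q := Nat.cast_nonneg _
        have hE1 : Real.exp (-ρ * q) ≤ 1 := Real.exp_le_one_iff.2 (by nlinarith)
        have hE0 := Real.exp_pos (-ρ * q)
        have h1 : q * Real.exp (-ρ * q) ^ 2 ≤ A := by
          have := hA q hq0
          nlinarith [mul_le_of_le_one_right (mul_nonneg hq0 hE0.le) hE1]
        have hpq : (p : ℝ) = 2 * q := by rw [hp]; push_cast; ring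
        have h2 : (p : ℝ) * ε ^ 2 ≤ 2 * B ^ 2 * A := by
          rw [hpq, hε]
          calc 2 * (q : ℝ) * (B * Real.exp (-ρ * q)) ^ 2
              = 2 * B ^ 2 * (q * Real.exp (-ρ * q) ^ 2) := by ring
            _ ≤ _ := by gcongr
        have hp0 : (0 : ℝ) ≤ p := Nat.cast_nonneg _
        nlinarith [mul_le_mul_of_nonneg_left h2 hp0]

/-- Chernoff bound for the sum of every other block. -/
theorem measureReal_alternate_blocks_ge_le {c₁ c₂ η V A : ℝ} (H : MixingApprox Q ξ B ρ ψ ψ')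
    (hξ : ∀ j, Measurable (ξ j)) (hB : 0 ≤ B) (hρ : 0 < ρ) (hc₁ : 0 < c₁)
    (hα : ∀ n : ℕ, 1 ≤ n → alphaCoeff Q ξ n ≤ c₁ * Real.exp (-c₂ * (n : ℝ) ^ η))
    (hV : ∀ N : ℕ, ∑ k ∈ Finset.range N, covBound c₁ c₂ η B ρ k ≤ V)
    (hA : ∀ u : ℝ, 0 ≤ u → (1 + u) * Real.exp (-ρ * u) ≤ A) {q : ℕ} (hq : 1 ≤ q)
    {s : ℝ} (hs : 0 ≤ s) (hsq : s * (4 * q * B) ≤ 1) (t : ℝ) (k e : ℕ) :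
    Q.real {w | t ≤ ∑ i ∈ Finset.range k, ∑ j ∈ Finset.range (2 * q),
      (ψ' q ((2 * i + e) * (2 * q) + j) w - ∫ w, ψ' q ((2 * i + e) * (2 * q) + j) w ∂Q)} ≤
    Real.exp (-(s * t) + k * (s ^ 2 * ((6 * V + 16 * B ^ 2 * A) * (2 * q : ℕ))) + 1) +
      k * (4 * Real.exp 1 * (c₁ * Real.exp (-c₂ * (q : ℝ) ^ η))) := by
  set θ : ℕ → Ω → ℝ := fun j w => ψ' q j w - ∫ w, ψ' q j w ∂Q with hθ
  have hθm : ∀ j, Measurable (θ j) := fun j => (H.measurable' hξ q j).sub_const _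
  have hθb : ∀ j w, |θ j w| ≤ 2 * B := fun j w => by
    have h1 := H.bound' q j w
    have h2 := abs_integral_le_of_ae_abs_le (μ := Q) (ae_of_all _ (H.bound' q j))
    exact (abs_sub _ _).trans (by linarith)
  have hθ0 : ∀ j, ∫ w, θ j w ∂Q = 0 := fun j => by
    rw [hθ, integral_sub (integrable_of_abs_le (H.measurable' hξ q j) (H.bound' q j))
      (integrable_const _)]
    simp
  set D : ℕ → Ω → ℝ := fun i w => ∑ j ∈ Finset.range (2 * q), θ ((2 * i + e) * (2 * q) + j) w
    with hD
  have hDb : ∀ i w, |s * D i w| ≤ 1 := fun i w => by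
    rw [abs_mul, abs_of_nonneg hs]
    refine le_trans (mul_le_mul_of_nonneg_left ?_ hs) hsq
    calc |D i w| ≤ ∑ j ∈ Finset.range (2 * q), |θ ((2 * i + e) * (2 * q) + j) w| :=
          Finset.abs_sum_le_sum_abs _ _
      _ ≤ ∑ j ∈ Finset.range (2 * q), 2 * B := Finset.sum_le_sum fun j _ => hθb _ _
      _ = 4 * q * B := by simp; ring
  have hDm : ∀ i, Measurable (D i) := fun i => Finset.measurable_fun_sum _ fun j _ => hθm _
  have hDi : ∀ i, Integrable (fun w => s * D i w) Q := fun i =>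
    integrable_of_abs_le ((hDm i).const_mul s) (hDb i)
  -- The past stops one block length 2q before block i starts. This contains the preceding block of
  -- the same parity, whereas the windows of block i reach back only q, leaving a gap q for mixing.
  set F : ℕ → MeasurableSpace Ω := fun i =>
    pastSigma ξ (((2 * i + e : ℕ) : ℤ) * (2 * q : ℕ) - (2 * q : ℕ)) with hF
  refine measureReal_sum_ge_le (F := F) (fun i => pastSigma_le hξ _) ?_ (D := D) ?_ hs hDb
    ?_ ?_ t k
  · intro i i' hi
    refine pastSigma_mono ξ (sub_le_sub_right (mul_le_mul_of_nonneg_right ?_ (by positivity)) _)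
    push_cast; omega
  · intro i
    refine Finset.measurable_fun_sum _ fun j hj => ?_
    refine Measurable.sub_const ((H.past q _).mono (pastSigma_mono ξ ?_) le_rfl) _
    have hj' : ((j : ℕ) : ℤ) ≤ (2 * q : ℕ) := by exact_mod_cast (Finset.mem_range.1 hj).le
    push_cast at hj' ⊢
    linarith
  · intro i
    have hfut : Measurable[futureSigma ξ (((2 * i + e : ℕ) : ℤ) * (2 * q : ℕ) - (2 * q : ℕ) + q)]
        (D i) := by
      refine Finset.measurable_fun_sum _ fun j _ => ?_
      refine Measurable.sub_const ((H.future q _).mono (futureSigma_anti ξ ?_) le_rfl) _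
      push_cast
      have : (0 : ℤ) ≤ j := Nat.cast_nonneg _
      linarith
    have h1 := integral_abs_condExp_pastSigma_sub_le (Q := Q) hξ _ q
      (Z := fun w => Real.exp (s * D i w)) ((hfut.const_mul s).exp) (B := Real.exp 1)
      fun w => by
        rw [abs_of_pos (Real.exp_pos _)]
        exact Real.exp_le_exp.2 (le_of_abs_le (hDb i w))
    exact h1.trans (mul_le_mul_of_nonneg_left (hα q hq) (by positivity))
  · intro i
    have hsq : Integrable (fun w => (s * D i w) ^ 2) Q := by
      simpa only [sq] using integrable_mul_of_abs_le (μ := Q) ((hDm i).const_mul s)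
        ((hDm i).const_mul s) (hDb i) (hDb i)
    have hD0 : ∫ w, s * D i w ∂Q = 0 := by
      rw [integral_const_mul, hD, integral_finsetSum _ fun j _ =>
        integrable_of_abs_le (hθm _) (hθb _)]
      simp [hθ0]
    have h12 : Integrable (fun w => 1 + s * D i w) Q := (integrable_const _).add (hDi i)
    -- The inequality e^y ≤ 1 + y + y² for |y| ≤ 1 and the vanishing mean reduce the moment
    -- generating function to the block variance.
    calc ∫ w, Real.exp (s * D i w) ∂Q ≤ ∫ w, ((1 + s * D i w) + (s * D i w) ^ 2) ∂Q := by
          refine integral_mono_of_nonneg (ae_of_all _ fun w => (Real.exp_pos _).le)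
            (h12.add hsq) (ae_of_all _ fun w => ?_)
          have := le_of_abs_le (Real.abs_exp_sub_one_sub_id_le (hDb i w))
          simp only; linarith
      _ = 1 + s ^ 2 * ∫ w, D i w ^ 2 ∂Q := by
          rw [integral_add h12 hsq, integral_add (integrable_const _) (hDi i), hD0]
          simp only [mul_pow]
          rw [integral_const_mul]; simp
      _ ≤ _ := by
          have := H.integral_block_sq_le hξ hB hρ hc₁ hα hV hA hq ((2 * i + e) * (2 * q))
          have h2 := mul_le_mul_of_nonneg_left this (sq_nonneg s)
          linarith

end MixingApprox

/-- Separating even from odd blocks of length p makes blocks of one parity a full block apart. -/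
theorem sum_range_two_mul_mul (f : ℕ → ℝ) (p k : ℕ) :
    ∑ j ∈ Finset.range (2 * k * p), f j =
      ∑ i ∈ Finset.range k, ∑ j ∈ Finset.range p, f ((2 * i + 0) * p + j) +
        ∑ i ∈ Finset.range k, ∑ j ∈ Finset.range p, f ((2 * i + 1) * p + j) := by
  induction k with
  | zero => simp
  | succ k ih =>
    rw [show 2 * (k + 1) * p = 2 * k * p + p + p by ring, Finset.sum_range_add,
      Finset.sum_range_add, ih, Finset.sum_range_succ, Finset.sum_range_succ]
    simp only [add_zero, show (2 * k + 1) * p = 2 * k * p + p by ring]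
    ring

set_option maxHeartbeats 1600000 in
/-- Variance and tail bounds for the sums of bounded variables that are exponentially well
approximated by functions of finite windows of a stretched exponentially mixing process. -/
theorem exists_mixing_tail_bound {c₁ c₂ η B ρ : ℝ} (hc₁ : 0 < c₁) (hc₂ : 0 < c₂) (hη : 0 < η)
    (hB : 1 ≤ B) (hρ : 0 < ρ) : ∃ V C c : ℝ, 0 < V ∧ 0 < C ∧ 0 < c ∧
      ∀ (Ω : Type*) (Y : Type*) [MeasurableSpace Ω] [MeasurableSpace Y] (Q : Measure Ω)
        [IsProbabilityMeasure Q] (ξ : ℤ → Ω → Y) (ψ : ℕ → Ω → ℝ) (ψ' : ℕ → ℕ → Ω → ℝ),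
        (∀ j, Measurable (ξ j)) →
        (∀ n : ℕ, 1 ≤ n → alphaCoeff Q ξ n ≤ c₁ * Real.exp (-c₂ * (n : ℝ) ^ η)) →
        MixingApprox Q ξ B ρ ψ ψ' → ∀ n : ℕ, 1 ≤ n →
          ∫ w, (∑ j ∈ Finset.range n, ψ j w) ^ 2 ∂Q ≤ V * n ∧
          ∀ t : ℝ, √n ≤ t → Q.real {w | t ≤ ∑ j ∈ Finset.range n, ψ j w} ≤
            C * Real.exp (-c * min (t ^ 2 / n) (t ^ (η / (1 + η)))) := by
  obtain ⟨V, hV0, hV⟩ := exists_sum_covBound_le (B := B) hc₁ hc₂ hη hρ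
  obtain ⟨A, hA0, hA⟩ := exists_pow_mul_exp_neg_rpow_le hρ one_pos 1
  simp only [pow_one, Real.rpow_one] at hA
  set κ := η / (1 + η) with hκ
  have hκ0 : 0 < κ := by positivity
  -- With y = t^{1/(1+η)}, this gives n ≤ t² ≤ y^{M₁}, so the accumulated approximation error of
  -- order n e^{-ρy} is bounded by the constant `Ce`.
  obtain ⟨M₁, hM₁⟩ := exists_nat_ge (2 * (1 + η))
  obtain ⟨A₁, hA₁0, hA₁⟩ := exists_pow_mul_exp_neg_rpow_le hρ one_pos (M₁ + 0)
  simp only [Real.rpow_one, add_zero] at hA₁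
  obtain ⟨A₂, hA₂0, hA₂⟩ := exists_pow_mul_exp_neg_rpow_le (half_pos hc₂) hκ0 2
  set W := 6 * V + 16 * B ^ 2 * A with hW
  have hW0 : 0 < W := by positivity
  set Ce := 20 * B ^ 2 * A₁ with hCe
  -- Chosen so that for s ≤ t/(A₃ n) the quadratic term of the Chernoff exponent is at most st/4.
  set A₃ := 20 * B * W with hA₃
  have hA₃0 : 0 < A₃ := by positivity
  set c' := min (1 / A₃) (1 / (8 * B)) with hc'
  have hc'0 : 0 < c' := by positivity
  refine ⟨3 * V, 2 * (Real.exp (Ce / 2 + 1) + 8 * Real.exp 1 * c₁ * A₂), min (c' / 4) (c₂ / 2),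
    by positivity, by positivity, by positivity, ?_⟩
  intro Ω Y _ _ Q _ ξ ψ ψ' hξ hα H n hn
  have hB0 : 0 ≤ B := by linarith
  refine ⟨by simpa using H.integral_sum_sq_le hξ hB0 hc₁ hα hV 0 n, fun t ht => ?_⟩
  have hn1 : (1 : ℝ) ≤ n := by exact_mod_cast hn
  have hn0 : (0 : ℝ) < n := by linarith
  have ht1 : 1 ≤ t := le_trans (Real.one_le_sqrt.2 hn1) ht
  have ht0 : 0 < t := by linarith
  have hnt : (n : ℝ) ≤ t ^ 2 := (Real.sqrt_le_left ht0.le).1 ht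
  rcases lt_or_ge (n * B) t with hbig | hsmall
  · have : {w | t ≤ ∑ j ∈ Finset.range n, ψ j w} = ∅ := by
      refine Set.eq_empty_of_forall_notMem fun w hw => ?_
      have h1 : ∑ j ∈ Finset.range n, ψ j w ≤ n * B := by
        calc _ ≤ ∑ j ∈ Finset.range n, B :=
              Finset.sum_le_sum fun j _ => le_of_abs_le (H.bound j w)
          _ = n * B := by simp
      exact absurd (le_trans (show t ≤ _ from hw) h1) (not_le.2 hbig)
    rw [this]; simp only [measureReal_empty]; positivity
  -- the block length
  set y := t ^ (1 / (1 + η)) with hy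
  have hη1 : 0 < 1 + η := by linarith
  have hy1 : 1 ≤ y := Real.one_le_rpow ht1 (by positivity)
  have hyt : y ≤ t := by
    calc y ≤ t ^ (1 : ℝ) := Real.rpow_le_rpow_of_exponent_le ht1
          ((div_le_one hη1).2 (by linarith))
      _ = t := Real.rpow_one t
  have hy0 : 0 < y := by linarith
  set q := ⌈y⌉₊ with hq
  have hqy : y ≤ q := Nat.le_ceil y
  have hqy2 : (q : ℝ) ≤ 2 * y := by
    have := Nat.ceil_lt_add_one hy0.le
    linarith
  have hq1 : 1 ≤ q := Nat.one_le_ceil_iff.2 hy0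
  have hq0 : (0 : ℝ) < q := by linarith
  set u := t ^ κ with hu
  -- The block length balances the mixing exponent y^η with t/y, the limit imposed by s of order
  -- 1/y; both equal t^κ.
  have hyu : y ^ η = u := by
    rw [hy, ← Real.rpow_mul ht0.le, hu, hκ]; congr 1; ring
  have hty : t / y = u := by
    rw [hy, hu, hκ]
    nth_rewrite 1 [← Real.rpow_one t]
    rw [← Real.rpow_sub ht0]; congr 1; field_simp; ring
  have hu1 : 1 ≤ u := Real.one_le_rpow ht1 hκ0.le
  -- the number of pairs of blocks
  set k := n / (4 * q) + 1 with hk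
  have hnk : n ≤ 2 * k * (2 * q) := by
    have := Nat.lt_div_mul_add (a := n) (b := 4 * q) (by omega)
    rw [hk]; nlinarith
  -- The overshoot 2q ≤ 4y ≤ 4t is absorbed using t ≤ nB, the case that remains after large t has
  -- been excluded.
  have hkq : (k : ℝ) * (2 * q) ≤ 5 * B * n := by
    have h1 : k * (2 * q) ≤ n + 2 * q := by
      have := Nat.div_mul_le_self n (4 * q)
      rw [hk]; nlinarith
    have h2 : (k : ℝ) * (2 * q) ≤ n + 2 * q := by exact_mod_cast h1
    nlinarith
  have hkn : (k : ℝ) ≤ 2 * t ^ 2 := by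
    have h1 : k ≤ n + 1 := by
      have := Nat.div_le_self n (4 * q); omega
    have h2 : (k : ℝ) ≤ n + 1 := by exact_mod_cast h1
    nlinarith
  have HT := H.truncate hB0 n
  set ψt : ℕ → Ω → ℝ := fun j w => if j < n then ψ j w else 0 with hψt
  set ψt' : ℕ → ℕ → Ω → ℝ := fun r j w => if j < n then ψ' r j w else 0 with hψt'
  set θ : ℕ → Ω → ℝ := fun j w => ψt' q j w - ∫ w, ψt' q j w ∂Q with hθ
  -- Up to constants the first entry is the Gaussian optimum; the second keeps s times a block sum
  -- below 1.
  set s := min (t / (A₃ * n)) (1 / (8 * B * y)) with hs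
  have hs0 : 0 ≤ s := by positivity
  have hs2 : s ≤ 1 / (8 * B * y) := min_le_right _ _
  have hsq : s * (4 * q * B) ≤ 1 := by
    calc s * (4 * q * B) ≤ 1 / (8 * B * y) * (4 * (2 * y) * B) := by gcongr
      _ = 1 := by field_simp; norm_num
  have hs1 : s ≤ 1 := hs2.trans ((div_le_one (by positivity)).2 (by nlinarith))
  -- After the approximation error is removed, one of the two parities must carry half of the
  -- deviation.
  set t' := (t - Ce) / 2 with ht'
  -- replacing the variables by their approximations
  have hsum : ∀ᵐ w ∂Q, ∑ j ∈ Finset.range n, ψ j w ≤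
      ∑ j ∈ Finset.range (2 * k * (2 * q)), θ j w + Ce := by
    have hap : ∀ᵐ w ∂Q, ∀ j, |ψt j w - ψt' q j w| ≤ B * Real.exp (-ρ * q) :=
      ae_all_iff.2 fun j => HT.approx q hq1 j
    filter_upwards [hap] with w hw
    have e1 : ∑ j ∈ Finset.range n, ψ j w = ∑ j ∈ Finset.range (2 * k * (2 * q)), ψt j w := by
      rw [← Finset.sum_subset (Finset.range_mono hnk)]
      · exact Finset.sum_congr rfl fun j hj => by simp [hψt, Finset.mem_range.1 hj]
      · intro j _ hj
        simp [hψt, Finset.mem_range.not.1 hj]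
    have e2 : ∑ j ∈ Finset.range (2 * k * (2 * q)), ψt j w ≤
        ∑ j ∈ Finset.range (2 * k * (2 * q)), (θ j w + 2 * B * Real.exp (-ρ * y)) := by
      refine Finset.sum_le_sum fun j _ => ?_
      have h1 := le_of_abs_le (hw j)
      have h2 := le_of_abs_le (HT.abs_integral_approx_le hξ hq1 j)
      have h3 : B * Real.exp (-ρ * q) ≤ B * Real.exp (-ρ * y) :=
        mul_le_mul_of_nonneg_left (Real.exp_le_exp.2 (by nlinarith)) hB0
      simp only [hθ]
      linarith
    rw [e1]
    refine e2.trans ?_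
    rw [Finset.sum_add_distrib]
    refine add_le_add le_rfl ?_
    rw [Finset.sum_const, Finset.card_range, nsmul_eq_mul]
    push_cast
    have hy2 : t ^ 2 ≤ y ^ M₁ := by
      rw [hy, ← Real.rpow_natCast, ← Real.rpow_natCast _ M₁, ← Real.rpow_mul ht0.le]
      refine Real.rpow_le_rpow_of_exponent_le ht1 ?_
      rw [one_div, inv_mul_eq_div, le_div_iff₀ hη1]
      exact_mod_cast hM₁
    calc (2 * k * (2 * q) : ℝ) * (2 * B * Real.exp (-ρ * y))
        = 4 * B * (k * (2 * q)) * Real.exp (-ρ * y) := by ring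
      _ ≤ 4 * B * (5 * B * n) * Real.exp (-ρ * y) := by gcongr
      _ ≤ 4 * B * (5 * B * (1 + y) ^ M₁) * Real.exp (-ρ * y) := by
          gcongr
          exact hnt.trans (hy2.trans (pow_le_pow_left₀ hy0.le (by linarith) _))
      _ = 20 * B ^ 2 * ((1 + y) ^ M₁ * Real.exp (-ρ * y)) := by ring
      _ ≤ Ce := by
          rw [hCe]
          exact mul_le_mul_of_nonneg_left (hA₁ y hy0.le) (by positivity)
  -- the exponent
  set m := min (t ^ 2 / n) u with hm
  have hm0 : 0 ≤ m := by positivity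
  have hst : c' * m ≤ s * t := by
    rw [hs, min_mul_of_nonneg _ _ ht0.le]
    refine le_min ?_ ?_
    · calc c' * m ≤ 1 / A₃ * (t ^ 2 / n) :=
            mul_le_mul (min_le_left _ _) (min_le_left _ _) hm0 (by positivity)
        _ = _ := by field_simp
    · calc c' * m ≤ 1 / (8 * B) * u :=
            mul_le_mul (min_le_right _ _) (min_le_right _ _) hm0 (by positivity)
        _ = _ := by rw [← hty]; field_simp
  have hblock : ∀ e : ℕ, Q.real {w | t' ≤ ∑ i ∈ Finset.range k, ∑ j ∈ Finset.range (2 * q),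
      θ ((2 * i + e) * (2 * q) + j) w} ≤
      (Real.exp (Ce / 2 + 1) + 8 * Real.exp 1 * c₁ * A₂) *
        Real.exp (-(min (c' / 4) (c₂ / 2)) * m) := by
    intro e
    have hch := HT.measureReal_alternate_blocks_ge_le hξ hB0 hρ hc₁ hα hV hA hq1 hs0 hsq t' k e
    refine hch.trans ?_
    rw [add_mul (Real.exp (Ce / 2 + 1))]
    refine add_le_add ?_ ?_
    · rw [← Real.exp_add]
      refine Real.exp_le_exp.2 ?_
      have h1 : k * (s ^ 2 * (W * (2 * q : ℕ))) ≤ s * t / 4 := by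
        push_cast
        calc (k : ℝ) * (s ^ 2 * (W * (2 * q))) = s * s * W * (k * (2 * q)) := by ring
          _ ≤ s * (t / (A₃ * n)) * W * (5 * B * n) := by
              have : s ≤ t / (A₃ * n) := min_le_left _ _
              gcongr
          _ = s * t / 4 := by rw [hA₃]; field_simp; ring
      have h2 : s * Ce ≤ Ce := mul_le_of_le_one_left (by positivity) hs1
      have h3 : min (c' / 4) (c₂ / 2) * m ≤ c' / 4 * m :=
        mul_le_mul_of_nonneg_right (min_le_left _ _) hm0
      have h4 : s * t' = s * t / 2 - s * Ce / 2 := by rw [ht']; ring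
      rw [h4]
      linarith
    -- Half of the mixing exponent absorbs the number of blocks, of order t²; the other half remains
    -- as decay.
    · have h1 : Real.exp (-c₂ * (q : ℝ) ^ η) ≤ Real.exp (-c₂ * u) := by
        refine Real.exp_le_exp.2 ?_
        have : u ≤ (q : ℝ) ^ η := hyu ▸ Real.rpow_le_rpow hy0.le hqy hη.le
        nlinarith
      have h2 : t ^ 2 * Real.exp (-(c₂ / 2) * u) ≤ A₂ := by
        refine le_trans ?_ (hA₂ t ht0.le)
        gcongr
        linarith
      have h3 : Real.exp (-(c₂ / 2) * u) ≤ Real.exp (-(min (c' / 4) (c₂ / 2)) * m) := by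
        refine Real.exp_le_exp.2 ?_
        have : min (c' / 4) (c₂ / 2) * m ≤ c₂ / 2 * u :=
          mul_le_mul (min_le_right _ _) (min_le_right _ _) hm0 (by positivity)
        linarith
      have h4 : Real.exp (-c₂ * u) = Real.exp (-(c₂ / 2) * u) * Real.exp (-(c₂ / 2) * u) := by
        rw [← Real.exp_add]; congr 1; ring
      calc (k : ℝ) * (4 * Real.exp 1 * (c₁ * Real.exp (-c₂ * (q : ℝ) ^ η)))
          ≤ 2 * t ^ 2 * (4 * Real.exp 1 * (c₁ * Real.exp (-c₂ * u))) := by gcongr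
        _ = 8 * Real.exp 1 * c₁ * (t ^ 2 * Real.exp (-(c₂ / 2) * u)) *
            Real.exp (-(c₂ / 2) * u) := by rw [h4]; ring
        _ ≤ _ := by gcongr
  have hsub : ∀ᵐ w ∂Q, w ∈ {w | t ≤ ∑ j ∈ Finset.range n, ψ j w} →
      w ∈ {w | t' ≤ ∑ i ∈ Finset.range k, ∑ j ∈ Finset.range (2 * q),
        θ ((2 * i + 0) * (2 * q) + j) w} ∪ {w | t' ≤ ∑ i ∈ Finset.range k,
          ∑ j ∈ Finset.range (2 * q), θ ((2 * i + 1) * (2 * q) + j) w} := by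
    filter_upwards [hsum] with w hw hwt
    have hwt' : t ≤ ∑ j ∈ Finset.range n, ψ j w := hwt
    rw [sum_range_two_mul_mul (fun j => θ j w)] at hw
    by_contra hcon
    simp only [Set.mem_union, Set.mem_ofPred_eq, not_or, not_le] at hcon
    linarith [hcon.1, hcon.2]
  calc _ ≤ Q.real _ := ENNReal.toReal_mono (measure_ne_top _ _) (measure_mono_ae hsub)
    _ ≤ _ := measureReal_union_le _ _
    _ ≤ _ := by linarith [hblock 0, hblock 1]

/-! ### The shift and the fiber maps -/

theorem measurable_shift {Y : Type*} [MeasurableSpace Y] (k : ℤ) :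
    Measurable (shift k : (ℤ → Y) → ℤ → Y) :=
  measurable_pi_lambda _ fun j => measurable_pi_apply (j + k)

theorem shift_shift {Y : Type*} (k l : ℤ) (ω : ℤ → Y) : shift k (shift l ω) = shift (k + l) ω := by
  funext j; simp only [shift, add_assoc]

theorem shift_zero {Y : Type*} (ω : ℤ → Y) : shift 0 ω = ω := by
  funext j; simp only [shift, add_zero]

theorem isProbabilityMeasure_pathLaw {Ω Y : Type*} [MeasurableSpace Ω] [MeasurableSpace Y]
    {Q : Measure Ω} [IsProbabilityMeasure Q] {ξ : ℤ → Ω → Y} (hξ : ∀ j, Measurable (ξ j)) :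
    IsProbabilityMeasure (pathLaw Q ξ) :=
  Measure.isProbabilityMeasure_map (measurable_pi_lambda _ hξ).aemeasurable

theorem measurePreserving_shift {Ω Y : Type*} [MeasurableSpace Ω] [MeasurableSpace Y]
    {Q : Measure Ω} {ξ : ℤ → Ω → Y} (hξ : ∀ j, Measurable (ξ j)) (hs : IsStationary Q ξ) (k : ℤ) :
    MeasurePreserving (shift k) (pathLaw Q ξ) (pathLaw Q ξ) := by
  refine ⟨measurable_shift k, ?_⟩
  unfold pathLaw
  rw [Measure.map_map (measurable_shift k) (measurable_pi_lambda _ hξ)]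
  exact hs k

/-- The compositions `T_{ω_{n-1}} ∘ ⋯ ∘ T_{ω_0}`. -/
def fiberIter {Y X : Type*} (T : Y → X → X) (ω : ℤ → Y) : ℕ → X → X
  | 0, x => x
  | n + 1, x => T (ω n) (fiberIter T ω n x)

theorem iterate_skewProduct {Y X : Type*} (T : Y → X → X) (n : ℕ) (z : (ℤ → Y) × X) :
    (skewProduct T)^[n] z = (shift n z.1, fiberIter T z.1 n z.2) := by
  induction n with
  | zero => simp [shift_zero, fiberIter]
  | succ n ih =>
    rw [Function.iterate_succ_apply', ih]
    simp only [skewProduct, shift_shift, fiberIter]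
    refine Prod.ext ?_ ?_
    · simp [add_comm]
    · simp [shift]

/-- The map T is read off from the skew product along constant sequences ω. -/
theorem measurable_uncurry_of_skewProduct {Y X : Type*} [MeasurableSpace Y] [MeasurableSpace X]
    {T : Y → X → X} (h : Measurable (skewProduct T)) : Measurable (Function.uncurry T) := by
  have h1 : Measurable fun p : Y × X => (((fun _ : ℤ => p.1), p.2) : (ℤ → Y) × X) :=
    (measurable_pi_lambda _ fun _ => measurable_fst).prodMk measurable_snd
  exact measurable_snd.comp (h.comp h1)

/-- Only the coordinates 0, ..., n-1 enter. The σ-algebra on α is arbitrary, so that past and future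
σ-algebras of the process can be inserted. -/
theorem measurable_fiberIter {α Y X : Type*} [MeasurableSpace α] [MeasurableSpace Y]
    [MeasurableSpace X] {T : Y → X → X} (hT : Measurable (Function.uncurry T)) {u : α → ℤ → Y}
    {n : ℕ} (hu : ∀ i : ℕ, i < n → Measurable fun a => u a i) :
    Measurable fun p : α × X => fiberIter T (u p.1) n p.2 := by
  induction n with
  | zero => exact measurable_snd
  | succ n ih =>
    exact hT.comp (((hu n (Nat.lt_succ_self n)).comp measurable_fst).prodMk
      (ih fun i hi => hu i (hi.trans (Nat.lt_succ_self n))))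

/-- Iterated duality for transfer operators. -/
theorem setIntegral_transfer_iterate {Y X : Type*} [MeasurableSpace X] {m : Measure X}
    [IsFiniteMeasure m] {T : Y → X → X} {ω : ℤ → Y}
    (hq : ∀ n : ℕ, Measure.QuasiMeasurePreserving (T (ω n)) m m) {U : ℕ → X → ℂ}
    (h0 : Integrable (U 0) m) (hU : ∀ n : ℕ, U (n + 1) =ᵐ[m] transfer m (T (ω n)) (U n)) (n : ℕ) :
    Integrable (U n) m ∧ ∀ B, MeasurableSet B →
      ∫ x in B, U n x ∂m = ∫ x in fiberIter T ω n ⁻¹' B, U 0 x ∂m := by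
  induction n with
  | zero => exact ⟨h0, fun B _ => rfl⟩
  | succ n ih =>
    refine ⟨(integrable_transfer _ _ _).congr (hU n).symm, fun B hB => ?_⟩
    rw [integral_congr_ae (ae_restrict_of_ae (hU n)),
      setIntegral_transfer m _ (hq n) _ ih.1 B hB, ih.2 _ ((hq n).measurable hB)]
    rfl

/-! ### BV norms -/

/-- The strict inequality provides an actual version with norm below c; the infimum itself need not
be attained. -/
theorem ae_enorm_le_of_bvNormAE_lt {X : Type*} [MeasurableSpace X] {m : Measure X} {C₀ : ℝ≥0}
    {v : (X → ℂ) → ℝ≥0∞} (hv : IsVariation m C₀ v) {f : X → ℂ} {c : ℝ≥0∞}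
    (h : bvNormAE m v f < c) : ∀ᵐ x ∂m, ‖f x‖ₑ ≤ C₀ * c := by
  unfold bvNormAE at h
  simp only [iInf_lt_iff] at h
  obtain ⟨g, ⟨hg, hgf⟩, hgc⟩ := h
  filter_upwards [hgf] with x hx
  rw [← hx]
  refine (le_iSup (fun x => ‖g x‖ₑ) x).trans ((hv.sup_le g hg).trans ?_)
  rw [add_comm]
  gcongr
  exact hgc.le

theorem lintegral_enorm_le_of_bvNormAE_lt {X : Type*} [MeasurableSpace X] {m : Measure X}
    {v : (X → ℂ) → ℝ≥0∞} {f : X → ℂ} {c : ℝ≥0∞} (h : bvNormAE m v f < c) :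
    ∫⁻ x, ‖f x‖ₑ ∂m ≤ c := by
  unfold bvNormAE at h
  simp only [iInf_lt_iff] at h
  obtain ⟨g, ⟨hg, hgf⟩, hgc⟩ := h
  calc ∫⁻ x, ‖f x‖ₑ ∂m = ∫⁻ x, ‖g x‖ₑ ∂m :=
        lintegral_congr_ae (hgf.mono fun x hx => by simp only [hx])
    _ ≤ bvNorm m v g := le_self_add
    _ ≤ c := hgc.le

theorem enorm_le_bvNorm {X : Type*} [MeasurableSpace X] {m : Measure X} {C₀ : ℝ≥0}
    {v : (X → ℂ) → ℝ≥0∞} (hv : IsVariation m C₀ v) {f : X → ℂ} (hf : Measurable f) (x : X) :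
    ‖f x‖ₑ ≤ C₀ * bvNorm m v f := by
  refine (le_iSup (fun x => ‖f x‖ₑ) x).trans ((hv.sup_le f hf).trans ?_)
  rw [add_comm]; rfl

theorem bvNorm_sub_const_le {X : Type*} [MeasurableSpace X] {m : Measure X}
    [IsProbabilityMeasure m] {C₀ : ℝ≥0} {v : (X → ℂ) → ℝ≥0∞} (hv : IsVariation m C₀ v)
    {f : X → ℂ} (hf : Measurable f) (c : ℂ) :
    bvNorm m v (fun x => f x - c) ≤ bvNorm m v f + ‖c‖ₑ := by
  have h1 : v (fun x => f x - c) ≤ v f := by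
    have := hv.add_le f (fun _ => -c) hf measurable_const
    rw [hv.const, add_zero] at this
    simpa only [sub_eq_add_neg] using this
  have h2 : ∫⁻ x, ‖f x - c‖ₑ ∂m ≤ ∫⁻ x, ‖f x‖ₑ ∂m + ‖c‖ₑ := by
    calc ∫⁻ x, ‖f x - c‖ₑ ∂m ≤ ∫⁻ x, (‖f x‖ₑ + ‖c‖ₑ) ∂m := lintegral_mono fun x => enorm_sub_le
      _ = _ := by rw [lintegral_add_right _ measurable_const]; simp
  unfold bvNorm
  calc _ ≤ (∫⁻ x, ‖f x‖ₑ ∂m + ‖c‖ₑ) + v f := add_le_add h2 h1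
    _ = _ := by ring

/-! ### The invariant measure -/

theorem integral_skewMeasure {Y X : Type*} [MeasurableSpace Y] [MeasurableSpace X]
    {P : Measure (ℤ → Y)} [IsProbabilityMeasure P] {m : Measure X} [IsProbabilityMeasure m]
    {h : (ℤ → Y) → X → ℝ} (hm : Measurable (Function.uncurry h)) (h0 : ∀ ω x, 0 ≤ h ω x)
    (hp : IsProbabilityMeasure (skewMeasure P m h)) {f : (ℤ → Y) × X → ℝ} (hf : Measurable f)
    {C : ℝ} (hC : ∀ z, |f z| ≤ C) :
    Integrable (fun ω => ∫ x, f (ω, x) * h ω x ∂m) P ∧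
      ∫ z, f z ∂(skewMeasure P m h) = ∫ ω, ∫ x, f (ω, x) * h ω x ∂m ∂P := by
  have hm' : Measurable fun z : (ℤ → Y) × X => h z.1 z.2 := hm
  have hhi : Integrable (fun z : (ℤ → Y) × X => h z.1 z.2) (P.prod m) := by
    refine ⟨hm'.aestronglyMeasurable, ?_⟩
    rw [hasFiniteIntegral_iff_ofReal (ae_of_all _ fun z : (ℤ → Y) × X => h0 z.1 z.2)]
    have := hp.measure_univ
    unfold skewMeasure at this
    rw [withDensity_apply _ MeasurableSet.univ, Measure.restrict_univ] at this
    rw [this]; exact ENNReal.one_lt_top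
  have hfi : Integrable (fun z : (ℤ → Y) × X => f z * h z.1 z.2) (P.prod m) :=
    hhi.bdd_mul hf.aestronglyMeasurable (ae_of_all _ hC)
  refine ⟨hfi.integral_prod_left, ?_⟩
  unfold skewMeasure
  rw [integral_withDensity_eq_integral_toReal_smul hm'.ennreal_ofReal
    (ae_of_all _ fun z => ENNReal.ofReal_lt_top)]
  have e : ∀ z : (ℤ → Y) × X, (ENNReal.ofReal (h z.1 z.2)).toReal • f z = f z * h z.1 z.2 :=
    fun z => by rw [ENNReal.toReal_ofReal (h0 _ _), smul_eq_mul, mul_comm]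
  simp_rw [e]
  exact integral_prod _ hfi

/-- Almost every fiber density h_ω has mass 1, so integrating over the fiber returns P. -/
theorem measurePreserving_fst_skewMeasure {Y X : Type*} [MeasurableSpace Y] [MeasurableSpace X]
    {P : Measure (ℤ → Y)} [IsProbabilityMeasure P] {m : Measure X} [IsProbabilityMeasure m]
    {h : (ℤ → Y) → X → ℝ} (hm : Measurable (Function.uncurry h)) (h0 : ∀ ω x, 0 ≤ h ω x)
    (hp : IsProbabilityMeasure (skewMeasure P m h)) (h1 : ∀ᵐ ω ∂P, ∫ x, h ω x ∂m = 1) :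
    MeasurePreserving Prod.fst (skewMeasure P m h) P := by
  refine ⟨measurable_fst, Measure.ext fun A hA => ?_⟩
  rw [Measure.map_apply measurable_fst hA, ← ENNReal.toReal_eq_toReal_iff' (measure_ne_top _ _)
    (measure_ne_top _ _)]
  have hA' : MeasurableSet (Prod.fst ⁻¹' A : Set ((ℤ → Y) × X)) := measurable_fst hA
  have := (integral_skewMeasure hm h0 hp (f := (Prod.fst ⁻¹' A).indicator fun _ => (1 : ℝ))
    (measurable_const.indicator hA') (C := 1) fun z => by
      by_cases hz : z ∈ (Prod.fst ⁻¹' A : Set ((ℤ → Y) × X)) <;> simp [hz]).2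
  rw [integral_indicator_const _ hA'] at this
  simp only [smul_eq_mul, mul_one] at this
  change (skewMeasure P m h).real _ = P.real A
  rw [this, ← mul_one (P.real A), ← smul_eq_mul, ← integral_indicator_const _ hA]
  refine integral_congr_ae ?_
  filter_upwards [h1] with ω hω
  by_cases hωA : ω ∈ A
  · simp [hωA, hω]
  · simp [hωA]

/-- Truncation of the values of a function to `[-b, b]`. -/
noncomputable def clip (b t : ℝ) : ℝ := max (-b) (min b t)

theorem abs_clip_le {b : ℝ} (hb : 0 ≤ b) (t : ℝ) : |clip b t| ≤ b :=
  abs_le.2 ⟨le_max_left _ _, max_le (by linarith) (min_le_left _ _)⟩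

theorem clip_of_abs_le {b t : ℝ} (h : |t| ≤ b) : clip b t = t := by
  rw [abs_le] at h
  rw [clip, min_eq_right h.2, max_eq_right h.1]

theorem measurable_clip (b : ℝ) : Measurable (clip b) := by
  unfold clip; fun_prop

/-- The fiber means `∫ φ_ω h_ω dm`, truncated to `[-b, b]`. -/
noncomputable def fiberMean {Y X : Type*} [MeasurableSpace X] (m : Measure X)
    (h : (ℤ → Y) → X → ℝ) (φ : Y → X → ℝ) (b : ℝ) (ω : ℤ → Y) : ℝ :=
  clip b (∫ x, φ (ω 0) x * h ω x ∂m)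

theorem integrable_of_integral_eq_one {X : Type*} [MeasurableSpace X] {m : Measure X} {f : X → ℝ}
    (h : ∫ x, f x ∂m = 1) : Integrable f m := by
  by_contra hf
  rw [integral_undef hf] at h
  exact zero_ne_one h

theorem measurable_fiberMean {Y X : Type*} [MeasurableSpace Y] [MeasurableSpace X]
    {m : Measure X} [SFinite m] {h : (ℤ → Y) → X → ℝ} {φ : Y → X → ℝ}
    (hφ : Measurable (Function.uncurry φ)) (hm : Measurable (Function.uncurry h)) (b : ℝ) :
    Measurable (fiberMean m h φ b) := by
  have h0 : Measurable fun z : (ℤ → Y) × X => (z.1 0, z.2) :=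
    ((measurable_pi_apply 0).comp measurable_fst).prodMk measurable_snd
  have h1 : Measurable fun z : (ℤ → Y) × X => φ (z.1 0) z.2 := hφ.comp h0
  have h2 : Measurable fun z : (ℤ → Y) × X => h z.1 z.2 := hm
  exact (measurable_clip b).comp (h1.mul h2).stronglyMeasurable.integral_prod_right'.measurable

/-- The level b is the uniform truncation level, while c may be the ω-dependent bound C₀‖φ_ω‖_BV,
which can still absorb a factor K(ω). -/
theorem fiberMean_eq {Y X : Type*} [MeasurableSpace X] {m : Measure X} {h : (ℤ → Y) → X → ℝ}
    {φ : Y → X → ℝ} {b : ℝ} {ω : ℤ → Y} (h0 : ∀ x, 0 ≤ h ω x) (h1 : ∫ x, h ω x ∂m = 1)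
    (hb : ∀ x, |φ (ω 0) x| ≤ b) {c : ℝ} (hc : ∀ x, |φ (ω 0) x| ≤ c) :
    fiberMean m h φ b ω = ∫ x, φ (ω 0) x * h ω x ∂m ∧
      |∫ x, φ (ω 0) x * h ω x ∂m| ≤ c := by
  have gen : ∀ c, (∀ x, |φ (ω 0) x| ≤ c) → |∫ x, φ (ω 0) x * h ω x ∂m| ≤ c := by
    intro c hc
    calc |∫ x, φ (ω 0) x * h ω x ∂m| ≤ ∫ x, |φ (ω 0) x * h ω x| ∂m :=
          abs_integral_le_integral_abs
      _ ≤ ∫ x, c * h ω x ∂m := by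
          refine integral_mono_of_nonneg (ae_of_all _ fun x => abs_nonneg _)
            ((integrable_of_integral_eq_one h1).const_mul c) (ae_of_all _ fun x => ?_)
          simp only [abs_mul, abs_of_nonneg (h0 x)]
          exact mul_le_mul_of_nonneg_right (hc x) (h0 x)
      _ = c := by rw [integral_const_mul, h1, mul_one]
  exact ⟨clip_of_abs_le (gen b hb), gen c hc⟩

/-! ### Quenched decay and approximation on the fibers -/

section

variable {Y X : Type*} [MeasurableSpace Y] [MeasurableSpace X] {P : Measure (ℤ → Y)}
  {m : Measure X} {T : Y → X → X}
  {v : (X → ℂ) → ℝ≥0∞} {h : (ℤ → Y) → X → ℝ} {K : (ℤ → Y) → ℝ} {lam eps : ℝ} {C₀ M : ℝ≥0}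
  {φ : Y → X → ℝ}

theorem ae_scaled_bvNorm_le (hM : scaledNorm P m v K φ ≤ (M : ℝ≥0∞)) :
    ∀ᵐ ω ∂P, ENNReal.ofReal (K ω) * bvNorm m v (fun x => (φ (ω 0) x : ℂ)) ≤ M := by
  filter_upwards [ENNReal.ae_le_essSup
    (fun ω => ENNReal.ofReal (K ω) * bvNorm m v (fun x => (φ (ω 0) x : ℂ)))] with ω hω
  exact hω.trans hM

/-- Pointwise bounds for the observable in terms of its BV norm. -/
theorem abs_le_of_scaled_bvNorm_le (hv : IsVariation m C₀ v)
    (hφ : Measurable (Function.uncurry φ)) {ω : ℤ → Y} (hK : 1 ≤ K ω)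
    (hω : ENNReal.ofReal (K ω) * bvNorm m v (fun x => (φ (ω 0) x : ℂ)) ≤ M) (x : X) :
    |φ (ω 0) x| ≤ C₀ * (bvNorm m v (fun x => (φ (ω 0) x : ℂ))).toReal ∧
      K ω * (bvNorm m v (fun x => (φ (ω 0) x : ℂ))).toReal ≤ M ∧ |φ (ω 0) x| ≤ C₀ * M := by
  set β := bvNorm m v (fun x => (φ (ω 0) x : ℂ)) with hβ
  have hφω : Measurable fun x => (φ (ω 0) x : ℂ) :=
    Complex.measurable_ofReal.comp (hφ.comp measurable_prodMk_left)
  have h1 : β ≤ ENNReal.ofReal (K ω) * β := by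
    calc β = 1 * β := (one_mul _).symm
      _ ≤ _ := by
          gcongr
          rw [← ENNReal.ofReal_one]
          exact ENNReal.ofReal_le_ofReal hK
  have hβt : β ≠ ∞ := ((h1.trans hω).trans_lt ENNReal.coe_lt_top).ne
  have h2 : K ω * β.toReal ≤ M := by
    have := ENNReal.toReal_mono ENNReal.coe_ne_top hω
    rwa [ENNReal.toReal_mul, ENNReal.toReal_ofReal (by linarith), ENNReal.coe_toReal] at this
  have h3 : |φ (ω 0) x| ≤ C₀ * β.toReal := by
    have := ENNReal.toReal_mono (ENNReal.mul_ne_top ENNReal.coe_ne_top hβt)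
      (enorm_le_bvNorm hv hφω x)
    rw [ENNReal.toReal_mul, ENNReal.coe_toReal, toReal_enorm, Complex.norm_real,
      Real.norm_eq_abs] at this
    exact this
  refine ⟨h3, h2, h3.trans (mul_le_mul_of_nonneg_left (le_trans ?_ h2) C₀.2)⟩
  exact le_mul_of_one_le_left ENNReal.toReal_nonneg hK

theorem ae_abs_le (hv : IsVariation m C₀ v) (hφ : Measurable (Function.uncurry φ))
    (hK : ∀ ω, 1 ≤ K ω) (hM : scaledNorm P m v K φ ≤ (M : ℝ≥0∞)) :
    ∀ᵐ ω ∂P, ∀ x, |φ (ω 0) x| ≤ C₀ * M := by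
  filter_upwards [ae_scaled_bvNorm_le hM] with ω hω x
  exact (abs_le_of_scaled_bvNorm_le hv hφ (hK ω) hω x).2.2

/-- Quenched decay: the images of the centered observable under the fiber maps are dominated by
the densities `h`, uniformly and exponentially. -/
theorem ae_abs_setIntegral_fiber_le [IsProbabilityMeasure m]
    (hA : StandingAssumption P m T v h K lam eps)
    (hv : IsVariation m C₀ v) (hP : ∀ k : ℤ, MeasurePreserving (shift k) P P)
    (hφ : Measurable (Function.uncurry φ)) (hM : scaledNorm P m v K φ ≤ (M : ℝ≥0∞)) :
    ∀ᵐ ω ∂P, ∀ n : ℕ, 1 ≤ n → ∀ B, MeasurableSet B →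
      |∫ x in fiberIter T ω n ⁻¹' B,
        (φ (ω 0) x - fiberMean m h φ (C₀ * M) ω) * h ω x ∂m| ≤
        C₀ * ((1 + C₀) * M + 1) * Real.exp (-lam * n) * ∫ x in B, h (shift n ω) x ∂m := by
  have hshift : ∀ {p : (ℤ → Y) → Prop}, (∀ᵐ ω ∂P, p ω) → ∀ᵐ ω ∂P, ∀ n : ℕ, p (shift n ω) :=
    fun hp => ae_all_iff.2 fun n => (hP n).quasiMeasurePreserving.ae hp
  filter_upwards [hshift hA.nonsingular, hshift hA.h_pos, hshift hA.h_mass, hA.decay_norm,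
    ae_scaled_bvNorm_le hM] with ω hns hpos hmass hdec hω n hn B hB
  have hKω := hA.one_le_K ω
  have hbd := abs_le_of_scaled_bvNorm_le hv hφ hKω hω
  have hmass0 : ∫ x, h ω x ∂m = 1 := by simpa [shift_zero] using hmass 0
  have hhi := integrable_of_integral_eq_one hmass0
  set β := bvNorm m v (fun x => (φ (ω 0) x : ℂ)) with hβ
  obtain ⟨hψ, hψβ⟩ := fiberMean_eq (m := m) (hA.h_nonneg ω) hmass0 (fun x => (hbd x).2.2)
    (fun x => (hbd x).1)
  set ψ := fiberMean m h φ (C₀ * M) ω with hψdef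
  rw [← hψ] at hψβ
  have hφω : Measurable fun x => φ (ω 0) x := hφ.comp measurable_prodMk_left
  have hφωc : Measurable fun x => (φ (ω 0) x : ℂ) := Complex.measurable_ofReal.comp hφω
  set g : X → ℂ := fun x => (φ (ω 0) x : ℂ) - (ψ : ℂ) with hg
  have hgm : Measurable g := hφωc.sub_const _
  have hgh : Integrable (fun x => (φ (ω 0) x - ψ) * h ω x) m := by
    refine hhi.bdd_mul (c := C₀ * M + |ψ|) (hφω.sub_const _).aestronglyMeasurable
      (ae_of_all _ fun x => ?_)
    exact (abs_sub _ _).trans (add_le_add_left (hbd x).2.2 _)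
  have hcast : ∀ x, g x * (h ω x : ℂ) = (((φ (ω 0) x - ψ) * h ω x : ℝ) : ℂ) := fun x => by
    simp [hg]
  have hmean : ∫ x, g x * (h ω x : ℂ) ∂m = 0 := by
    simp_rw [hcast]
    rw [integral_complex_ofReal]
    have h1 : Integrable (fun x => φ (ω 0) x * h ω x) m :=
      hhi.bdd_mul hφω.aestronglyMeasurable (ae_of_all _ fun x => (hbd x).2.2)
    simp only [sub_mul]
    rw [integral_sub h1 (hhi.const_mul _), integral_const_mul, hmass0, ← hψ]
    simp
  -- Here the factor K(ω) of the decay is absorbed by the scaled norm: K‖φ_ω‖_BV ≤ M and K|ψ| ≤ C₀M.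
  have hgbv : ENNReal.ofReal (K ω) * bvNorm m v g ≤ ENNReal.ofReal ((1 + C₀) * M) := by
    have hMof : (M : ℝ≥0∞) = ENNReal.ofReal M := (ENNReal.ofReal_coe_nnreal).symm
    have hψe : ‖(ψ : ℂ)‖ₑ = ENNReal.ofReal |ψ| := by
      rw [← ofReal_norm, Complex.norm_real, Real.norm_eq_abs]
    calc ENNReal.ofReal (K ω) * bvNorm m v g
        ≤ ENNReal.ofReal (K ω) * (β + ‖(ψ : ℂ)‖ₑ) := by
          gcongr; exact bvNorm_sub_const_le hv hφωc _
      _ = ENNReal.ofReal (K ω) * β + ENNReal.ofReal (K ω * |ψ|) := by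
          rw [mul_add, hψe, ENNReal.ofReal_mul (by linarith)]
      _ ≤ ENNReal.ofReal M + ENNReal.ofReal (C₀ * M) := by
          refine add_le_add (hMof ▸ hω) (ENNReal.ofReal_le_ofReal ?_)
          · have : Nonempty X := m.nonempty_of_neZero
            have h2 := (hbd this.some).2.1
            calc K ω * |ψ| ≤ K ω * (C₀ * β.toReal) := by gcongr
              _ = C₀ * (K ω * β.toReal) := by ring
              _ ≤ _ := mul_le_mul_of_nonneg_left h2 C₀.2
      _ = _ := by rw [← ENNReal.ofReal_add (by positivity) (by positivity)]; congr 1; ring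
  -- The summand 1 makes the bound on the essential BV norm strict, also when M = 0.
  set c := ((1 + C₀) * M + 1) * Real.exp (-lam * n) with hc
  have hLn : ∀ᵐ x ∂m, ‖normTransferIter m T h ω n g x‖ ≤ C₀ * c := by
    have h1 := hdec n hn g hgm
    rw [hmean] at h1
    simp only [sub_zero] at h1
    have h2 : bvNormAE m v (fun x => normTransferIter m T h ω n g x) < ENNReal.ofReal c := by
      refine h1.trans_lt ?_
      calc _ ≤ ENNReal.ofReal ((1 + C₀) * M) * ENNReal.ofReal (Real.exp (-lam * n)) := by gcongr
        _ = ENNReal.ofReal ((1 + C₀) * M * Real.exp (-lam * n)) := by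
            rw [← ENNReal.ofReal_mul (by positivity)]
        _ < ENNReal.ofReal c := by
            rw [ENNReal.ofReal_lt_ofReal_iff (by positivity), hc]
            exact mul_lt_mul_of_pos_right (lt_add_one _) (Real.exp_pos _)
    filter_upwards [ae_enorm_le_of_bvNormAE_lt hv h2] with x hx
    have := ENNReal.toReal_mono (by finiteness) hx
    rwa [toReal_enorm, ENNReal.toReal_mul, ENNReal.coe_toReal,
      ENNReal.toReal_ofReal (by positivity)] at this
  -- Multiplying by h_{σ^n ω} > 0 undoes the normalization, so U evolves under the plain transfer
  -- operators and iterated duality applies.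
  set U : ℕ → X → ℂ := fun n x => normTransferIter m T h ω n g x * (h (shift n ω) x : ℂ) with hU
  have hU0 : ∀ x, U 0 x = (((φ (ω 0) x - ψ) * h ω x : ℝ) : ℂ) := fun x => by
    simp only [hU, normTransferIter, Nat.cast_zero, shift_zero, hcast]
  have hUs : ∀ n : ℕ, U (n + 1) =ᵐ[m] transfer m (T (ω n)) (U n) := fun n => by
    filter_upwards [hpos (n + 1)] with x hx
    have e1 : shift (1 : ℤ) (shift (n : ℤ) ω) = shift ((n + 1 : ℕ) : ℤ) ω := by
      rw [shift_shift]; push_cast; rw [add_comm]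
    have e2 : (shift (n : ℤ) ω) 0 = ω n := by simp [shift]
    simp only [hU, normTransferIter, normTransfer, e1, e2]
    exact div_mul_cancel₀ _ (Complex.ofReal_ne_zero.2 hx.ne')
  have hq : ∀ n : ℕ, Measure.QuasiMeasurePreserving (T (ω n)) m m := fun n => by
    have := hns n
    simpa [shift] using this
  have hU0i : Integrable (U 0) m := by
    rw [show U 0 = fun x => (((φ (ω 0) x - ψ) * h ω x : ℝ) : ℂ) from funext hU0]
    exact hgh.ofReal
  obtain ⟨hUi, hUset⟩ := setIntegral_transfer_iterate hq hU0i hUs n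
  have e := hUset B hB
  simp_rw [hU0] at e
  rw [integral_complex_ofReal] at e
  have hn' : ‖∫ x in B, U n x ∂m‖ = |∫ x in fiberIter T ω n ⁻¹' B,
      (φ (ω 0) x - ψ) * h ω x ∂m| := by
    rw [e, Complex.norm_real, Real.norm_eq_abs]
  rw [← hn', mul_assoc, mul_assoc, ← mul_assoc _ (Real.exp _), ← hc, ← mul_assoc,
    ← integral_const_mul]
  have hhn := integrable_of_integral_eq_one (hmass n)
  refine norm_integral_le_of_norm_le (hhn.integrableOn.const_mul _) (ae_restrict_of_ae ?_)
  filter_upwards [hLn] with x hx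
  simp only [hU, norm_mul, Complex.norm_real, Real.norm_eq_abs,
    abs_of_nonneg (hA.h_nonneg (shift n ω) x)]
  exact mul_le_mul_of_nonneg_right hx (hA.h_nonneg _ _)

/-- The fiber means are exponentially well approximated by functions of finitely many past
coordinates. -/
theorem ae_abs_integral_fiberIter_sub_fiberMean_le [IsProbabilityMeasure m]
    (hA : StandingAssumption P m T v h K lam eps)
    (hv : IsVariation m C₀ v) (hP : ∀ k : ℤ, MeasurePreserving (shift k) P P)
    (hφ : Measurable (Function.uncurry φ)) (hM : scaledNorm P m v K φ ≤ (M : ℝ≥0∞)) :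
    ∀ᵐ ω ∂P, ∀ r : ℕ, 1 ≤ r →
      |fiberMean m h φ (C₀ * M) ω - ∫ x, φ (ω 0) (fiberIter T (shift (-r) ω) r x) ∂m| ≤
        2 * (C₀ * M) * Real.exp (-(2 * lam / 3) * r) := by
  have hns : ∀ᵐ ω ∂P, ∀ k : ℤ, Measure.QuasiMeasurePreserving (T (shift k ω 0)) m m :=
    ae_all_iff.2 fun k => (hP k).quasiMeasurePreserving.ae hA.nonsingular
  have hdec : ∀ᵐ ω ∂P, ∀ r : ℕ, ∀ n : ℕ, 1 ≤ n →
    bvNormAE m v (fun x => transferIter m T (shift (-r) ω) n (fun _ => 1) x -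
        (h (shift n (shift (-r) ω)) x : ℂ)) ≤
      ENNReal.ofReal (K (shift (-r) ω) * Real.exp (-lam * n)) :=
    ae_all_iff.2 fun r => (hP (-r)).quasiMeasurePreserving.ae hA.decay_density
  filter_upwards [hns, hA.h_mass, hdec, hA.slow, ae_scaled_bvNorm_le hM] with
    ω hns hmass hdec hslow hω r hr
  have hKω := hA.one_le_K ω
  have hbd := abs_le_of_scaled_bvNorm_le hv hφ hKω hω
  have hhi := integrable_of_integral_eq_one hmass
  set β := (bvNorm m v (fun x => (φ (ω 0) x : ℂ))).toReal with hβ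
  have hβ0 : 0 ≤ β := ENNReal.toReal_nonneg
  have hφω : Measurable fun x => φ (ω 0) x := hφ.comp measurable_prodMk_left
  rw [(fiberMean_eq (m := m) (hA.h_nonneg ω) hmass (fun x => (hbd x).2.2)
    (fun x => (hbd x).1)).1]
  -- Iterating from r steps in the past ends over ω itself: 𝓛^r 1 started at ω' approximates h_ω and
  -- depends on the coordinates -r, ..., -1 of ω only.
  set ω' := shift (-r) ω with hω'
  have hback : shift (r : ℤ) ω' = ω := by rw [hω', shift_shift, add_neg_cancel, shift_zero]
  set U : ℕ → X → ℂ := fun n => transferIter m T ω' n (fun _ => 1) with hU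
  have hUs : ∀ n : ℕ, U (n + 1) =ᵐ[m] transfer m (T (ω' n)) (U n) := fun n => by
    have e2 : (shift (n : ℤ) ω') 0 = ω' n := by simp [shift]
    simp only [hU, transferIter, e2]
    exact EventuallyEq.rfl
  have hq : ∀ n : ℕ, Measure.QuasiMeasurePreserving (T (ω' n)) m m := fun n => by
    have := hns (-r + n)
    have e : shift (-r + n : ℤ) ω 0 = ω' n := by simp [hω', shift, add_comm]
    rwa [e] at this
  have hU0i : Integrable (U 0) m := integrable_const _
  obtain ⟨hUi, hUset⟩ := setIntegral_transfer_iterate hq hU0i hUs r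
  have hfm : Measurable (fiberIter T ω' r) :=
    (measurable_fiberIter (α := Unit) (u := fun _ => ω')
      (measurable_uncurry_of_skewProduct hA.measurable_skew)
      fun _ _ => measurable_const).comp (measurable_const (a := ()).prodMk measurable_id)
  have hUre : Integrable (fun x => (U r x).re) m := hUi.re
  have hset : ∀ B, MeasurableSet B →
      ∫ x in B, (U r x).re ∂m = ∫ x in fiberIter T ω' r ⁻¹' B, (1 : ℝ) ∂m := by
    intro B hB
    have e := integral_re (𝕜 := ℂ) (hUi.integrableOn (s := B))
    simp only [RCLike.re_eq_complex_re] at e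
    rw [e, hUset B hB]
    simp [hU, transferIter]
  have hdual := integral_mul_eq_integral_mul_comp hfm (integrable_const (1 : ℝ)) hUre hset hφω
    (fun x => (hbd x).2.2)
  simp only [one_mul] at hdual
  rw [← hdual, ← integral_sub
    (hhi.bdd_mul hφω.aestronglyMeasurable (ae_of_all _ fun x => (hbd x).2.2))
    (hUre.mul_bdd hφω.aestronglyMeasurable (ae_of_all _ fun x => (hbd x).2.2))]
  set E := Real.exp (-lam * r) with hE
  have hE0 : 0 < E := Real.exp_pos _
  have hKω' := hA.one_le_K ω'
  have hL1 : ∫ x, ‖U r x - (h ω x : ℂ)‖ ∂m ≤ K ω' * E + E := by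
    have h1 := hdec r r hr
    rw [hback] at h1
    have h2 : bvNormAE m v (fun x => U r x - (h ω x : ℂ)) < ENNReal.ofReal (K ω' * E + E) :=
      h1.trans_lt ((ENNReal.ofReal_lt_ofReal_iff (by positivity)).2 (by linarith))
    have h3 := lintegral_enorm_le_of_bvNormAE_lt h2
    have h4 : Integrable (fun x => U r x - (h ω x : ℂ)) m := hUi.sub hhi.ofReal
    rw [integral_norm_eq_lintegral_enorm h4.aestronglyMeasurable]
    exact ENNReal.toReal_le_of_le_ofReal (by positivity) h3
  have hint : Integrable (fun x => ‖U r x - (h ω x : ℂ)‖) m := (hUi.sub hhi.ofReal).norm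
  calc _ ≤ ∫ x, |φ (ω 0) x * h ω x - (U r x).re * φ (ω 0) x| ∂m := abs_integral_le_integral_abs
    _ ≤ ∫ x, C₀ * β * ‖U r x - (h ω x : ℂ)‖ ∂m := by
        refine integral_mono_of_nonneg (ae_of_all _ fun x => abs_nonneg _)
          (hint.const_mul _) (ae_of_all _ fun x => ?_)
        have e : φ (ω 0) x * h ω x - (U r x).re * φ (ω 0) x =
          -(φ (ω 0) x * (U r x - (h ω x : ℂ)).re) := by simp; ring
        simp only [e, abs_neg, abs_mul]
        exact mul_le_mul (hbd x).1 (Complex.abs_re_le_norm _) (abs_nonneg _) (by positivity)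
    _ ≤ C₀ * β * (K ω' * E + E) := by
        rw [integral_const_mul]
        exact mul_le_mul_of_nonneg_left hL1 (by positivity)
    -- Slow variation turns K(σ^{-r} ω) into K(ω) e^{εr}, and ε < λ/3 leaves the rate 2λ/3. The
    -- factor 2 covers the extra E that made the norm bound strict.
    _ ≤ C₀ * β * (2 * (K ω * Real.exp (-(2 * lam / 3) * r))) := by
        have hr0 : (0 : ℝ) ≤ r := Nat.cast_nonneg _
        have h1 : K ω' ≤ K ω * Real.exp (eps * r) := by
          have := (hslow (-r)).2
          simpa using this
        have h2 : Real.exp (eps * r) * E ≤ Real.exp (-(2 * lam / 3) * r) := by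
          rw [hE, ← Real.exp_add]
          refine Real.exp_le_exp.2 ?_
          have := hA.eps_lt
          nlinarith
        have h3 : E ≤ Real.exp (-(2 * lam / 3) * r) := by
          refine le_trans ?_ h2
          exact le_mul_of_one_le_left hE0.le (Real.one_le_exp
            (mul_nonneg hA.eps_pos.le hr0))
        refine mul_le_mul_of_nonneg_left ?_ (by positivity)
        have h4 : K ω' * E ≤ K ω * Real.exp (-(2 * lam / 3) * r) := by
          calc K ω' * E ≤ K ω * Real.exp (eps * r) * E := by gcongr
            _ = K ω * (Real.exp (eps * r) * E) := by ring
            _ ≤ _ := by gcongr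
        have h5 : E ≤ K ω * Real.exp (-(2 * lam / 3) * r) :=
          h3.trans (le_mul_of_one_le_left (Real.exp_pos _).le hKω)
        linarith
    _ = 2 * (C₀ * (K ω * β)) * Real.exp (-(2 * lam / 3) * r) := by ring
    _ ≤ _ := by
        have : Nonempty X := m.nonempty_of_neZero
        have h2 := (hbd this.some).2.1
        gcongr

end

/-! ### Annealed decay of the centered observable -/

theorem measurable_observable {Y X : Type*} [MeasurableSpace Y] [MeasurableSpace X]
    {φ : Y → X → ℝ} (hφ : Measurable (Function.uncurry φ)) :
    Measurable fun z : (ℤ → Y) × X => φ (z.1 0) z.2 := by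
  have h0 : Measurable fun z : (ℤ → Y) × X => (z.1 0, z.2) :=
    ((measurable_pi_apply 0).comp measurable_fst).prodMk measurable_snd
  exact hφ.comp h0

/-- The truncated observable minus its fiber means. -/
noncomputable def centered {Y X : Type*} [MeasurableSpace X] (m : Measure X)
    (h : (ℤ → Y) → X → ℝ) (φ : Y → X → ℝ) (b : ℝ) (z : (ℤ → Y) × X) : ℝ :=
  clip b (φ (z.1 0) z.2) - fiberMean m h φ b z.1

theorem measurable_centered {Y X : Type*} [MeasurableSpace Y] [MeasurableSpace X]
    {m : Measure X} [SFinite m] {h : (ℤ → Y) → X → ℝ} {φ : Y → X → ℝ}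
    (hφ : Measurable (Function.uncurry φ)) (hm : Measurable (Function.uncurry h)) (b : ℝ) :
    Measurable (centered m h φ b) :=
  ((measurable_clip b).comp (measurable_observable hφ)).sub
    ((measurable_fiberMean hφ hm b).comp measurable_fst)

theorem abs_centered_le {Y X : Type*} [MeasurableSpace X] (m : Measure X)
    (h : (ℤ → Y) → X → ℝ) (φ : Y → X → ℝ) {b : ℝ} (hb : 0 ≤ b) (z : (ℤ → Y) × X) :
    |centered m h φ b z| ≤ 2 * b := by
  have h1 := abs_clip_le hb (φ (z.1 0) z.2)
  have h2 := abs_clip_le hb (∫ x, φ (z.1 0) x * h z.1 x ∂m)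
  exact (abs_sub _ _).trans (by unfold fiberMean; linarith)

section

variable {Y X : Type*} [MeasurableSpace Y] [MeasurableSpace X] {P : Measure (ℤ → Y)}
  [IsProbabilityMeasure P] {m : Measure X} [IsProbabilityMeasure m] {T : Y → X → X}
  {v : (X → ℂ) → ℝ≥0∞} {h : (ℤ → Y) → X → ℝ} {K : (ℤ → Y) → ℝ} {lam eps : ℝ} {C₀ M : ℝ≥0}
  {φ : Y → X → ℝ}

/-- Annealed decay for the centered observable. -/
theorem abs_setIntegral_iterate_le (hA : StandingAssumption P m T v h K lam eps)
    (hv : IsVariation m C₀ v) (hP : ∀ k : ℤ, MeasurePreserving (shift k) P P)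
    (hφ : Measurable (Function.uncurry φ)) (hM : scaledNorm P m v K φ ≤ (M : ℝ≥0∞))
    {n : ℕ} (hn : 1 ≤ n) {A : Set ((ℤ → Y) × X)} (hAm : MeasurableSet A) :
    |∫ z in (skewProduct T)^[n] ⁻¹' A, centered m h φ (C₀ * M) z ∂(skewMeasure P m h)| ≤
      C₀ * ((1 + C₀) * M + 1) * Real.exp (-lam * n) * (skewMeasure P m h).real A := by
  have hb : (0 : ℝ) ≤ C₀ * M := by positivity
  have hf := measurable_centered (m := m) hφ hA.measurable_h (C₀ * M : ℝ)
  set S := (skewProduct T)^[n] ⁻¹' A with hS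
  have hSm : MeasurableSet S := (hA.measurable_skew.iterate n) hAm
  set D := C₀ * ((1 + C₀) * M + 1) * Real.exp (-lam * n) with hD
  have hI1 := integral_skewMeasure hA.measurable_h hA.h_nonneg hA.prob (hf.indicator hSm)
    (C := 2 * (C₀ * M)) fun z => by
      by_cases hz : z ∈ S
      · rw [Set.indicator_of_mem hz]; exact abs_centered_le m h φ hb z
      · rw [Set.indicator_of_notMem hz, abs_zero]; positivity
  have hI2 := integral_skewMeasure hA.measurable_h hA.h_nonneg hA.prob
    (f := A.indicator fun _ => 1) (measurable_const.indicator hAm) (C := 1) fun z => by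
      by_cases hz : z ∈ A <;> simp [hz]
  rw [← integral_indicator hSm, hI1.2]
  set F : (ℤ → Y) → ℝ := fun ω => ∫ x, A.indicator (fun _ => (1 : ℝ)) (ω, x) * h ω x ∂m with hF
  have hFm : Measurable F := by
    have h1 : Measurable fun z : (ℤ → Y) × X => A.indicator (fun _ => (1 : ℝ)) z :=
      measurable_const.indicator hAm
    have h2 : Measurable fun z : (ℤ → Y) × X => h z.1 z.2 := hA.measurable_h
    exact (h1.mul h2).stronglyMeasurable.integral_prod_right'.measurable
  have hFi : Integrable (fun ω => D * F (shift n ω)) P :=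
    ((hP n).integrable_comp_of_integrable hI2.1).const_mul D
  -- Fiberwise, the preimage of A under τ^n is the preimage of the section of A over σ^n ω. Shift
  -- invariance of P then recombines the fiber bounds into μ(A).
  have hbound : ∀ᵐ ω ∂P,
      ‖∫ x, S.indicator (centered m h φ (C₀ * M)) (ω, x) * h ω x ∂m‖ ≤ D * F (shift n ω) := by
    filter_upwards [ae_abs_setIntegral_fiber_le hA hv hP hφ hM,
      ae_abs_le hv hφ hA.one_le_K hM] with ω hω hφω
    have hB : MeasurableSet (Prod.mk (shift (n : ℤ) ω) ⁻¹' A) := measurable_prodMk_left hAm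
    have hfm : Measurable (fiberIter T ω n) :=
      (measurable_fiberIter (α := Unit) (u := fun _ => ω)
        (measurable_uncurry_of_skewProduct hA.measurable_skew)
        fun _ _ => measurable_const).comp (measurable_const (a := ()).prodMk measurable_id)
    have := hω n hn _ hB
    rw [← integral_indicator (hfm hB), ← integral_indicator hB] at this
    have e1 : ∀ x, S.indicator (centered m h φ (C₀ * M)) (ω, x) * h ω x =
        (fiberIter T ω n ⁻¹' (Prod.mk (shift (n : ℤ) ω) ⁻¹' A)).indicator
          (fun x => (φ (ω 0) x - fiberMean m h φ (C₀ * M) ω) * h ω x) x := by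
      intro x
      have hmem : (ω, x) ∈ S ↔ x ∈ fiberIter T ω n ⁻¹' (Prod.mk (shift (n : ℤ) ω) ⁻¹' A) := by
        rw [hS, Set.mem_preimage, iterate_skewProduct]; rfl
      by_cases hx : (ω, x) ∈ S
      · rw [Set.indicator_of_mem hx, Set.indicator_of_mem (hmem.1 hx), centered,
          clip_of_abs_le (hφω x)]
      · rw [Set.indicator_of_notMem hx, Set.indicator_of_notMem (fun h => hx (hmem.2 h)), zero_mul]
    have e2 : F (shift n ω) = ∫ x, (Prod.mk (shift (n : ℤ) ω) ⁻¹' A).indicator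
        (fun x => h (shift n ω) x) x ∂m := by
      refine integral_congr_ae (ae_of_all _ fun x => ?_)
      by_cases hx : (shift (n : ℤ) ω, x) ∈ A
      · simp only [Set.indicator_of_mem hx, one_mul]
        rw [Set.indicator_of_mem (by exact hx)]
      · simp only [Set.indicator_of_notMem hx, zero_mul]
        rw [Set.indicator_of_notMem (by exact hx)]
    simp_rw [e1]
    rw [e2]
    exact this
  refine (norm_integral_le_of_norm_le hFi hbound).trans_eq ?_
  rw [integral_const_mul, integral_comp_of_measurePreserving (hP n) hFm, ← hI2.2,
    integral_indicator_const _ hAm]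
  simp

theorem integral_fiberMean_eq_zero (hA : StandingAssumption P m T v h K lam eps)
    (hv : IsVariation m C₀ v) (hφ : Measurable (Function.uncurry φ))
    (hM : scaledNorm P m v K φ ≤ (M : ℝ≥0∞))
    (h0 : ∫ z, φ (z.1 0) z.2 ∂(skewMeasure P m h) = 0) :
    ∫ z, clip (C₀ * M) (φ (z.1 0) z.2) ∂(skewMeasure P m h) = 0 ∧
      ∫ ω, fiberMean m h φ (C₀ * M) ω ∂P = 0 := by
  have hb : (0 : ℝ) ≤ C₀ * M := by positivity
  have hfst := measurePreserving_fst_skewMeasure hA.measurable_h hA.h_nonneg hA.prob hA.h_mass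
  have hφb := ae_abs_le hv hφ hA.one_le_K hM
  have e1 : ∫ z, clip (C₀ * M) (φ (z.1 0) z.2) ∂(skewMeasure P m h) = 0 := by
    rw [← h0]
    refine integral_congr_ae ?_
    filter_upwards [hfst.quasiMeasurePreserving.ae hφb] with z hz
    exact clip_of_abs_le (hz z.2)
  refine ⟨e1, ?_⟩
  have hcm : Measurable fun z : (ℤ → Y) × X => clip (C₀ * M) (φ (z.1 0) z.2) :=
    (measurable_clip _).comp (measurable_observable hφ)
  rw [(integral_skewMeasure hA.measurable_h hA.h_nonneg hA.prob hcm
    (fun z => abs_clip_le hb _)).2] at e1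
  rw [← e1]
  refine integral_congr_ae ?_
  filter_upwards [hφb, hA.h_mass] with ω hω h1
  rw [(fiberMean_eq (m := m) (hA.h_nonneg ω) h1 hω hω).1]
  refine integral_congr_ae (ae_of_all _ fun x => ?_)
  simp only
  rw [clip_of_abs_le (hω x)]

end

/-! ### The fiber means as a mixing sequence -/

theorem measurable_integral_fiberIter {α Y X : Type*} [MeasurableSpace α] [MeasurableSpace Y]
    [MeasurableSpace X] {m : Measure X} [SFinite m] {T : Y → X → X}
    (hT : Measurable (Function.uncurry T)) {φ : Y → X → ℝ} (hφ : Measurable (Function.uncurry φ))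
    (b : ℝ) {y : α → Y} (hy : Measurable y) {u : α → ℤ → Y} {n : ℕ}
    (hu : ∀ i : ℕ, i < n → Measurable fun a => u a i) :
    Measurable fun a => ∫ x, clip b (φ (y a) (fiberIter T (u a) n x)) ∂m := by
  have h1 : Measurable fun p : α × X => (y p.1, fiberIter T (u p.1) n p.2) :=
    (hy.comp measurable_fst).prodMk (measurable_fiberIter hT hu)
  have h2 : Measurable fun p : α × X => clip b (φ (y p.1) (fiberIter T (u p.1) n p.2)) :=
    (measurable_clip b).comp (hφ.comp h1)
  exact h2.stronglyMeasurable.integral_prod_right'.measurable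

/-- The fiber means along the orbit of the shift are well approximated by functions of finite
windows of the driving process. -/
theorem mixingApprox_fiberMean {Ω Y X : Type*} [MeasurableSpace Ω] [MeasurableSpace Y]
    [MeasurableSpace X] {Q : Measure Ω} [IsProbabilityMeasure Q] {m : Measure X}
    [IsProbabilityMeasure m] {ξ : ℤ → Ω → Y} {T : Y → X → X} {v : (X → ℂ) → ℝ≥0∞}
    {h : (ℤ → Y) → X → ℝ} {K : (ℤ → Y) → ℝ} {lam eps : ℝ} {C₀ M : ℝ≥0} {φ : Y → X → ℝ}
    (hξ : ∀ j, Measurable (ξ j)) (hs : IsStationary Q ξ)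
    (hA : StandingAssumption (pathLaw Q ξ) m T v h K lam eps)
    (hv : IsVariation m C₀ v) (hφ : Measurable (Function.uncurry φ))
    (hM : scaledNorm (pathLaw Q ξ) m v K φ ≤ (M : ℝ≥0∞))
    (h0 : ∫ z, φ (z.1 0) z.2 ∂(skewMeasure (pathLaw Q ξ) m h) = 0) :
    MixingApprox Q ξ (2 * (C₀ * M) + 1) (2 * lam / 3)
      (fun j w => fiberMean m h φ (C₀ * M) (shift j fun i => ξ i w))
      (fun r j w => ∫ x, clip (C₀ * M)
        (φ (ξ j w) (fiberIter T (shift ((j : ℤ) - r) fun i => ξ i w) r x)) ∂m) := by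
  have hb : (0 : ℝ) ≤ C₀ * M := by positivity
  have hT := measurable_uncurry_of_skewProduct hA.measurable_skew
  have := isProbabilityMeasure_pathLaw (Q := Q) hξ
  have hP := measurePreserving_shift (Q := Q) hξ hs
  have hπ : MeasurePreserving (fun w => fun j : ℤ => ξ j w) Q (pathLaw Q ξ) :=
    ⟨measurable_pi_lambda _ hξ, rfl⟩
  have hpast : ∀ {i j : ℤ}, i ≤ j → Measurable[pastSigma ξ j] (ξ i) := fun {i j} hij =>
    (comap_measurable (ξ i)).mono (le_iSup₂_of_le i hij le_rfl) le_rfl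
  have hfut : ∀ {i j : ℤ}, j ≤ i → Measurable[futureSigma ξ j] (ξ i) := fun {i j} hij =>
    (comap_measurable (ξ i)).mono (le_iSup₂_of_le i hij le_rfl) le_rfl
  have hψm := measurable_fiberMean (m := m) hφ hA.measurable_h (C₀ * M : ℝ)
  -- The bound 2C₀M + 1 is shared by all conditions: the 2 is the constant of the approximation, and
  -- the 1 ensures B ≥ 1.
  refine ⟨fun j => hψm.comp ((measurable_shift _).comp hπ.measurable), fun j w => ?_,
    fun j => ?_, fun r j => ?_, fun r j => ?_, fun r j w => ?_, fun r hr j => ?_⟩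
  · exact (abs_clip_le hb _).trans (by linarith)
  · exact (integral_comp_of_measurePreserving ((hP j).comp hπ) hψm).trans
      (integral_fiberMean_eq_zero hA hv hφ hM h0).2
  · refine @measurable_integral_fiberIter Ω Y X (pastSigma ξ j) _ _ m _ T hT φ hφ _ _
      (hpast le_rfl) _ r fun i hi => ?_
    exact hpast (by omega)
  · refine @measurable_integral_fiberIter Ω Y X (futureSigma ξ ((j : ℤ) - r)) _ _ m _ T hT φ hφ _ _
      (hfut (by omega)) _ r fun i hi => ?_
    exact hfut (by omega)
  · refine (abs_integral_le_of_ae_abs_le (ae_of_all _ fun x => abs_clip_le hb _)).trans ?_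
    linarith
  · have hae := ((hP j).comp hπ).quasiMeasurePreserving.ae
      ((ae_abs_integral_fiberIter_sub_fiberMean_le hA hv hP hφ hM).and
        (ae_abs_le hv hφ hA.one_le_K hM))
    filter_upwards [hae] with w hw
    obtain ⟨h1, h2⟩ := hw
    have h3 := h1 r hr
    simp only [Function.comp_apply, shift_shift] at h2 h3
    have e1 : shift (j : ℤ) (fun i => ξ i w) 0 = ξ j w := by simp [shift]
    rw [e1] at h3 h2
    rw [show -(r : ℤ) + j = j - r by ring] at h3
    have e2 : ∀ x, clip (C₀ * M) (φ (ξ j w)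
        (fiberIter T (shift ((j : ℤ) - r) fun i => ξ i w) r x)) =
        φ (ξ j w) (fiberIter T (shift ((j : ℤ) - r) fun i => ξ i w) r x) :=
      fun x => clip_of_abs_le (h2 _)
    simp_rw [e2]
    refine h3.trans (mul_le_mul_of_nonneg_right (by linarith) (Real.exp_pos _).le)

/-! ### From moments to tails, and the choice of constants -/

/-- Cantelli's inequality. -/
theorem measureReal_ge_le_cantelli {α : Type*} [MeasurableSpace α] {μ : Measure α}
    [IsProbabilityMeasure μ] {S : α → ℝ} (hS : Measurable S) {b : ℝ} (hb : ∀ z, |S z| ≤ b)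
    (h0 : ∫ z, S z ∂μ = 0) {W : ℝ} (hW : ∫ z, S z ^ 2 ∂μ ≤ W) {t : ℝ} (ht : 0 < t) :
    μ.real {z | t ≤ S z} ≤ W / (W + t ^ 2) := by
  have hW0 : 0 ≤ W := le_trans (integral_nonneg fun z => sq_nonneg _) hW
  -- This shift minimizes the Chebyshev bound (W + l²)/(t + l)².
  set l := W / t with hl
  have hl0 : 0 ≤ l := div_nonneg hW0 ht.le
  have hSi : Integrable S μ := integrable_of_abs_le hS hb
  have hS2 : Integrable (fun z => S z ^ 2) μ := by
    simpa only [sq] using integrable_mul_of_abs_le (μ := μ) hS hS hb hb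
  have h12 : Integrable (fun z => S z ^ 2 + 2 * l * S z) μ := hS2.add (hSi.const_mul _)
  have e : ∀ z, (S z + l) ^ 2 = (S z ^ 2 + 2 * l * S z) + l ^ 2 := fun z => by ring
  have hint : Integrable (fun z => (S z + l) ^ 2) μ := by
    simp_rw [e]; exact h12.add (integrable_const _)
  have hval : ∫ z, (S z + l) ^ 2 ∂μ ≤ W + l ^ 2 := by
    simp_rw [e]
    rw [integral_add h12 (integrable_const _), integral_add hS2 (hSi.const_mul _),
      integral_const_mul, h0]
    simpa using hW
  have hmk := mul_meas_ge_le_integral_of_nonneg (μ := μ) (ae_of_all _ fun z => sq_nonneg (S z + l))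
    hint ((t + l) ^ 2)
  have hsub : {z | t ≤ S z} ⊆ {z | (t + l) ^ 2 ≤ (S z + l) ^ 2} := fun z hz =>
    pow_le_pow_left₀ (by positivity) (add_le_add_left (show t ≤ S z from hz) l) 2
  have h1 : (t + l) ^ 2 * μ.real {z | t ≤ S z} ≤ W + l ^ 2 :=
    (mul_le_mul_of_nonneg_left (measureReal_mono hsub) (sq_nonneg _)).trans (hmk.trans hval)
  have h2 : (t + l) ^ 2 = (W + t ^ 2) ^ 2 / t ^ 2 := by rw [hl]; field_simp; ring
  have h3 : W + l ^ 2 = W * (W + t ^ 2) / t ^ 2 := by rw [hl]; field_simp; ring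
  rw [h2, h3, div_mul_eq_mul_div, div_le_div_iff_of_pos_right (by positivity)] at h1
  rw [le_div_iff₀ (by positivity)]
  have h4 : 0 < W + t ^ 2 := by positivity
  nlinarith

/-- Variance and tail bounds from a Gaussian type bound for the exponential moments. -/
theorem sq_and_tail_of_integral_exp_le {α : Type*} [MeasurableSpace α] {μ : Measure α}
    [IsProbabilityMeasure μ] {S : α → ℝ} (hS : Measurable S) {b : ℝ} (hb : ∀ z, |S z| ≤ b)
    {a d : ℝ} (ha : 0 < a) (hd : 0 ≤ d) {n : ℕ} (hn : 1 ≤ n)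
    (h : ∀ s, ∫ z, Real.exp (s * S z) ∂μ ≤ Real.exp (a * s ^ 2 * n + d * |s|)) :
    ∫ z, S z ^ 2 ∂μ ≤ 4 * Real.exp (a + d) * n ∧
      ∀ t, 0 ≤ t → μ.real {z | t ≤ S z} ≤
        Real.exp (d ^ 2 / (2 * a)) * Real.exp (-(1 / (8 * a)) * (t ^ 2 / n)) := by
  have hn1 : (1 : ℝ) ≤ n := by exact_mod_cast hn
  have hn0 : (0 : ℝ) < n := by linarith
  have hei : ∀ s, Integrable (fun z => Real.exp (s * S z)) μ := fun s => by
    refine integrable_of_abs_le (C := Real.exp (|s| * b)) (hS.const_mul s).exp fun z => ?_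
    rw [abs_of_pos (Real.exp_pos _)]
    refine Real.exp_le_exp.2 ((le_abs_self _).trans ?_)
    rw [abs_mul]
    exact mul_le_mul_of_nonneg_left (hb z) (abs_nonneg _)
  have hsqrt : 1 ≤ √(n : ℝ) := Real.one_le_sqrt.2 hn1
  have hsq : √(n : ℝ) ^ 2 = n := Real.sq_sqrt hn0.le
  constructor
  -- At this scale the exponential moments are bounded by e^{a+d}, and they dominate (sS)²/2 =
  -- S²/(2n).
  · set s := 1 / √(n : ℝ) with hs
    have hs0 : 0 < s := by positivity
    have hs2 : s ^ 2 * n = 1 := by rw [hs, div_pow, hsq]; field_simp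
    have hs1 : s ≤ 1 := (div_le_one (by positivity)).2 hsqrt
    have hE : ∀ s', |s'| = s → ∫ z, Real.exp (s' * S z) ∂μ ≤ Real.exp (a + d) := fun s' hs' => by
      refine (h s').trans (Real.exp_le_exp.2 ?_)
      rw [← sq_abs, hs', mul_assoc, hs2]
      nlinarith
    calc ∫ z, S z ^ 2 ∂μ ≤ ∫ z, n * 2 * (Real.exp (s * S z) + Real.exp (-s * S z)) ∂μ := by
          refine integral_mono_of_nonneg (ae_of_all _ fun z => sq_nonneg _)
            (((hei s).add (hei (-s))).const_mul _) (ae_of_all _ fun z => ?_)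
          have h1 := Real.quadratic_le_exp_of_nonneg (abs_nonneg (s * S z))
          have h2 : Real.exp |s * S z| ≤ Real.exp (s * S z) + Real.exp (-s * S z) := by
            rw [neg_mul]; exact Real.exp_abs_le _
          have h3 : (s * S z) ^ 2 / 2 ≤ Real.exp (s * S z) + Real.exp (-s * S z) - 1 := by
            rw [sq_abs] at h1
            linarith [abs_nonneg (s * S z)]
          have h4 : S z ^ 2 = n * (s * S z) ^ 2 := by
            rw [mul_pow, ← mul_assoc, mul_comm (n : ℝ), hs2, one_mul]
          simp only [h4]
          rw [mul_assoc]
          exact mul_le_mul_of_nonneg_left (by linarith) hn0.le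
      _ ≤ n * 2 * (Real.exp (a + d) + Real.exp (a + d)) := by
          rw [integral_const_mul, integral_add (hei s) (hei (-s))]
          gcongr
          · exact hE s (abs_of_pos hs0)
          · exact hE (-s) (by rw [abs_neg, abs_of_pos hs0])
      _ = _ := by ring
  · intro t ht
    -- This minimizes a s² n - st. The neglected term d s is absorbed by completing a square, at the
    -- price of the prefactor and half of the exponent.
    set s := t / (2 * a * n) with hs
    have hs0 : 0 ≤ s := by positivity
    have hmk := mul_meas_ge_le_integral_of_nonneg (μ := μ)
      (ae_of_all _ fun z => (Real.exp_pos (s * S z)).le) (hei s) (Real.exp (s * t))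
    have hsub : {z | t ≤ S z} ⊆ {z | Real.exp (s * t) ≤ Real.exp (s * S z)} := fun z hz =>
      Real.exp_le_exp.2 (mul_le_mul_of_nonneg_left hz hs0)
    have h1 : Real.exp (s * t) * μ.real {z | t ≤ S z} ≤ Real.exp (a * s ^ 2 * n + d * |s|) :=
      (mul_le_mul_of_nonneg_left (measureReal_mono hsub) (Real.exp_pos _).le).trans
        (hmk.trans (h s))
    rw [← le_div_iff₀' (Real.exp_pos _), ← Real.exp_sub] at h1
    refine h1.trans ?_
    rw [← Real.exp_add, abs_of_nonneg hs0]
    refine Real.exp_le_exp.2 ?_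
    set y := t / √(n : ℝ) with hy
    have hy0 : 0 ≤ y := by positivity
    have e1 : t ^ 2 / n = y ^ 2 := by rw [hy, div_pow, hsq]
    have e2 : a * s ^ 2 * n = y ^ 2 / (4 * a) := by
      rw [← e1, hs]; field_simp; ring
    have e3 : s * t = y ^ 2 / (2 * a) := by rw [← e1, hs]; field_simp
    have e4 : d * s ≤ d * (y / (2 * a)) := by
      refine mul_le_mul_of_nonneg_left ?_ hd
      have : s = y / √(n : ℝ) / (2 * a) := by
        rw [hs, hy, div_div t, ← sq, hsq, div_div]; congr 1; ring
      rw [this]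
      gcongr
      exact div_le_self hy0 hsqrt
    rw [e1, e2, e3]
    have e5 : d ^ 2 / (2 * a) + -(1 / (8 * a)) * y ^ 2 - (y ^ 2 / (4 * a) + d * (y / (2 * a)) -
      y ^ 2 / (2 * a)) = (y - 2 * d) ^ 2 / (8 * a) := by field_simp; ring
    have e6 : 0 ≤ (y - 2 * d) ^ 2 / (8 * a) := by positivity
    linarith

/-- Below the threshold `x₀` the first hypothesis has no prefactor and a₁ ≥ V + x₀² suffices. Above
it the prefactor is at most exp(c' m/2), with m the minimum in the second hypothesis. The term a₁
alone handles the bound by x² and the term with a₂ alone the bound by (x√n)^κ. -/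
theorem exists_bound_constants {V C c γ : ℝ} (hV : 0 < V) (hc : 0 < c) (hγ : 0 < γ) :
    ∃ a₁ a₂ : ℝ, 0 < a₁ ∧ 0 < a₂ ∧ ∀ (x : ℝ) (n : ℕ) (p : ℝ), 0 < x → 1 ≤ n →
      p ≤ V / (V + x ^ 2) →
      (2 ≤ x → p ≤ C * Real.exp (-c * min (x ^ 2) ((x * √(n : ℝ)) ^ (1 / (1 + γ))))) →
      p ≤ Real.exp (-(x ^ 2 / (2 * (a₁ + a₂ * x * (n : ℝ) ^ (-(1 / (2 + 4 * γ)))) ^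
        ((1 + 2 * γ) / (1 + γ))))) := by
  set κ := 1 / (1 + γ) with hκ
  have hκ0 : 0 < κ := by positivity
  -- The cap at 1 gives 1/c' ≥ 1, so 1/c' ≤ (1/c')^e and the constant can be moved inside the power.
  set c' := min c 1 with hc'
  have hc'0 : 0 < c' := lt_min hc one_pos
  have hc'1 : 1 ≤ 1 / c' := (one_le_div hc'0).2 (min_le_right _ _)
  set C' := max C 1 with hC'
  have hC'1 : 1 ≤ C' := le_max_right _ _
  have hlog : 0 ≤ Real.log C' := Real.log_nonneg hC'1
  set x₀ := 2 + (2 * Real.log C' / c') ^ (1 / κ) with hx₀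
  have hx₀r : 0 ≤ (2 * Real.log C' / c') ^ (1 / κ) := by positivity
  refine ⟨1 / c' + V + x₀ ^ 2, 1 / c', by positivity, by positivity, ?_⟩
  set a₁ := 1 / c' + V + x₀ ^ 2 with ha₁
  intro x n p hx hn h1 h2
  have hn1 : (1 : ℝ) ≤ n := by exact_mod_cast hn
  have hn0 : (0 : ℝ) < n := by linarith
  set e := (1 + 2 * γ) / (1 + γ) with he
  have he1 : 1 ≤ e := by rw [he, one_le_div (by linarith)]; linarith
  set w := (1 / c') * x * (n : ℝ) ^ (-(1 / (2 + 4 * γ))) with hw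
  have hw0 : 0 ≤ w := by positivity
  have ha₁1 : 1 ≤ a₁ := by nlinarith [sq_nonneg x₀]
  have hD1 : a₁ ≤ (a₁ + w) ^ e := by
    calc a₁ ≤ a₁ + w := by linarith
      _ = (a₁ + w) ^ (1 : ℝ) := (Real.rpow_one _).symm
      _ ≤ (a₁ + w) ^ e := Real.rpow_le_rpow_of_exponent_le (by linarith) he1
  have hD0 : 0 < (a₁ + w) ^ e := by linarith
  rcases lt_or_ge x x₀ with hx0 | hx0
  · refine h1.trans ?_
    have e1 : V / (V + x ^ 2) = 1 - x ^ 2 / (V + x ^ 2) := by field_simp; ring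
    have e2 := Real.add_one_le_exp (-(x ^ 2 / (V + x ^ 2)))
    rw [e1]
    refine le_trans (by linarith) (e2.trans (Real.exp_le_exp.2 (neg_le_neg ?_)))
    refine div_le_div_of_nonneg_left (sq_nonneg _) (by positivity) ?_
    have : x ^ 2 ≤ x₀ ^ 2 := pow_le_pow_left₀ hx.le hx0.le 2
    have : 0 < 1 / c' := by positivity
    linarith
  · have hx2 : 2 ≤ x := by linarith
    have hx1 : 1 ≤ x := by linarith
    refine (h2 hx2).trans ?_
    set m := min (x ^ 2) ((x * √(n : ℝ)) ^ κ) with hm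
    have hsqrt : 1 ≤ √(n : ℝ) := Real.one_le_sqrt.2 hn1
    have hκ1 : κ ≤ 1 := by rw [hκ, div_le_one (by linarith)]; linarith
    have hxm : x ^ κ ≤ m := by
      refine le_min ?_ (Real.rpow_le_rpow hx.le (le_mul_of_one_le_right hx.le hsqrt) hκ0.le)
      rw [← Real.rpow_natCast x 2]
      exact Real.rpow_le_rpow_of_exponent_le hx1 (by push_cast; linarith)
    have hlogm : 2 * Real.log C' ≤ c' * m := by
      have h3 : 2 * Real.log C' / c' ≤ x ^ κ := by
        calc 2 * Real.log C' / c' = ((2 * Real.log C' / c') ^ (1 / κ)) ^ κ := by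
              rw [← Real.rpow_mul (by positivity), one_div_mul_cancel hκ0.ne', Real.rpow_one]
          _ ≤ x ^ κ := Real.rpow_le_rpow hx₀r (by linarith) hκ0.le
      rw [div_le_iff₀' hc'0] at h3
      exact h3.trans (mul_le_mul_of_nonneg_left hxm hc'0.le)
    have hm0 : 0 ≤ m := by positivity
    calc C * Real.exp (-c * m) ≤ C' * Real.exp (-c' * m) := by
          refine mul_le_mul (le_max_left _ _) (Real.exp_le_exp.2 ?_) (Real.exp_pos _).le
            (by linarith)
          have := mul_le_mul_of_nonneg_right (min_le_left c 1) hm0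
          linarith
      _ = Real.exp (Real.log C' + -c' * m) := by
          rw [Real.exp_add, Real.exp_log (by linarith)]
      _ ≤ Real.exp (-(c' / 2 * m)) := Real.exp_le_exp.2 (by linarith)
      _ ≤ _ := by
          refine Real.exp_le_exp.2 (neg_le_neg ?_)
          have b1 : x ^ 2 / (2 * (a₁ + w) ^ e) ≤ c' / 2 * x ^ 2 := by
            rw [div_le_iff₀ (by positivity)]
            have h3 : 1 ≤ c' * (a₁ + w) ^ e := by
              have h5 : 1 / c' ≤ (a₁ + w) ^ e := by nlinarith [sq_nonneg x₀]
              rwa [div_le_iff₀' hc'0] at h5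
            nlinarith [sq_nonneg x]
          have b2 : x ^ 2 / (2 * (a₁ + w) ^ e) ≤ c' / 2 * (x * √(n : ℝ)) ^ κ := by
            have h3 : 1 / c' * (x ^ e * (n : ℝ) ^ (-(κ / 2))) ≤ (a₁ + w) ^ e := by
              calc 1 / c' * (x ^ e * (n : ℝ) ^ (-(κ / 2)))
                  ≤ (1 / c') ^ e * (x ^ e * (n : ℝ) ^ (-(κ / 2))) := by
                    gcongr
                    calc 1 / c' = (1 / c') ^ (1 : ℝ) := (Real.rpow_one _).symm
                      _ ≤ _ := Real.rpow_le_rpow_of_exponent_le hc'1 he1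
                _ = w ^ e := by
                    rw [hw, Real.mul_rpow (by positivity) (by positivity),
                      Real.mul_rpow (by positivity) hx.le, ← Real.rpow_mul hn0.le, mul_assoc]
                    congr 3
                    rw [hκ, he]; field_simp; ring
                _ ≤ _ := Real.rpow_le_rpow hw0 (by linarith) (by linarith)
            have h4 : (x * √(n : ℝ)) ^ κ * (x ^ e * (n : ℝ) ^ (-(κ / 2))) = x ^ 2 := by
              rw [Real.mul_rpow hx.le (Real.sqrt_nonneg _), Real.sqrt_eq_rpow,
                ← Real.rpow_mul hn0.le]
              calc x ^ κ * (n : ℝ) ^ (1 / 2 * κ) * (x ^ e * (n : ℝ) ^ (-(κ / 2)))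
                  = (x ^ κ * x ^ e) * ((n : ℝ) ^ (1 / 2 * κ) * (n : ℝ) ^ (-(κ / 2))) := by ring
                _ = x ^ (2 : ℝ) * (n : ℝ) ^ (0 : ℝ) := by
                    rw [← Real.rpow_add hx, ← Real.rpow_add hn0]
                    congr 2
                    · rw [hκ, he]; field_simp; ring
                    · ring
                _ = x ^ 2 := by rw [Real.rpow_zero, mul_one]; norm_cast
            rw [div_le_iff₀ (by positivity), ← h4]
            have hk0 : 0 ≤ (x * √(n : ℝ)) ^ κ := by positivity
            have h5 : x ^ e * (n : ℝ) ^ (-(κ / 2)) ≤ c' * (a₁ + w) ^ e := by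
              rwa [one_div_mul_eq_div, div_le_iff₀' hc'0] at h3
            nlinarith [mul_le_mul_of_nonneg_left h5 hk0]
          rw [hm, mul_min_of_nonneg _ _ (by positivity)]
          exact le_min b1 b2

/-! ### Combination of the two parts and the theorem -/

/-- Variance and tail bounds for the sums `S_n φ` with constants depending only on the mixing
rate, the decay rate and the bounds on the observable. -/
theorem exists_skewSum_bound {c₁ c₂ η lam : ℝ} (hc₁ : 0 < c₁) (hc₂ : 0 < c₂) (hη : 0 < η)
    (hlam : 0 < lam) (C₀ M : ℝ≥0) : ∃ V C c : ℝ, 0 < V ∧ 0 < c ∧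
      ∀ (Ω₀ : Type*) (Y : Type*) (X : Type*)
        [MeasurableSpace Ω₀] [MeasurableSpace Y] [MeasurableSpace X]
        (Q : Measure Ω₀) [IsProbabilityMeasure Q]
        (m : Measure X) [IsProbabilityMeasure m]
        (ξ : ℤ → Ω₀ → Y) (T : Y → X → X) (v : (X → ℂ) → ℝ≥0∞)
        (h : (ℤ → Y) → X → ℝ) (K : (ℤ → Y) → ℝ) (eps : ℝ) (φ : Y → X → ℝ),
        (∀ j, Measurable (ξ j)) →
        IsStationary Q ξ →
        IsVariation m C₀ v →
        StandingAssumption (pathLaw Q ξ) m T v h K lam eps →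
        (∀ n : ℕ, 1 ≤ n → alphaCoeff Q ξ n ≤ c₁ * Real.exp (-c₂ * (n : ℝ) ^ η)) →
        Measurable (Function.uncurry φ) →
        scaledNorm (pathLaw Q ξ) m v K φ ≤ (M : ℝ≥0∞) →
        ∫ z, φ (z.1 0) z.2 ∂(skewMeasure (pathLaw Q ξ) m h) = 0 →
        ∀ (x : ℝ) (n : ℕ), 0 < x → 1 ≤ n →
          (skewMeasure (pathLaw Q ξ) m h).real {z | x * √(n : ℝ) ≤ skewSum T φ n z} ≤
            V / (V + x ^ 2) ∧
          (2 ≤ x →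
            (skewMeasure (pathLaw Q ξ) m h).real {z | x * √(n : ℝ) ≤ skewSum T φ n z} ≤
              C * Real.exp (-c * min (x ^ 2) ((x * √(n : ℝ)) ^ (η / (1 + η))))) := by
  set b : ℝ := C₀ * M with hbdef
  have hb : 0 ≤ b := by positivity
  -- One constant serves as the pointwise bound 2b on the centered observable and as the decay
  -- constant; the 1 makes it positive.
  set D : ℝ := 2 * b + C₀ * ((1 + C₀) * M + 1) + 1 with hD
  have hD0 : 0 < D := by positivity
  set r := Real.exp (-lam) with hr
  have hr0 : 0 < r := Real.exp_pos _
  have hr1 : r < 1 := Real.exp_zero ▸ Real.exp_lt_exp.2 (by linarith)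
  set D' := D / (1 - r) with hD'
  have hD'0 : 0 < D' := div_pos hD0 (by linarith)
  obtain ⟨V, C, c, hV, hC, hc, hmix⟩ := exists_mixing_tail_bound (B := 2 * b + 1)
    (ρ := 2 * lam / 3) hc₁ hc₂ hη (by linarith) (by positivity)
  set a := 2 * D' ^ 2 with ha
  set d := 3 * D' with hd
  have ha0 : 0 < a := by positivity
  have hd0 : 0 ≤ d := by positivity
  set κ := η / (1 + η) with hκ
  have hκ1 : κ ≤ 1 := by rw [hκ, div_le_one (by linarith)]; linarith
  have hκ0 : 0 < κ := by positivity
  -- The factors 2 come from (S + R)² ≤ 2S² + 2R².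
  set V' := 2 * (4 * Real.exp (a + d)) + 2 * V with hV'
  set c₃ := min (1 / (8 * a)) c / 4 with hc₃
  have hc₃0 : 0 < c₃ := by positivity
  refine ⟨V', Real.exp (d ^ 2 / (2 * a)) + C, c₃, by positivity, hc₃0, ?_⟩
  intro Ω₀ Y X _ _ _ Q _ m _ ξ T v h K eps φ hξ hs hv hA hα hφ hM h0 x n hx hn
  have hn1 : (1 : ℝ) ≤ n := by exact_mod_cast hn
  have hn0 : (0 : ℝ) < n := by linarith
  have := isProbabilityMeasure_pathLaw (Q := Q) hξ
  have hP := measurePreserving_shift (Q := Q) hξ hs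
  have hπ : MeasurePreserving (fun w => fun j : ℤ => ξ j w) Q (pathLaw Q ξ) :=
    ⟨measurable_pi_lambda _ hξ, rfl⟩
  set μ := skewMeasure (pathLaw Q ξ) m h with hμ
  have hμp : IsProbabilityMeasure μ := hA.prob
  have hτ : MeasurePreserving (skewProduct T) μ μ := hA.invariant
  have hfst : MeasurePreserving Prod.fst μ (pathLaw Q ξ) :=
    measurePreserving_fst_skewMeasure hA.measurable_h hA.h_nonneg hA.prob hA.h_mass
  set f := centered m h φ b with hf
  have hfm : Measurable f := measurable_centered hφ hA.measurable_h b
  have hfb : ∀ z, |f z| ≤ D := fun z => (abs_centered_le m h φ hb z).trans (by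
    have : 0 ≤ C₀ * ((1 + C₀) * M + 1) := by positivity
    have : (0 : ℝ) ≤ C₀ * ((1 + C₀) * M + 1) := by exact_mod_cast this
    linarith)
  set S := birkhoffSum (skewProduct T) f n with hS
  have hSm : Measurable S := measurable_birkhoffSum hτ.measurable hfm n
  have hSb : ∀ z, |S z| ≤ n * D := abs_birkhoffSum_le hfb n
  have hexp : ∀ s, ∫ z, Real.exp (s * S z) ∂μ ≤ Real.exp (a * s ^ 2 * n + d * |s|) := by
    refine fun s => integral_exp_birkhoffSum_le hτ hfm hD0 hr0 hr1 hfb (fun k hk A hAm => ?_) s n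
    refine (abs_setIntegral_iterate_le hA hv hP hφ hM hk hAm).trans ?_
    refine mul_le_mul_of_nonneg_right ?_ measureReal_nonneg
    have e : Real.exp (-lam * k) = r ^ k := by
      rw [hr, ← Real.exp_nat_mul]; congr 1; ring
    rw [e]
    exact mul_le_mul_of_nonneg_right (by linarith) (by positivity)
  obtain ⟨hSsq, hStail⟩ := sq_and_tail_of_integral_exp_le hSm hSb ha0 hd0 hn hexp
  set ψ : ℕ → (ℤ → Y) → ℝ := fun j ω => fiberMean m h φ b (shift j ω) with hψ
  set R : (ℤ → Y) → ℝ := fun ω => ∑ j ∈ Finset.range n, ψ j ω with hR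
  have hψm := measurable_fiberMean (m := m) hφ hA.measurable_h b
  have hRm : Measurable R := Finset.measurable_fun_sum _ fun j _ => hψm.comp (measurable_shift _)
  obtain ⟨hRsq, hRtail⟩ := hmix Ω₀ Y Q ξ _ _ hξ hα
    (mixingApprox_fiberMean hξ hs hA hv hφ hM h0) n hn
  have hRb : ∀ ω, |R ω| ≤ n * b := fun ω => by
    calc |R ω| ≤ ∑ j ∈ Finset.range n, |ψ j ω| := Finset.abs_sum_le_sum_abs _ _
      _ ≤ ∑ j ∈ Finset.range n, b := Finset.sum_le_sum fun j _ => abs_clip_le hb _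
      _ = n * b := by simp
  have hRsq' : ∫ z, R z.1 ^ 2 ∂μ ≤ V * n := by
    rw [integral_comp_of_measurePreserving hfst (g := fun ω => R ω ^ 2) (hRm.pow_const 2),
      ← integral_comp_of_measurePreserving hπ (g := fun ω => R ω ^ 2) (hRm.pow_const 2)]
    exact hRsq
  have hRtail' : ∀ t : ℝ, √(n : ℝ) ≤ t → μ.real {z | t ≤ R z.1} ≤
      C * Real.exp (-c * min (t ^ 2 / n) (t ^ κ)) := by
    intro t ht
    have hm : MeasurableSet {ω | t ≤ R ω} := hRm measurableSet_Ici
    have e1 : μ.real {z | t ≤ R z.1} = Q.real {w | t ≤ R fun j => ξ j w} := by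
      rw [measureReal_def, measureReal_def]
      congr 1
      exact (hfst.measure_preimage hm.nullMeasurableSet).trans
        (hπ.measure_preimage hm.nullMeasurableSet).symm
    rw [e1]
    exact hRtail t ht
  -- the sum of the truncated observables
  set G : (ℤ → Y) × X → ℝ := fun z => clip b (φ (z.1 0) z.2) with hG
  have hGm : Measurable G := (measurable_clip b).comp (measurable_observable hφ)
  have hGb : ∀ z, |G z| ≤ b := fun z => abs_clip_le hb _
  set U := birkhoffSum (skewProduct T) G n with hU
  have hUm : Measurable U := measurable_birkhoffSum hτ.measurable hGm n
  have hUb : ∀ z, |U z| ≤ n * b := abs_birkhoffSum_le hGb n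
  have hUSR : ∀ z, U z = S z + R z.1 := fun z => by
    simp only [hU, hS, hR, hψ, birkhoffSum, ← Finset.sum_add_distrib]
    refine Finset.sum_congr rfl fun j _ => ?_
    simp only [hf, hG, centered, iterate_skewProduct]
    ring
  have hUae : ∀ᵐ z ∂μ, skewSum T φ n z = U z := by
    have h1 : ∀ᵐ ω ∂(pathLaw Q ξ), ∀ j : ℕ, ∀ x, |φ ((shift j ω) 0) x| ≤ b :=
      ae_all_iff.2 fun j => (hP j).quasiMeasurePreserving.ae (ae_abs_le hv hφ hA.one_le_K hM)
    filter_upwards [hfst.quasiMeasurePreserving.ae h1] with z hz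
    simp only [skewSum, hU, birkhoffSum, iterate_skewProduct, hG]
    exact Finset.sum_congr rfl fun j _ => (clip_of_abs_le (hz j _)).symm
  have hU0 : ∫ z, U z ∂μ = 0 := by
    simp only [hU, birkhoffSum]
    have hGi : ∀ j, Integrable (fun z => G ((skewProduct T)^[j] z)) μ := fun j =>
      integrable_of_abs_le (hGm.comp (hτ.measurable.iterate j)) fun z => hGb _
    rw [integral_finsetSum _ fun j _ => hGi j]
    refine Finset.sum_eq_zero fun j _ => ?_
    rw [integral_comp_of_measurePreserving (hτ.iterate j) hGm]
    exact (integral_fiberMean_eq_zero hA hv hφ hM h0).1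
  have hUsq : ∫ z, U z ^ 2 ∂μ ≤ V' * n := by
    have i1 : Integrable (fun z => S z ^ 2) μ := by
      simpa only [sq] using integrable_mul_of_abs_le (μ := μ) hSm hSm hSb hSb
    have hR1 : Measurable fun z : (ℤ → Y) × X => R z.1 := hRm.comp measurable_fst
    have i2 : Integrable (fun z => R z.1 ^ 2) μ := by
      simpa only [sq] using integrable_mul_of_abs_le (μ := μ) hR1 hR1 (fun z => hRb z.1)
        (fun z => hRb z.1)
    calc ∫ z, U z ^ 2 ∂μ ≤ ∫ z, (2 * S z ^ 2 + 2 * R z.1 ^ 2) ∂μ := by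
          refine integral_mono_of_nonneg (ae_of_all _ fun z => sq_nonneg _)
            ((i1.const_mul 2).add (i2.const_mul 2)) (ae_of_all _ fun z => ?_)
          simp only [hUSR]
          nlinarith [sq_nonneg (S z - R z.1)]
      _ = 2 * ∫ z, S z ^ 2 ∂μ + 2 * ∫ z, R z.1 ^ 2 ∂μ := by
          rw [integral_add (i1.const_mul 2) (i2.const_mul 2), integral_const_mul,
            integral_const_mul]
      _ ≤ V' * n := by rw [hV']; linarith
  have hset : μ.real {z | x * √(n : ℝ) ≤ skewSum T φ n z} = μ.real {z | x * √(n : ℝ) ≤ U z} := by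
    refine measureReal_congr ?_
    filter_upwards [hUae] with z hz
    exact congrArg (fun y => x * √(n : ℝ) ≤ y) hz
  rw [hset]
  set t := x * √(n : ℝ) with ht
  have hsqrt : 0 < √(n : ℝ) := Real.sqrt_pos.2 hn0
  have ht0 : 0 < t := mul_pos hx hsqrt
  have ht2 : t ^ 2 / n = x ^ 2 := by
    rw [ht, mul_pow, Real.sq_sqrt hn0.le]; field_simp
  refine ⟨?_, fun hx2 => ?_⟩
  · refine (measureReal_ge_le_cantelli hUm hUb hU0 hUsq ht0).trans_eq ?_
    have e : t ^ 2 = x ^ 2 * n := by rw [← ht2]; field_simp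
    rw [e, ← add_mul, mul_div_mul_right _ _ hn0.ne']
  · have hsub : {z | t ≤ U z} ⊆ {z | t / 2 ≤ S z} ∪ {z | t / 2 ≤ R z.1} := by
      intro z hz
      by_contra hcon
      simp only [Set.mem_union, Set.mem_ofPred_eq, not_or, not_le] at hcon hz
      rw [hUSR] at hz
      linarith [hcon.1, hcon.2]
    -- The restriction x ≥ 2 enters here: half of the deviation must stay in the range t ≥ √n of the
    -- mixing tail bound.
    have hhalf : √(n : ℝ) ≤ t / 2 := by rw [ht]; nlinarith
    have hm0 : 0 ≤ min (x ^ 2) (t ^ κ) := by positivity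
    have hquarter : (t / 2) ^ 2 / n = x ^ 2 / 4 := by rw [← ht2]; ring
    have hpow : t ^ κ / 4 ≤ (t / 2) ^ κ := by
      rw [Real.div_rpow ht0.le zero_le_two]
      have : (2 : ℝ) ^ κ ≤ 2 ^ (2 : ℝ) :=
        Real.rpow_le_rpow_of_exponent_le one_le_two (by linarith)
      gcongr
      refine this.trans_eq ?_
      norm_num
    calc μ.real {z | t ≤ U z} ≤ _ := measureReal_mono hsub
      _ ≤ _ := measureReal_union_le _ _
      _ ≤ Real.exp (d ^ 2 / (2 * a)) * Real.exp (-c₃ * min (x ^ 2) (t ^ κ)) +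
          C * Real.exp (-c₃ * min (x ^ 2) (t ^ κ)) := by
          refine add_le_add ((hStail (t / 2) (by positivity)).trans ?_)
            ((hRtail' (t / 2) hhalf).trans ?_)
          · refine mul_le_mul_of_nonneg_left (Real.exp_le_exp.2 ?_) (Real.exp_pos _).le
            rw [hquarter]
            have : min (1 / (8 * a)) c * min (x ^ 2) (t ^ κ) ≤ 1 / (8 * a) * x ^ 2 :=
              mul_le_mul (min_le_left _ _) (min_le_left _ _) hm0 (by positivity)
            rw [hc₃]; linarith
          · refine mul_le_mul_of_nonneg_left (Real.exp_le_exp.2 ?_) hC.le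
            rw [hquarter]
            have h1 : min (x ^ 2) (t ^ κ) / 4 ≤ min (x ^ 2 / 4) ((t / 2) ^ κ) :=
              le_min (by linarith [min_le_left (x ^ 2) (t ^ κ)])
                (by linarith [min_le_right (x ^ 2) (t ^ κ)])
            have : min (1 / (8 * a)) c * (min (x ^ 2) (t ^ κ) / 4) ≤
                c * min (x ^ 2 / 4) ((t / 2) ^ κ) :=
              mul_le_mul (min_le_right _ _) h1 (by positivity) hc.le
            rw [hc₃]; linarith
      _ = _ := by ring

end RandomSkew

theorem mainTheorem5
    (c₁ c₂ η γ lam : ℝ) (hc₁ : 0 < c₁) (hc₂ : 0 < c₂) (hη : 0 < η) (hγ : γ = 1 / η)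
    (hlam : 0 < lam) (C₀ M : ℝ≥0) :
    ∃ a₁ a₂ : ℝ, 0 < a₁ ∧ 0 < a₂ ∧
      ∀ (Ω₀ : Type*) (Y : Type*) (X : Type*)
        [MeasurableSpace Ω₀] [MeasurableSpace Y] [MeasurableSpace X]
        (Q : Measure Ω₀) [IsProbabilityMeasure Q]
        (m : Measure X) [IsProbabilityMeasure m]
        (ξ : ℤ → Ω₀ → Y) (T : Y → X → X) (v : (X → ℂ) → ℝ≥0∞)
        (h : (ℤ → Y) → X → ℝ) (K : (ℤ → Y) → ℝ) (eps : ℝ) (φ : Y → X → ℝ),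
        (∀ j, Measurable (ξ j)) →
        RandomSkew.IsStationary Q ξ →
        RandomSkew.IsVariation m C₀ v →
        RandomSkew.StandingAssumption (RandomSkew.pathLaw Q ξ) m T v h K lam eps →
        (∀ n : ℕ, 1 ≤ n → RandomSkew.alphaCoeff Q ξ n ≤ c₁ * Real.exp (-c₂ * (n : ℝ) ^ η)) →
        Measurable (Function.uncurry φ) →
        RandomSkew.scaledNorm (RandomSkew.pathLaw Q ξ) m v K φ ≤ (M : ℝ≥0∞) →
        ∫ z, φ (z.1 0) z.2 ∂(RandomSkew.skewMeasure (RandomSkew.pathLaw Q ξ) m h) = 0 →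
        ∀ (x : ℝ) (n : ℕ), 0 < x → 1 ≤ n →
          (RandomSkew.skewMeasure (RandomSkew.pathLaw Q ξ) m h).real
              {z | x ≤ RandomSkew.skewSum T φ n z / √(n : ℝ)} ≤
            Real.exp (-(x ^ 2 /
              (2 * (a₁ + a₂ * x * (n : ℝ) ^ (-(1 / (2 + 4 * γ)))) ^
                ((1 + 2 * γ) / (1 + γ))))) := by
  have hγ0 : 0 < γ := hγ ▸ one_div_pos.2 hη
  have hκ : η / (1 + η) = 1 / (1 + γ) := by rw [hγ]; field_simp; ring
  obtain ⟨V, C, c, hV, hc, hbound⟩ :=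
    RandomSkew.exists_skewSum_bound hc₁ hc₂ hη hlam C₀ M
  obtain ⟨a₁, a₂, h₁, h₂, hfinal⟩ := RandomSkew.exists_bound_constants (C := C) hV hc hγ0
  refine ⟨a₁, a₂, h₁, h₂, ?_⟩
  intro Ω₀ Y X _ _ _ Q _ m _ ξ T v h K eps φ hξ hs hv hA hα hφ hM h0 x n hx hn
  have hn0 : (0 : ℝ) < n := by exact_mod_cast hn
  have hset : {z | x ≤ RandomSkew.skewSum T φ n z / √(n : ℝ)} =
      {z | x * √(n : ℝ) ≤ RandomSkew.skewSum T φ n z} := by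
    ext z
    exact le_div_iff₀ (Real.sqrt_pos.2 hn0)
  rw [hset]
  obtain ⟨b1, b2⟩ := hbound Ω₀ Y X Q m ξ T v h K eps φ hξ hs hv hA hα hφ hM h0 x n hx hn
  rw [hκ] at b2
  exact hfinal x n _ hx hn b1 b2
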